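/- **Conventions.** "Space" means simplicial set and "based space" means based simplicial set; $\mathcal T$ is the category of based simplicial sets. An *equivalence* is a weak homotopy equivalence of simplicial sets. The realization of a simplicial space is the diagonal of the corresponding bisimplicial set. A homotopy colimit $\operatorname{hocolim}_{\mathcal C}F$ is the unbased Bousfield–Kan one, i.e. the realization of $[k]\mapsto\coprod_{c_0\to\dots\to c_k}F(c_0)$. *$\mathcal I$-monoids.* Let $\mathcal I$ be the category with objects $\mathbf n=\{1,\dots,n\}$, $n\ge 0$, and all injective maps as morphisms; it is symmetric monoidal under concatenation $\mathbf m\sqcup\mathbf n$, with symmetry the shuffles $\tau_{m,n}\colon\mathbf m\sqcup\mathbf n\to\mathbf n\sqcup\mathbf m$. A *commutative $\mathcal I$-monoid* is a functor $X\colon\mathcal I\to\mathcal T$ with a natural transformation $\mu_{m,n}\colon X(m)\times X(n)\to X(m+n)$ of functors on $\mathcal I^2$ that is associative, has the base point of $X(0)$ as a unit, and satisfies $\tau_{m,n}\circ\mu_{m,n}=\mu_{n,m}\circ\mathrm{tw}$. Morphisms are natural transformations compatible with $\mu$. Then $X_{h\mathcal I}=\operatorname{hocolim}_{\mathcal I}X$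 is a simplicial monoid via $$X_{h\mathcal I}\times X_{h\mathcal I}=\operatorname{hocolim}_{\mathcal I\times\mathcal I}X(m)\times X(n)\xrightarrow{\ \mu\ }\operatorname{hocolim}_{\mathcal I\times\mathcal I}X(m+n)\to X_{h\mathcal I}.$$ It is *group-like* if the monoid $\pi_0X_{h\mathcal I}$ is a group. $BX_{h\mathcal I}$ denotes the realization of its bar construction $[k]\mapsto (X_{h\mathcal I})^k$. *$\Gamma$-spaces.* Let $\Gamma^o$ be the category of finite pointed sets. A *$\Gamma$-space* is a functor $A\colon\Gamma^o\to\mathcal T$ with $A(*)=*$. It is *special* if for all $S,T$ the natural map $A(S\vee T)\to A(S)\times A(T)$ is an equivalence. A special $A$ is *very special* if $\pi_0A(S^0)$, with the multiplication $\pi_0A(S^0)\times\pi_0A(S^0)\cong\pi_0A(S^0\vee S^0)\to\pi_0A(S^0)$ induced by the fold map, is a group. $A(S^1)$ denotes the realization of $[k]\mapsto A(S^1_k)$, where $S^1_\bullet=\Delta[1]/\partial\Delta[1]$. *The $\Gamma$-space of $X$.* For $S$ in $\Gamma^o$ let $\bar S=S\setminus\{*\}$ and let $\mathcal P(\bar S)$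 be the category of subsets of $\bar S$ and inclusions. Let $\mathcal D(S)$ be the category whose objects are the functors $\theta\colon\mathcal P(\bar S)\to\mathcal I$ such that $\theta_U\to\theta_{U\cup V}\leftarrow\theta_V$ is a coproduct diagram of finite sets whenever $U\cap V=\emptyset$, and whose morphisms are all natural transformations. A pointed map $\alpha\colon S\to T$ induces $\alpha_*\colon\mathcal D(S)\to\mathcal D(T)$, $(\alpha_*\theta)_U=\theta_{\alpha^{-1}(U)}$. Let $X(S)$ be the diagram $\theta\mapsto\prod_{s\in\bar S}X(\theta_{\{s\}})$ on $\mathcal D(S)$. There is a natural transformation $X(S)\to X(T)\circ\alpha_*$ with component at $t\in\bar T$ the map $\prod_{s\in\alpha^{-1}(t)}X(\theta_{\{s\}})\to X\bigl(\bigsqcup_{s\in\alpha^{-1}(t)}\theta_{\{s\}}\bigr)\to X(\theta_{\alpha^{-1}(t)})$ given by $\mu$ and by the bijection determined by $\theta$; by commutativity it does not depend on the ordering of $\alpha^{-1}(t)$. Put $X_{h\mathcal I}(S)=\operatorname{hocolim}_{\mathcal D(S)}X(S)$, with the induced maps, based at the base points of $X(0)$ over the diagram $\theta$ with all $\theta_U=\mathbf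 0$. **Proposition.** For every commutative $\mathcal I$-monoid $X$, the functor $S\mapsto X_{h\mathcal I}(S)$ is a special $\Gamma$-space, and it is very special if and only if the monoid $X_{h\mathcal I}$ is group-like. Moreover, there is a map of based spaces $BX_{h\mathcal I}\to X_{h\mathcal I}(S^1)$, natural in the commutative $\mathcal I$-monoid $X$, which is an equivalence for every $X$. -/

import Mathlib

open CategoryTheory Opposite MonoidalCategory
universe u

namespace IGamma

/-- The category of based spaces: based simplicial sets, that is, simplicial objects in pointed
sets (a base point in every degree, preserved by all simplicial operators). -/
abbrev BasedSSet : Type (u + 1) := SimplicialObject Pointed.{u}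

/-- The underlying (unbased) simplicial set. -/
abbrev underlying : BasedSSet.{u} ⥤ SSet.{u} :=
  (SimplicialObject.whiskering Pointed.{u} (Type u)).obj (forget Pointed.{u})

/-- Weak homotopy equivalences of simplicial sets: `f : X ⟶ Y` such that for every Kan complex
`Z`, precomposition with `f` induces a bijection `π₀ Fun(Y, Z) → π₀ Fun(X, Z)`. -/
def IsWeakEquivalence {X Y : SSet.{u}} (f : X ⟶ Y) : Prop :=
  ∀ Z : SSet.{u}, SSet.KanComplex Z →
    Function.Bijective (SSet.mapπ₀ ((MonoidalClosed.pre f).app Z))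

/-- The realization of a simplicial (based) space `[k] ↦ B_k`: the diagonal `k ↦ (B_k)_k` of the
bisimplicial set. -/
def diag : SimplicialObject BasedSSet.{u} ⥤ BasedSSet.{u} where
  obj B :=
    { obj := fun k => (B.obj k).obj k
      map := fun {k l} φ => (B.map φ).app k ≫ (B.obj l).map φ
      map_comp := by
        intro k l m φ ψ
        simp }
  map f :=
    { app := fun k => (f.app k).app k
      naturality := by
        intro k l φ
        have h := congrArg (fun t => NatTrans.app t k) (f.naturality φ)
        simp only [NatTrans.comp_app] at h
        simp only [Category.assoc, NatTrans.naturality]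
        rw [← Category.assoc, ← Category.assoc, h] }

section hocolim
variable {C D E : Type} [Category.{0} C] [Category.{0} D] [Category.{0} E]

/-- A `k`-simplex of the homotopy colimit of `F`: a chain `c₀ ⟶ ⋯ ⟶ c_k` in the indexing category
together with a `k`-simplex of `F(c₀)`. -/
abbrev HocolimSimplex (F : C ⥤ SSet.{u}) (k : SimplexCategoryᵒᵖ) : Type u :=
  Σ c : ComposableArrows C k.unop.len, (F.obj (c.obj 0)).obj k

/-- The simplicial operators on the homotopy colimit: they act on the chain as in the nerve and on
the simplex of `F(c₀)` through `F(c₀) ⟶ F(c_{φ(0)})`. -/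
def hocolimOp (F : C ⥤ SSet.{u}) {k l : SimplexCategoryᵒᵖ} (φ : k ⟶ l)
    (p : HocolimSimplex F k) :
    HocolimSimplex F l :=
  ⟨(nerve C).map φ p.1,
    (F.map (p.1.map (homOfLE (Fin.zero_le (φ.unop.toOrderHom 0))))).app l
      ((F.obj (p.1.obj 0)).map φ p.2)⟩

lemma hocolimOp_id (F : C ⥤ SSet.{u}) {k : SimplexCategoryᵒᵖ}
    (p : HocolimSimplex F k) :
    hocolimOp F (𝟙 k) p = p := by
  obtain ⟨c, x⟩ := p
  refine Sigma.ext (by rfl) (heq_of_eq ?_)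
  change (F.map (c.map (𝟙 (0 : Fin (k.unop.len + 1))))).app k ((F.obj (c.obj 0)).map (𝟙 k) x) = x
  simp

lemma hocolimOp_comp (F : C ⥤ SSet.{u}) {k l m : SimplexCategoryᵒᵖ} (φ : k ⟶ l) (ψ : l ⟶ m)
    (p : HocolimSimplex F k) :
    hocolimOp F (φ ≫ ψ) p = hocolimOp F ψ (hocolimOp F φ p) := by
  obtain ⟨c, x⟩ := p
  refine Sigma.ext (by rfl) (heq_of_eq ?_)
  have h0 : φ.unop.toOrderHom 0 ≤ φ.unop.toOrderHom (ψ.unop.toOrderHom 0) :=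
    φ.unop.toOrderHom.monotone (Fin.zero_le _)
  change (F.map (c.map (homOfLE (Fin.zero_le (φ.unop.toOrderHom (ψ.unop.toOrderHom 0)))))).app m
      ((F.obj (c.obj 0)).map (φ ≫ ψ) x) =
    (F.map (c.map (homOfLE h0))).app m ((F.obj (c.obj (φ.unop.toOrderHom 0))).map ψ
      ((F.map (c.map (homOfLE (Fin.zero_le (φ.unop.toOrderHom 0))))).app l
        ((F.obj (c.obj 0)).map φ x)))
  rw [← homOfLE_comp (Fin.zero_le (φ.unop.toOrderHom 0)) h0, c.map_comp, F.map_comp,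
    Functor.map_comp]
  simp only [SSet.comp_app, ConcreteCategory.comp_apply]
  rw [NatTrans.naturality_apply]

/-- The (unbased) homotopy colimit of a diagram of simplicial sets, by the Bousfield-Kan
formula: the diagonal of the simplicial replacement `[k] ↦ ∐_{c₀ ⟶ ⋯ ⟶ c_k} F(c₀)`. -/
def hocolim (F : C ⥤ SSet.{u}) : SSet.{u} where
  obj k := HocolimSimplex F k
  map φ := ↾hocolimOp F φ
  map_id k := by
    exact ConcreteCategory.hom_ext _ _ (fun p => hocolimOp_id F p)
  map_comp φ ψ := by
    exact ConcreteCategory.hom_ext _ _ (fun p => hocolimOp_comp F φ ψ p)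

lemma hocolim_ext {F : C ⥤ SSet.{u}} {k : SimplexCategoryᵒᵖ} {p q : HocolimSimplex F k}
    (h : ∀ i, p.1.obj i = q.1.obj i)
    (hm : ∀ (i j : Fin (k.unop.len + 1)) (f : i ⟶ j),
      p.1.map f ≫ eqToHom (h j) = eqToHom (h i) ≫ q.1.map f)
    (hx : (F.map (eqToHom (h 0))).app k p.2 = q.2) : p = q := by
  obtain ⟨c, x⟩ := p
  obtain ⟨d, y⟩ := q
  have hcd : c = d := CategoryTheory.Functor.ext h (fun i j f => by
    have := hm i j f
    simp only at this
    rw [← Category.assoc, ← this]; simp)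
  subst hcd
  refine Sigma.ext rfl (heq_of_eq ?_)
  simpa using hx

/-- The map of homotopy colimits given by a functor `Φ` of indexing categories and a natural
transformation `F ⟶ Φ ⋙ G`. -/
def hocolimMap {F : C ⥤ SSet.{u}} {G : D ⥤ SSet.{u}} (Φ : C ⥤ D) (η : F ⟶ Φ ⋙ G) :
    hocolim F ⟶ hocolim G where
  app k := ↾fun p => ⟨p.1 ⋙ Φ, (η.app (p.1.obj 0)).app k p.2⟩
  naturality {k l} φ := by
    ext ⟨c, x⟩
    refine Sigma.ext (by rfl) (heq_of_eq ?_)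
    change (η.app _).app l ((F.map (c.map (homOfLE (Fin.zero_le (φ.unop.toOrderHom 0))))).app l
      ((F.obj (c.obj 0)).map φ x)) =
      (G.map (Φ.map (c.map (homOfLE (Fin.zero_le (φ.unop.toOrderHom 0)))))).app l
        ((G.obj (Φ.obj (c.obj 0))).map φ ((η.app (c.obj 0)).app k x))
    have h1 := ConcreteCategory.congr_hom (congrArg (fun t => NatTrans.app t l)
      (η.naturality (c.map (homOfLE (Fin.zero_le (φ.unop.toOrderHom 0))))))
        ((F.obj (c.obj 0)).map φ x)
    have h2 := ConcreteCategory.congr_hom ((η.app (c.obj 0)).naturality φ) x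
    refine h1.trans ?_
    exact congrArg _ h2

end hocolim

/-- The bar construction `B_• M` of a monoid, the nerve of the category with one object and
endomorphism monoid `M`. A `k`-simplex is a sequence `(g₁, …, g_k)`, with `d_i` multiplying `g_i g_{i+1}`
for `0 < i < k`. Composition in `SingleObj N` is `f ≫ g = g * f`, hence the opposite monoid. -/
def bar : MonCat.{u} ⥤ BasedSSet.{u} where
  obj M :=
    { obj := fun k => Pointed.of (X := (nerve (SingleObj (M : Type u)ᵐᵒᵖ)).obj k)
        ((Functor.const _).obj (SingleObj.star _))
      map := fun φ => ⟨(nerve (SingleObj (M : Type u)ᵐᵒᵖ)).map φ, rfl⟩ }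
  map f :=
    { app := fun k => ⟨(nerveMap (SingleObj.mapHom _ _ (MonoidHom.op f.hom))).app k, by
        refine CategoryTheory.Functor.ext (fun _ => rfl) (fun i j g => ?_)
        change (SingleObj.mapHom _ _ (MonoidHom.op f.hom)).map (𝟙 _) = _
        simp
        rfl⟩}

/-- Simplicial monoids, the topological monoids of the simplicial setting. -/
abbrev SimplicialMonoid : Type (u + 1) := SimplicialObject MonCat.{u}

/-- The classifying space `BG` of a simplicial monoid `G`: the realization of `[k] ↦ B_k G = G^k`. -/
def barConstruction : SimplicialMonoid.{u} ⥤ BasedSSet.{u} :=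
  (SimplicialObject.whiskering _ _).obj bar ⋙ diag

/-- The category `I`: objects are the finite sets `{1, …, n}`, morphisms are all injective maps. -/
structure FinInj : Type where
  card : ℕ

namespace FinInj

instance : Category.{0} FinInj where
  Hom m n := Fin m.card ↪ Fin n.card
  id m := Function.Embedding.refl _
  comp f g := f.trans g

@[ext] lemma hom_ext {m n : FinInj} {f g : m ⟶ n} (h : ∀ i, f.toFun i = g.toFun i) : f = g :=
  Function.Embedding.ext h

@[simp] lemma id_toFun (m : FinInj) (i : Fin m.card) : (𝟙 m : m ⟶ m).toFun i = i := rfl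

@[simp] lemma comp_toFun {l m n : FinInj} (f : l ⟶ m) (g : m ⟶ n) (i : Fin l.card) :
    (f ≫ g).toFun i = g.toFun (f.toFun i) := rfl

/-- The empty set. -/
def zero : FinInj := ⟨0⟩

/-- Concatenation `m ⊔ n`. -/
def sum (m n : FinInj) : FinInj := ⟨m.card + n.card⟩

/-- Concatenation of injective maps. -/
def sumMap {m m' n n' : FinInj} (f : m ⟶ m') (g : n ⟶ n') : sum m n ⟶ sum m' n' :=
  (finSumFinEquiv.symm.toEmbedding.trans (Function.Embedding.sumMap f g)).trans
    finSumFinEquiv.toEmbedding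

/-- The symmetry `m ⊔ n ⟶ n ⊔ m`, sending `i ≤ m` to `i + n` and `m + i` to `i`. -/
def shuffle (m n : FinInj) : sum m n ⟶ sum n m := (finAddFlip (m := m.card) (n := n.card)).toEmbedding

/-- The identity map between equal finite sets. -/
def castHom {m n : FinInj} (h : m.card = n.card) : m ⟶ n := (finCongr h).toEmbedding

/-- The inclusion as the first elements. -/
def inl (m n : FinInj) : m ⟶ sum m n := Fin.castAddEmb n.card
/-- The inclusion as the last elements. -/
def inr (m n : FinInj) : n ⟶ sum m n := Fin.natAddEmb m.card

lemma sum_hom_ext {m n p : FinInj} {f g : sum m n ⟶ p} (h₁ : inl m n ≫ f = inl m n ≫ g)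
    (h₂ : inr m n ≫ f = inr m n ≫ g) : f = g := by
  ext i
  induction i using Fin.addCases with
  | left i => exact congrArg Fin.val (congrArg (fun e : m ⟶ p => e.toFun i) h₁)
  | right i => exact congrArg Fin.val (congrArg (fun e : n ⟶ p => e.toFun i) h₂)


@[simp] lemma inl_toFun (m n : FinInj) (i : Fin m.card) :
    (inl m n).toFun i = Fin.castAdd n.card i := rfl

@[simp] lemma inr_toFun (m n : FinInj) (i : Fin n.card) :
    (inr m n).toFun i = Fin.natAdd m.card i := rfl

@[simp]
lemma inl_sumMap {m m' n n' : FinInj} (f : m ⟶ m') (g : n ⟶ n') :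
    inl m n ≫ sumMap f g = f ≫ inl m' n' := by
  apply hom_ext
  intro i
  change finSumFinEquiv (Sum.map f.toFun g.toFun (finSumFinEquiv.symm (Fin.castAdd n.card i))) = _
  rw [finSumFinEquiv_symm_apply_castAdd]
  rfl

@[simp]
lemma inl_sumMap_assoc {m m' n n' p : FinInj} (f : m ⟶ m') (g : n ⟶ n') (h : sum m' n' ⟶ p) :
    inl m n ≫ sumMap f g ≫ h = f ≫ inl m' n' ≫ h := by
  rw [← Category.assoc, inl_sumMap, Category.assoc]

@[simp]
lemma inr_sumMap {m m' n n' : FinInj} (f : m ⟶ m') (g : n ⟶ n') :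
    inr m n ≫ sumMap f g = g ≫ inr m' n' := by
  apply hom_ext
  intro i
  change finSumFinEquiv (Sum.map f.toFun g.toFun (finSumFinEquiv.symm (Fin.natAdd m.card i))) = _
  rw [finSumFinEquiv_symm_apply_natAdd]
  rfl

@[simp]
lemma inr_sumMap_assoc {m m' n n' p : FinInj} (f : m ⟶ m') (g : n ⟶ n') (h : sum m' n' ⟶ p) :
    inr m n ≫ sumMap f g ≫ h = g ≫ inr m' n' ≫ h := by
  rw [← Category.assoc, inr_sumMap, Category.assoc]

@[simp]
lemma inl_shuffle (m n : FinInj) : inl m n ≫ shuffle m n = inr n m := by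
  apply hom_ext
  intro i
  exact finAddFlip_apply_castAdd i n.card

@[simp]
lemma inl_shuffle_assoc (m n : FinInj) {p : FinInj} (h : sum n m ⟶ p) :
    inl m n ≫ shuffle m n ≫ h = inr n m ≫ h := by
  rw [← Category.assoc, inl_shuffle]

@[simp]
lemma inr_shuffle (m n : FinInj) : inr m n ≫ shuffle m n = inl n m := by
  apply hom_ext
  intro i
  exact finAddFlip_apply_natAdd i m.card

@[simp]
lemma inr_shuffle_assoc (m n : FinInj) {p : FinInj} (h : sum n m ⟶ p) :
    inr m n ≫ shuffle m n ≫ h = inl n m ≫ h := by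
  rw [← Category.assoc, inr_shuffle]

lemma eqToHom_eq {m n : FinInj} (h : m = n) : eqToHom h = castHom (congrArg card h) := by
  subst h; rfl

@[simp] lemma sumMap_id (m n : FinInj) : sumMap (𝟙 m) (𝟙 n) = 𝟙 (sum m n) :=
  sum_hom_ext (by simp) (by simp)

lemma sumMap_comp {m m' m'' n n' n'' : FinInj} (f : m ⟶ m') (f' : m' ⟶ m'') (g : n ⟶ n')
    (g' : n' ⟶ n'') : sumMap (f ≫ f') (g ≫ g') = sumMap f g ≫ sumMap f' g' :=
  sum_hom_ext (by simp) (by simp)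

lemma zero_hom_ext {n : FinInj} (f g : zero ⟶ n) : f = g := by
  apply hom_ext
  intro i
  exact i.elim0

/-- The identification `(l ⊔ m) ⊔ n = l ⊔ (m ⊔ n)`. -/
def assoc (l m n : FinInj) : sum (sum l m) n ⟶ sum l (sum m n) := castHom (Nat.add_assoc _ _ _)

@[simp]
lemma inl_inl_assoc (l m n : FinInj) :
    inl l m ≫ inl (sum l m) n ≫ assoc l m n = inl l (sum m n) := rfl

@[simp]
lemma inl_inl_assoc_assoc (l m n : FinInj) {p : FinInj} (h : sum l (sum m n) ⟶ p) :
    inl l m ≫ inl (sum l m) n ≫ assoc l m n ≫ h = inl l (sum m n) ≫ h := rfl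

@[simp]
lemma inr_inl_assoc (l m n : FinInj) :
    inr l m ≫ inl (sum l m) n ≫ assoc l m n = inl m n ≫ inr l (sum m n) := rfl

@[simp]
lemma inr_inl_assoc_assoc (l m n : FinInj) {p : FinInj} (h : sum l (sum m n) ⟶ p) :
    inr l m ≫ inl (sum l m) n ≫ assoc l m n ≫ h = inl m n ≫ inr l (sum m n) ≫ h := rfl

@[simp]
lemma inr_assoc (l m n : FinInj) :
    inr (sum l m) n ≫ assoc l m n = inr m n ≫ inr l (sum m n) := by
  apply hom_ext
  intro i
  exact Fin.ext (Nat.add_assoc l.card m.card i)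

@[simp]
lemma inr_assoc_assoc (l m n : FinInj) {p : FinInj} (h : sum l (sum m n) ⟶ p) :
    inr (sum l m) n ≫ assoc l m n ≫ h = inr m n ≫ inr l (sum m n) ≫ h := by
  rw [← Category.assoc, inr_assoc, Category.assoc]

/-- The identification `0 ⊔ n = n`. -/
def leftUnit (n : FinInj) : sum zero n ⟶ n := castHom (Nat.zero_add _)

/-- The identification `n ⊔ 0 = n`. -/
def rightUnit (n : FinInj) : sum n zero ⟶ n := castHom (Nat.add_zero _)

@[simp]
lemma inr_leftUnit (n : FinInj) : inr zero n ≫ leftUnit n = 𝟙 n := by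
  apply hom_ext
  intro i
  exact Fin.ext (Nat.zero_add i)

@[simp]
lemma inr_leftUnit_assoc (n : FinInj) {p : FinInj} (h : n ⟶ p) :
    inr zero n ≫ leftUnit n ≫ h = h := by
  rw [← Category.assoc, inr_leftUnit, Category.id_comp]

@[simp]
lemma inl_rightUnit (n : FinInj) : inl n zero ≫ rightUnit n = 𝟙 n := rfl

@[simp]
lemma inl_rightUnit_assoc (n : FinInj) {p : FinInj} (h : n ⟶ p) :
    inl n zero ≫ rightUnit n ≫ h = h := rfl

lemma assoc_naturality {l m n l' m' n' : FinInj} (f : l ⟶ l') (g : m ⟶ m') (h : n ⟶ n') :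
    sumMap (sumMap f g) h ≫ assoc l' m' n' = assoc l m n ≫ sumMap f (sumMap g h) :=
  sum_hom_ext (sum_hom_ext (by simp) (by simp)) (by simp)

lemma leftUnit_naturality {n n' : FinInj} (g : n ⟶ n') :
    sumMap (𝟙 zero) g ≫ leftUnit n' = leftUnit n ≫ g :=
  sum_hom_ext (zero_hom_ext _ _) (by simp)

lemma rightUnit_naturality {n n' : FinInj} (g : n ⟶ n') :
    sumMap g (𝟙 zero) ≫ rightUnit n' = rightUnit n ≫ g :=
  sum_hom_ext (by simp) (zero_hom_ext _ _)

end FinInj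

open FinInj

/-- A commutative `I`-monoid: a functor `X` from `I` to based spaces with a natural transformation
`μ_{m,n} : X(m) × X(n) ⟶ X(m + n)` of functors on `I × I` (here given on simplices) which is unital with
respect to the base point of `X(0)`, associative and commutative. (That `μ` preserves base points
follows, see `CommIMonoid.mul_point`.) -/
structure CommIMonoid where
  space : FinInj ⥤ BasedSSet.{u}
  mul : ∀ {m n : FinInj} {k : SimplexCategoryᵒᵖ},
    (space.obj m).obj k → (space.obj n).obj k → (space.obj (sum m n)).obj k
  map_mul : ∀ {m n : FinInj} {k l : SimplexCategoryᵒᵖ} (φ : k ⟶ l) (x : (space.obj m).obj k)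
    (y : (space.obj n).obj k),
    ((space.obj (sum m n)).map φ).toFun (mul x y) =
      mul (((space.obj m).map φ).toFun x) (((space.obj n).map φ).toFun y)
  mul_natural : ∀ {m m' n n' : FinInj} (f : m ⟶ m') (g : n ⟶ n') {k : SimplexCategoryᵒᵖ}
    (x : (space.obj m).obj k) (y : (space.obj n).obj k),
    ((space.map (sumMap f g)).app k).toFun (mul x y) =
      mul (((space.map f).app k).toFun x) (((space.map g).app k).toFun y)
  one_mul : ∀ {n : FinInj} {k : SimplexCategoryᵒᵖ} (x : (space.obj n).obj k),
    ((space.map (leftUnit n)).app k).toFun (mul ((space.obj zero).obj k).point x) = x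
  mul_one : ∀ {n : FinInj} {k : SimplexCategoryᵒᵖ} (x : (space.obj n).obj k),
    ((space.map (rightUnit n)).app k).toFun (mul x ((space.obj zero).obj k).point) = x
  mul_assoc : ∀ {l m n : FinInj} {k : SimplexCategoryᵒᵖ} (x : (space.obj l).obj k)
    (y : (space.obj m).obj k) (z : (space.obj n).obj k),
    ((space.map (FinInj.assoc l m n)).app k).toFun (mul (mul x y) z) = mul x (mul y z)
  mul_comm : ∀ {m n : FinInj} {k : SimplexCategoryᵒᵖ} (x : (space.obj m).obj k)
    (y : (space.obj n).obj k),
    ((space.map (shuffle m n)).app k).toFun (mul x y) = mul y x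

lemma hocolim_ext_cast {F : FinInj ⥤ SSet.{u}} {k : SimplexCategoryᵒᵖ}
    {p q : HocolimSimplex F k} (h : ∀ i, (p.1.obj i).card = (q.1.obj i).card)
    (hm : ∀ (i j : Fin (k.unop.len + 1)) (f : i ⟶ j),
      p.1.map f ≫ castHom (h j) = castHom (h i) ≫ q.1.map f)
    (hx : (F.map (castHom (h 0))).app k p.2 = q.2) : p = q := by
  refine hocolim_ext (fun i => congrArg FinInj.mk (h i)) (fun i j f => ?_) ?_
  · rw [eqToHom_eq, eqToHom_eq]
    exact hm i j f
  · rw [eqToHom_eq]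
    exact hx

namespace CommIMonoid

/-- Morphisms of commutative `I`-monoids: multiplicative natural transformations of functors to
based spaces. -/
@[ext]
structure Hom (X Y : CommIMonoid.{u}) where
  natTrans : X.space ⟶ Y.space
  map_mul : ∀ {m n : FinInj} {k : SimplexCategoryᵒᵖ} (x : (X.space.obj m).obj k)
    (y : (X.space.obj n).obj k),
    ((natTrans.app (sum m n)).app k).toFun (X.mul x y) =
      Y.mul (((natTrans.app m).app k).toFun x) (((natTrans.app n).app k).toFun y)

instance : Category CommIMonoid.{u} where
  Hom := Hom
  id X := ⟨𝟙 _, fun _ _ => rfl⟩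
  comp f g := ⟨f.natTrans ≫ g.natTrans, fun x y => by
    have h1 := f.map_mul x y
    have h2 := g.map_mul (((f.natTrans.app _).app _).toFun x) (((f.natTrans.app _).app _).toFun y)
    exact (congrArg _ h1).trans h2⟩

/-- The diagram of underlying spaces. -/
abbrev diagram (X : CommIMonoid.{u}) : FinInj ⥤ SSet.{u} := X.space ⋙ underlying

/-- Concatenation of chains in `I`: the functor `⊔ : I × I ⥤ I` applied to a chain in `I × I`. -/
def sumChain {n : ℕ} (c d : ComposableArrows FinInj n) : ComposableArrows FinInj n where
  obj i := sum (c.obj i) (d.obj i)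
  map f := sumMap (c.map f) (d.map f)
  map_id i := by simp
  map_comp f g := by simp [sumMap_comp]

/-- The constant chain at the initial object `0`. -/
def zeroChain (n : ℕ) : ComposableArrows FinInj n := (Functor.const _).obj zero

variable (X : CommIMonoid.{u})

/-- The monoid structure on `X_{hI} = hocolim_I X`, on `k`-simplices: the composite
`X_{hI} × X_{hI} = hocolim_{I × I} X(m) × X(n) ⟶ hocolim_{I × I} X(m + n) ⟶ X_{hI}`.
The unit is the base point of `X(0)`. -/
instance hMonoid (k : SimplexCategoryᵒᵖ) : Monoid (HocolimSimplex X.diagram k) where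
  mul p q := ⟨sumChain p.1 q.1, X.mul p.2 q.2⟩
  one := ⟨zeroChain _, ((X.space.obj zero).obj k).point⟩
  mul_assoc p q r := hocolim_ext_cast (fun _ => Nat.add_assoc _ _ _)
    (fun _ _ _ => assoc_naturality _ _ _) (X.mul_assoc p.2 q.2 r.2)
  one_mul p := hocolim_ext_cast (fun _ => Nat.zero_add _)
    (fun _ _ _ => leftUnit_naturality _) (X.one_mul p.2)
  mul_one p := hocolim_ext_cast (fun _ => Nat.add_zero _)
    (fun _ _ _ => rightUnit_naturality _) (X.mul_one p.2)

/-- The simplicial operators of `X_{hI}` are monoid homomorphisms. -/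
def hMonoidMap {k l : SimplexCategoryᵒᵖ} (φ : k ⟶ l) :
    HocolimSimplex X.diagram k →* HocolimSimplex X.diagram l where
  toFun := hocolimOp X.diagram φ
  map_one' := by
    refine Sigma.ext (by rfl) (heq_of_eq ?_)
    change ((X.space.map (𝟙 zero)).app l).toFun (((X.space.obj zero).map φ).toFun
      ((X.space.obj zero).obj k).point) = ((X.space.obj zero).obj l).point
    rw [CategoryTheory.Functor.map_id, Pointed.Hom.map_point]
    rfl
  map_mul' p q := by
    refine Sigma.ext (by rfl) (heq_of_eq ?_)
    refine (congrArg _ (X.map_mul φ p.2 q.2)).trans ?_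
    exact X.mul_natural _ _ _ _

/-- The simplicial monoid `X_{hI}`. -/
def hSimplicialMonoid : SimplicialMonoid.{u} where
  obj k := MonCat.of (HocolimSimplex X.diagram k)
  map φ := MonCat.ofHom (X.hMonoidMap φ)
  map_id k := by
    exact MonCat.hom_ext (MonoidHom.ext fun p => hocolimOp_id _ p)
  map_comp φ ψ := by
    exact MonCat.hom_ext (MonoidHom.ext fun p => hocolimOp_comp _ φ ψ p)

/-- The map `X_{hI} ⟶ Y_{hI}` induced by a morphism. -/
def hMap {X Y : CommIMonoid.{u}} (f : X ⟶ Y) : hocolim X.diagram ⟶ hocolim Y.diagram :=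
  hocolimMap (G := Y.diagram) (𝟭 FinInj) (Functor.whiskerRight f.natTrans underlying)

/-- The functor `X ↦ X_{hI}` from commutative `I`-monoids to simplicial monoids. -/
def hMonoidFunctor : CommIMonoid.{u} ⥤ SimplicialMonoid.{u} where
  obj X := X.hSimplicialMonoid
  map {X Y} f :=
    { app := fun k => MonCat.ofHom
        { toFun := (hMap f).app k
          map_one' := by
            refine Sigma.ext (by rfl) (heq_of_eq ?_)
            exact ((f.natTrans.app zero).app k).map_point
          map_mul' := fun p q => by
            refine Sigma.ext (by rfl) (heq_of_eq ?_)
            exact f.map_mul p.2 q.2 }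
      naturality := fun k l φ => by
        ext p
        exact ConcreteCategory.congr_hom ((hMap f).naturality φ) p }
  map_id X := by
    ext k p
    rfl
  map_comp f g := by
    ext k p
    rfl


/-- The map induced by `f : m ⟶ n`, on `k`-simplices. -/
def act {m n : FinInj} (f : m ⟶ n) {k : SimplexCategoryᵒᵖ} (x : (X.space.obj m).obj k) :
    (X.space.obj n).obj k := ((X.space.map f).app k).toFun x

variable {X}

@[simp] lemma act_id {m : FinInj} {k : SimplexCategoryᵒᵖ} (x : (X.space.obj m).obj k) :
    X.act (𝟙 m) x = x := by
  simp [act]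

lemma act_comp {l m n : FinInj} (f : l ⟶ m) (g : m ⟶ n) {k : SimplexCategoryᵒᵖ}
    (x : (X.space.obj l).obj k) : X.act (f ≫ g) x = X.act g (X.act f x) := by
  simp [act]

lemma act_point {m n : FinInj} (f : m ⟶ n) (k : SimplexCategoryᵒᵖ) :
    X.act f ((X.space.obj m).obj k).point = ((X.space.obj n).obj k).point :=
  ((X.space.map f).app k).map_point

lemma mul_act_left {m m' n : FinInj} (f : m ⟶ m') {k : SimplexCategoryᵒᵖ}
    (x : (X.space.obj m).obj k) (y : (X.space.obj n).obj k) :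
    X.mul (X.act f x) y = X.act (sumMap f (𝟙 n)) (X.mul x y) := by
  have h := X.mul_natural f (𝟙 n) x y
  have h' : ((X.space.map (𝟙 n)).app k).toFun y = y := act_id y
  rw [h'] at h
  exact h.symm

lemma mul_act_right {m n n' : FinInj} (g : n ⟶ n') {k : SimplexCategoryᵒᵖ}
    (x : (X.space.obj m).obj k) (y : (X.space.obj n).obj k) :
    X.mul x (X.act g y) = X.act (sumMap (𝟙 m) g) (X.mul x y) := by
  have h := X.mul_natural (𝟙 m) g x y
  have h' : ((X.space.map (𝟙 m)).app k).toFun x = x := act_id x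
  rw [h'] at h
  exact h.symm

end CommIMonoid

/-! ### Sum diagrams -/

/-- The category `Γᵒ` of finite pointed sets and pointed maps. -/
abbrev FinPointed := ObjectProperty.FullSubcategory (fun S : Pointed.{0} => Finite S)

/-- The poset (category) of subsets of `S̄ = S ∖ {*}`, realized as the subsets of `S` that do not
contain the base point. -/
abbrev Subsets (S : Pointed.{0}) : Type := {U : Set S // S.point ∉ U}

namespace Subsets

variable {S T : Pointed.{0}}

/-- The union of two subsets. -/
def union (U V : Subsets S) : Subsets S := ⟨U.1 ∪ V.1, fun h => h.elim U.2 V.2⟩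

/-- The empty subset. -/
def empty (S : Pointed.{0}) : Subsets S := ⟨∅, fun h => h⟩

/-- The one-point subset `{s}`, for `s ∈ S̄`. -/
def single (s : {s : S // s ≠ S.point}) : Subsets S := ⟨{s.1}, fun h => s.2 h.symm⟩

lemma le_union_left (U V : Subsets S) : U ≤ union U V := fun _ h => Or.inl h

lemma le_union_right (U V : Subsets S) : V ≤ union U V := fun _ h => Or.inr h

/-- The preimage `α⁻¹(U)` of a subset `U` of `T̄`. -/
def preimage (α : S ⟶ T) (U : Subsets T) : Subsets S :=
  ⟨α.toFun ⁻¹' U.1, fun h => U.2 (by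
    have h' : α.toFun S.point ∈ U.1 := h
    rwa [α.map_point] at h')⟩

/-- The functor `α^*` on categories of subsets, `U ↦ α⁻¹(U)`. -/
def pullback (α : S ⟶ T) : Subsets T ⥤ Subsets S where
  obj U := preimage α U
  map f := homOfLE (fun _ h => leOfHom f h)

end Subsets

open Subsets

/-- `θ` takes disjoint unions to coproducts of finite sets: if `U ∩ V = ∅`, the maps
`θ_U ⟶ θ_{U ∪ V}` and `θ_V ⟶ θ_{U ∪ V}` induce a bijection from the disjoint union of `θ_U` and `θ_V` to
`θ_{U ∪ V}`. -/
def IsSumDiagram (S : Pointed.{0}) : ObjectProperty (Subsets S ⥤ FinInj) := fun θ =>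
  ∀ U V : Subsets S, Disjoint U.1 V.1 →
    Function.Bijective (Sum.elim (θ.map (homOfLE (le_union_left U V))).toFun
      (θ.map (homOfLE (le_union_right U V))).toFun)

/-- The category `D(S)` of `S̄`-indexed sum diagrams in `I`, with all natural transformations as
morphisms. -/
abbrev SumDiagram (S : Pointed.{0}) : Type := (IsSumDiagram S).FullSubcategory

namespace SumDiagram

variable {S T : Pointed.{0}}

/-- The functor `α_* : D(S) ⥤ D(T)`, `α_* θ = θ ∘ α^*`. -/
def pushforward (α : S ⟶ T) : SumDiagram S ⥤ SumDiagram T where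
  obj θ := ⟨pullback α ⋙ θ.obj, fun U V h => θ.property (preimage α U) (preimage α V)
    (h.preimage α.toFun)⟩
  map f := ObjectProperty.homMk (Functor.whiskerLeft (pullback α) f.hom)

/-- The sum diagram with all values the empty set. -/
def zero (S : Pointed.{0}) : SumDiagram S :=
  ⟨(Functor.const _).obj FinInj.zero, fun _ _ _ =>
    ⟨fun a => Sum.elim (fun i => i.elim0) (fun i => i.elim0) a, fun i => i.elim0⟩⟩

/-- The bijection `θ_U ⊔ θ_V ⟶ θ_{U ∪ V}` for disjoint `U` and `V`. -/
def glue (θ : SumDiagram S) (U V : Subsets S) (h : Disjoint U.1 V.1) :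
    FinInj.sum (θ.obj.obj U) (θ.obj.obj V) ⟶ θ.obj.obj (union U V) :=
  finSumFinEquiv.symm.toEmbedding.trans ⟨_, (θ.property U V h).1⟩

@[simp]
lemma inl_glue (θ : SumDiagram S) (U V : Subsets S) (h : Disjoint U.1 V.1) :
    inl _ _ ≫ θ.glue U V h = θ.obj.map (homOfLE (le_union_left U V)) := by
  apply FinInj.hom_ext
  intro i
  change Sum.elim _ _ (finSumFinEquiv.symm (Fin.castAdd _ i)) = _
  rw [finSumFinEquiv_symm_apply_castAdd]
  rfl

@[simp]
lemma inl_glue_assoc (θ : SumDiagram S) (U V : Subsets S) (h : Disjoint U.1 V.1) {p : FinInj}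
    (g : θ.obj.obj (union U V) ⟶ p) :
    inl _ _ ≫ θ.glue U V h ≫ g = θ.obj.map (homOfLE (le_union_left U V)) ≫ g := by
  rw [← Category.assoc, inl_glue]

@[simp]
lemma inr_glue (θ : SumDiagram S) (U V : Subsets S) (h : Disjoint U.1 V.1) :
    inr _ _ ≫ θ.glue U V h = θ.obj.map (homOfLE (le_union_right U V)) := by
  apply FinInj.hom_ext
  intro i
  change Sum.elim _ _ (finSumFinEquiv.symm (Fin.natAdd _ i)) = _
  rw [finSumFinEquiv_symm_apply_natAdd]
  rfl

@[simp]
lemma inr_glue_assoc (θ : SumDiagram S) (U V : Subsets S) (h : Disjoint U.1 V.1) {p : FinInj}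
    (g : θ.obj.obj (union U V) ⟶ p) :
    inr _ _ ≫ θ.glue U V h ≫ g = θ.obj.map (homOfLE (le_union_right U V)) ≫ g := by
  rw [← Category.assoc, inr_glue]

lemma glue_naturality {θ θ' : SumDiagram S} (f : θ ⟶ θ') (U V : Subsets S)
    (h : Disjoint U.1 V.1) :
    sumMap (f.hom.app U) (f.hom.app V) ≫ θ'.glue U V h = θ.glue U V h ≫ f.hom.app (union U V) :=
  sum_hom_ext (by simp) (by simp)

end SumDiagram

namespace CommIMonoid

variable {S T : Pointed.{0}} (X : CommIMonoid.{u}) (θ : SumDiagram S) (k : SimplexCategoryᵒᵖ)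

/-- `X(θ_U)_k`. -/
abbrev Val (U : Subsets S) : Type u := (X.space.obj (θ.obj.obj U)).obj k

variable {X θ k}

/-- The product `X(θ_U) × X(θ_V) ⟶ X(θ_U ⊔ θ_V) ⟶ X(θ_{U ∪ V})` for disjoint `U` and `V`. -/
def join (U V : Subsets S) (h : Disjoint U.1 V.1) (x : X.Val θ k U) (y : X.Val θ k V) :
    X.Val θ k (union U V) := X.act (θ.glue U V h) (X.mul x y)

variable (X θ k) in
/-- The elements of all the `X(θ_U)_k`, with an extra element `undef`. It is a commutative monoid
under `join`, where the product over non-disjoint subsets is `undef`; so products over finite sets do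
not depend on an ordering. -/
inductive Partial : Type u where
  | undef : Partial
  | val (p : Σ U : Subsets S, X.Val θ k U) : Partial

lemma sigma_ext {U V : Subsets S} {x : X.Val θ k U} {y : X.Val θ k V} (h : U = V)
    (hx : X.act (θ.obj.map (eqToHom h)) x = y) :
    (⟨U, x⟩ : Σ U : Subsets S, X.Val θ k U) = ⟨V, y⟩ := by
  subst h
  simp only [eqToHom_refl, CategoryTheory.Functor.map_id, act_id] at hx
  rw [hx]

lemma join_comm (U V : Subsets S) (h : Disjoint U.1 V.1) (x : X.Val θ k U) (y : X.Val θ k V) :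
    (⟨_, join U V h x y⟩ : Σ U : Subsets S, X.Val θ k U) = ⟨_, join V U h.symm y x⟩ := by
  refine sigma_ext (Subtype.ext (Set.union_comm _ _)) ?_
  have h1 : X.mul y x = X.act (shuffle _ _) (X.mul x y) := (X.mul_comm x y).symm
  rw [join, join, h1, ← act_comp, ← act_comp]
  congr 1
  apply sum_hom_ext
  · rw [inl_shuffle_assoc, SumDiagram.inr_glue, SumDiagram.inl_glue_assoc, ← θ.obj.map_comp]
    rfl
  · rw [inr_shuffle_assoc, SumDiagram.inl_glue, SumDiagram.inr_glue_assoc, ← θ.obj.map_comp]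
    rfl

lemma join_assoc (U V W : Subsets S) (h : Disjoint U.1 V.1) (h' : Disjoint (union U V).1 W.1)
    (h₁ : Disjoint V.1 W.1) (h₁' : Disjoint U.1 (union V W).1)
    (x : X.Val θ k U) (y : X.Val θ k V) (z : X.Val θ k W) :
    (⟨_, join (union U V) W h' (join U V h x y) z⟩ : Σ U : Subsets S, X.Val θ k U) =
      ⟨_, join U (union V W) h₁' x (join V W h₁ y z)⟩ := by
  refine sigma_ext (Subtype.ext (Set.union_assoc _ _ _)) ?_
  have e : X.mul x (X.mul y z) = X.act (FinInj.assoc _ _ _) (X.mul (X.mul x y) z) :=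
    (X.mul_assoc x y z).symm
  rw [join, join, join, join, mul_act_left, mul_act_right, e]
  simp only [← act_comp]
  congr 1
  apply sum_hom_ext
  · apply sum_hom_ext
    · simp [← θ.obj.map_comp]
    · simp [← θ.obj.map_comp]
  · simp [← θ.obj.map_comp]

lemma one_join (V : Subsets S) (h : Disjoint (Subsets.empty S).1 V.1) (x : X.Val θ k V) :
    (⟨_, join (Subsets.empty S) V h (((X.space.obj _).obj k).point) x⟩ :
      Σ U : Subsets S, X.Val θ k U) = ⟨V, x⟩ := by
  refine sigma_ext (Subtype.ext (Set.empty_union _)) ?_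
  let f : FinInj.zero ⟶ θ.obj.obj (Subsets.empty S) := ⟨fun i => i.elim0, fun i => i.elim0⟩
  have e := X.one_mul x
  rw [join, ← act_point f k, mul_act_left]
  simp only [← act_comp]
  refine Eq.trans ?_ e
  change _ = X.act _ _
  congr 1
  apply sum_hom_ext
  · exact zero_hom_ext _ _
  · simp [← θ.obj.map_comp]


open Classical in
/-- The product of two elements, `undef` if their subsets are not disjoint. -/
noncomputable def joinOpt (p q : Σ U : Subsets S, X.Val θ k U) : Partial X θ k :=
  if h : Disjoint p.1.1 q.1.1 then .val ⟨_, join p.1 q.1 h p.2 q.2⟩ else .undef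

lemma joinOpt_pos (p q : Σ U : Subsets S, X.Val θ k U) (h : Disjoint p.1.1 q.1.1) :
    joinOpt p q = .val ⟨_, join p.1 q.1 h p.2 q.2⟩ := dif_pos h

lemma joinOpt_neg (p q : Σ U : Subsets S, X.Val θ k U) (h : ¬ Disjoint p.1.1 q.1.1) :
    joinOpt p q = .undef := dif_neg h

noncomputable instance : Mul (Partial X θ k) where
  mul p q := match p, q with
    | .val a, .val b => joinOpt a b
    | .val _, .undef => .undef
    | .undef, _ => .undef

instance : One (Partial X θ k) where
  one := .val ⟨Subsets.empty S, ((X.space.obj _).obj k).point⟩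

lemma undef_mul (q : Partial X θ k) : (Partial.undef : Partial X θ k) * q = .undef := rfl

lemma mul_undef (p : Partial X θ k) : p * (Partial.undef : Partial X θ k) = .undef := by
  cases p <;> rfl

lemma val_mul_val (p q : Σ U : Subsets S, X.Val θ k U) :
    (Partial.val p : Partial X θ k) * Partial.val q = joinOpt p q := rfl

lemma partial_mul_comm (p q : Partial X θ k) : p * q = q * p := by
  obtain _ | p := p
  · exact (mul_undef q).symm
  obtain _ | q := q
  · rfl
  refine (val_mul_val p q).trans (Eq.trans ?_ (val_mul_val q p).symm)
  by_cases h : Disjoint p.1.1 q.1.1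
  · rw [joinOpt_pos p q h, joinOpt_pos q p h.symm]
    exact congrArg Partial.val (join_comm _ _ h p.2 q.2)
  · rw [joinOpt_neg p q h, joinOpt_neg q p (fun h' => h (Disjoint.symm h'))]

lemma partial_mul_assoc (p q r : Partial X θ k) : p * q * r = p * (q * r) := by
  obtain _ | p := p
  · rfl
  obtain _ | q := q
  · rfl
  obtain _ | r := r
  · exact (mul_undef _).trans (congrArg (fun t => Partial.val p * t) (mul_undef _)).symm
  change joinOpt p q * Partial.val r = Partial.val p * joinOpt q r
  by_cases h : Disjoint p.1.1 q.1.1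
  · by_cases h₁ : Disjoint q.1.1 r.1.1
    · rw [joinOpt_pos p q h, joinOpt_pos q r h₁, val_mul_val, val_mul_val]
      by_cases h₂ : Disjoint p.1.1 r.1.1
      · have e₁ : Disjoint (union p.1 q.1).1 r.1.1 := Set.disjoint_union_left.2 ⟨h₂, h₁⟩
        have e₂ : Disjoint p.1.1 (union q.1 r.1).1 := Set.disjoint_union_right.2 ⟨h, h₂⟩
        rw [joinOpt_pos _ _ e₁, joinOpt_pos _ _ e₂]
        exact congrArg Partial.val (join_assoc _ _ _ h e₁ h₁ e₂ _ _ _)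
      · rw [joinOpt_neg _ _ (fun e => h₂ (Set.disjoint_union_left.1 e).1),
          joinOpt_neg _ _ (fun e => h₂ (Set.disjoint_union_right.1 e).2)]
    · rw [joinOpt_pos p q h, joinOpt_neg q r h₁, val_mul_val,
        joinOpt_neg _ _ (fun e => h₁ (Set.disjoint_union_left.1 e).2)]
      rfl
  · rw [joinOpt_neg p q h]
    by_cases h₁ : Disjoint q.1.1 r.1.1
    · rw [joinOpt_pos q r h₁, val_mul_val,
        joinOpt_neg _ _ (fun e => h (Set.disjoint_union_right.1 e).1)]
      rfl
    · rw [joinOpt_neg q r h₁]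
      rfl

lemma partial_one_mul (p : Partial X θ k) : 1 * p = p := by
  obtain _ | p := p
  · rfl
  · refine (joinOpt_pos _ _ (Set.empty_disjoint _)).trans ?_
    exact congrArg Partial.val (one_join p.1 (Set.empty_disjoint _) p.2)

noncomputable instance : CommMonoid (Partial X θ k) where
  mul_assoc := partial_mul_assoc
  one_mul := partial_one_mul
  mul_one p := (partial_mul_comm p 1).trans (partial_one_mul p)
  mul_comm := partial_mul_comm

lemma val_injective : Function.Injective (Partial.val (X := X) (θ := θ) (k := k)) :=
  fun _ _ h => Partial.val.inj h

lemma val_mul (p q : Σ U : Subsets S, X.Val θ k U) (h : Disjoint p.1.1 q.1.1) :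
    Partial.val p * Partial.val q = Partial.val ⟨_, join p.1 q.1 h p.2 q.2⟩ :=
  joinOpt_pos p q h

lemma disjoint_of_mul_eq {p q r : Σ U : Subsets S, X.Val θ k U}
    (h : Partial.val p * Partial.val q = Partial.val r) :
    Disjoint p.1.1 q.1.1 := by
  by_contra h'
  have e : (Partial.undef : Partial X θ k) = .val r := (joinOpt_neg p q h').symm.trans h
  cases e

/-- Maps that are multiplicative on disjoint subsets commute with defined products. -/
lemma prod_map {S' : Pointed.{0}} {X' : CommIMonoid.{u}} {θ' : SumDiagram S'}
    {k' : SimplexCategoryᵒᵖ}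
    (F : (Σ U : Subsets S, X.Val θ k U) → (Σ U : Subsets S', X'.Val θ' k' U))
    (hone : ∀ r, (Partial.val r : Partial X θ k) = 1 → (Partial.val (F r) : Partial X' θ' k') = 1)
    (hmul : ∀ p q (h : Disjoint p.1.1 q.1.1), 
      Partial.val (F p) * Partial.val (F q) = (Partial.val (X := X') (θ := θ') (k := k') <| F ⟨_, join p.1 q.1 h p.2 q.2⟩))
    {ι : Type} (A : Finset ι) (p : ι → Σ U : Subsets S, X.Val θ k U) :
    ∀ r, ∏ i ∈ A, (Partial.val (p i) : Partial X θ k) = Partial.val r →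
      ∏ i ∈ A, (Partial.val (F (p i)) : Partial X' θ' k') = Partial.val (F r) := by
  classical
  induction A using Finset.induction_on with
  | empty =>
    intro r hr
    rw [Finset.prod_empty] at hr ⊢
    exact (hone r hr.symm).symm
  | insert i A hi ih =>
    intro r hr
    rw [Finset.prod_insert hi] at hr ⊢
    rcases hq : (∏ i ∈ A, (Partial.val (p i) : Partial X θ k)) with _ | q
    · rw [hq] at hr
      have e : (Partial.undef : Partial X θ k) = .val r := (mul_undef _).symm.trans hr
      cases e
    · have hr' : Partial.val (p i) * Partial.val q = Partial.val r := by
        rw [← hr, hq]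
      have hd := disjoint_of_mul_eq hr'
      rw [val_mul _ _ hd] at hr'
      rw [ih q hq, hmul _ _ hd]
      rw [val_injective hr']

lemma exists_prod (x : ∀ s : {s : S // s ≠ S.point}, X.Val θ k (single s))
    (A : Finset {s : S // s ≠ S.point}) :
    ∀ U : Subsets S, (∀ s, s ∈ A ↔ s.1 ∈ U.1) →
    ∃ y : X.Val θ k U, ∏ s ∈ A, (Partial.val ⟨single s, x s⟩ : Partial X θ k) = Partial.val ⟨U, y⟩ := by
  classical
  induction A using Finset.induction_on with
  | empty =>
    intro U hU
    obtain rfl : U = Subsets.empty S := Subtype.ext (Set.eq_empty_iff_forall_notMem.2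
      (fun s hs => absurd ((hU ⟨s, fun h => U.2 (h ▸ hs)⟩).2 hs) (Finset.notMem_empty _)))
    exact ⟨_, rfl⟩
  | insert i A hi ih =>
    intro U hU
    let V : Subsets S := ⟨U.1 \ {i.1}, fun h => U.2 h.1⟩
    have hV : ∀ s, s ∈ A ↔ s.1 ∈ V.1 := by
      intro s
      have h1 := hU s
      rw [Finset.mem_insert] at h1
      constructor
      · intro hs
        exact ⟨h1.1 (Or.inr hs), fun e => hi (by rwa [← (Subtype.ext e : s = i)])⟩
      · rintro ⟨hs, hs'⟩
        exact (h1.2 hs).resolve_left (fun e => hs' (congrArg Subtype.val e))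
    obtain ⟨y, hy⟩ := ih V hV
    have hd : Disjoint (single i).1 V.1 := Set.disjoint_sdiff_right
    have hUV : union (single i) V = U := by
      apply Subtype.ext
      apply Set.union_sdiff_cancel
      rintro _ rfl
      exact (hU i).1 (Finset.mem_insert_self _ _)
    have key : ∀ U', union (single i) V = U' → ∃ y : X.Val θ k U',
        ∏ s ∈ insert i A, (Partial.val ⟨single s, x s⟩ : Partial X θ k) =
          Partial.val ⟨U', y⟩ := by
      rintro _ rfl
      exact ⟨join (single i) V hd (x i) y, by rw [Finset.prod_insert hi, hy, val_mul _ _ hd]⟩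
    exact key U hUV

/-- The elements of `U`, as a finset in `S̄`. -/
noncomputable def members [Finite S] (U : Subsets S) : Finset {s : S // s ≠ S.point} :=
  (Set.toFinite {s : {s : S // s ≠ S.point} | s.1 ∈ U.1}).toFinset

lemma mem_members [Finite S] (U : Subsets S) (s : {s : S // s ≠ S.point}) :
    s ∈ members U ↔ s.1 ∈ U.1 := by
  simp [members]

/-- The product `∏_{s ∈ U} X(θ_s) ⟶ X(⊔_{s ∈ U} θ_s) ⟶ X(θ_U)`: the product of the `x_s`, `s ∈ U`, in the
commutative monoid above, which lies over the subset `U`. -/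
noncomputable def prodOver [Finite S] (x : ∀ s : {s : S // s ≠ S.point}, X.Val θ k (single s))
    (U : Subsets S) : X.Val θ k U :=
  (exists_prod x (members U) U (mem_members U)).choose

lemma prodOver_spec [Finite S] (x : ∀ s : {s : S // s ≠ S.point}, X.Val θ k (single s))
    (U : Subsets S) :
    ∏ s ∈ members U, (Partial.val ⟨single s, x s⟩ : Partial X θ k) = Partial.val ⟨U, prodOver x U⟩ :=
  (exists_prod x (members U) U (mem_members U)).choose_spec

lemma prodOver_eq [Finite S] (x : ∀ s : {s : S // s ≠ S.point}, X.Val θ k (single s))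
    (U : Subsets S) (y : X.Val θ k U)
    (h : ∏ s ∈ members U, (Partial.val ⟨single s, x s⟩ : Partial X θ k) = Partial.val ⟨U, y⟩) :
    prodOver x U = y := by
  have e := val_injective ((prodOver_spec x U).symm.trans h)
  exact eq_of_heq (Sigma.mk.inj e).2

lemma prodOver_single [Finite S] (x : ∀ s : {s : S // s ≠ S.point}, X.Val θ k (single s))
    (s : {s : S // s ≠ S.point}) : prodOver x (single s) = x s := by
  apply prodOver_eq
  have : members (single s) = {s} := by
    ext t
    rw [mem_members, Finset.mem_singleton]
    exact Subtype.ext_iff.symm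
  rw [this, Finset.prod_singleton]

/-- Families of maps compatible with `join` and base points commute with `prodOver`. -/
lemma map_prodOver [Finite S] {X' : CommIMonoid.{u}} {θ' : SumDiagram S} {k' : SimplexCategoryᵒᵖ}
    (g : ∀ U : Subsets S, X.Val θ k U → X'.Val θ' k' U)
    (hone : g (Subsets.empty S) ((X.space.obj _).obj k).point = ((X'.space.obj _).obj k').point)
    (hmul : ∀ U V (h : Disjoint U.1 V.1) x y,
      g (union U V) (join U V h x y) = join U V h (g U x) (g V y))
    (x : ∀ s : {s : S // s ≠ S.point}, X.Val θ k (single s)) (U : Subsets S) :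
    g U (prodOver x U) = prodOver (fun s => g (single s) (x s)) U := by
  symm
  apply prodOver_eq
  refine prod_map (X := X) (θ := θ) (k := k) (fun p => ⟨p.1, g p.1 p.2⟩) ?_ ?_ _ _ _
    (prodOver_spec x U)
  · intro r hr
    have e : r = ⟨Subsets.empty S, ((X.space.obj _).obj k).point⟩ := val_injective hr
    subst e
    exact congrArg (fun y => Partial.val ⟨Subsets.empty S, y⟩) hone
  · intro p q h
    refine (val_mul (X := X') (θ := θ') (k := k') ⟨p.1, g p.1 p.2⟩ ⟨q.1, g q.1 q.2⟩ h).trans ?_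
    exact congrArg (fun y => Partial.val ⟨_, y⟩) (hmul _ _ h _ _).symm

lemma prodOver_comp [Finite S] [Finite T] (α : S ⟶ T)
    (x : ∀ s : {s : S // s ≠ S.point}, X.Val θ k (single s)) (W : Subsets T) :
    prodOver (θ := (SumDiagram.pushforward α).obj θ)
      (fun t => prodOver x (preimage α (single t))) W = prodOver x (preimage α W) := by
  classical
  symm
  apply prodOver_eq
  have h := prod_map (X := X) (θ := (SumDiagram.pushforward α).obj θ) (k := k)
    (X' := X) (θ' := θ) (k' := k) (fun p => ⟨preimage α p.1, p.2⟩)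
    (fun r hr => by
      have e : r = ⟨Subsets.empty T, ((X.space.obj _).obj k).point⟩ := val_injective hr
      subst e
      rfl)
    (fun p q h => val_mul (X := X) (θ := θ) (k := k) ⟨preimage α p.1, p.2⟩
      ⟨preimage α q.1, q.2⟩ (h.preimage _)) _ _ _
    (prodOver_spec (θ := (SumDiagram.pushforward α).obj θ)
      (fun t => prodOver x (preimage α (single t))) W)
  refine Eq.trans ?_ h
  have e : members (preimage α W) = (members W).biUnion
      (fun t => members (preimage α (single t))) := by
    ext s
    simp only [Finset.mem_biUnion, mem_members]
    constructor
    · intro hs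
      exact ⟨⟨α.toFun s.1, fun e => W.2 (by
        have hs' : α.toFun s.1 ∈ W.1 := hs
        rwa [e] at hs')⟩, hs, rfl⟩
    · rintro ⟨t, ht, hst⟩
      have e : α.toFun s.1 = t.1 := hst
      change α.toFun s.1 ∈ W.1
      rwa [e]
  rw [e, Finset.prod_biUnion]
  · exact Finset.prod_congr rfl (fun t _ => prodOver_spec x (preimage α (single t)))
  · intro t _ t' _ htt'
    refine Finset.disjoint_left.2 (fun s hs hs' => htt' ?_)
    rw [mem_members] at hs hs'
    have e₁ : α.toFun s.1 = t.1 := hs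
    have e₂ : α.toFun s.1 = t'.1 := hs'
    exact Subtype.ext (e₁.symm.trans e₂)


lemma mul_point (m n : FinInj) (k : SimplexCategoryᵒᵖ) :
    X.mul ((X.space.obj m).obj k).point ((X.space.obj n).obj k).point =
      ((X.space.obj (sum m n)).obj k).point := by
  let f : FinInj.zero ⟶ m := ⟨fun i => i.elim0, fun i => i.elim0⟩
  have e := X.one_mul ((X.space.obj n).obj k).point
  have e' : X.mul ((X.space.obj FinInj.zero).obj k).point ((X.space.obj n).obj k).point =
      ((X.space.obj (sum FinInj.zero n)).obj k).point := by
    have h := congrArg (X.act (castHom (Nat.zero_add n.card).symm : n ⟶ sum FinInj.zero n)) e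
    rw [act_point] at h
    refine Eq.trans ?_ h
    change _ = X.act _ (X.act _ _)
    rw [← act_comp]
    exact (act_id _).symm
  rw [← act_point f k, mul_act_left, e', act_point]

lemma join_point (U V : Subsets S) (h : Disjoint U.1 V.1) :
    join (X := X) (θ := θ) (k := k) U V h ((X.space.obj _).obj k).point
      ((X.space.obj _).obj k).point = ((X.space.obj _).obj k).point := by
  rw [join, mul_point, act_point]

lemma prodOver_point [Finite S] (U : Subsets S) :
    prodOver (X := X) (θ := θ) (k := k) (fun _ => ((X.space.obj _).obj k).point) U =
      ((X.space.obj _).obj k).point :=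
  (map_prodOver (X := X) (θ := θ) (k := k) (X' := X) (θ' := θ) (k' := k)
    (fun U _ => ((X.space.obj (θ.obj.obj U)).obj k).point) rfl
    (fun U V h _ _ => (join_point U V h).symm) (fun _ => ((X.space.obj _).obj k).point) U).symm

variable (X) in
/-- The `D(S)`-diagram `X(S) : θ ↦ ∏_{s ∈ S̄} X(θ_s)`. -/
def valueDiagram (S : Pointed.{0}) : SumDiagram S ⥤ SSet.{u} where
  obj θ :=
    { obj := fun k => ∀ s : {s : S // s ≠ S.point}, X.Val θ k (single s)
      map := fun φ => ↾fun x s => ((X.space.obj _).map φ).toFun (x s)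
      map_id := fun k => ConcreteCategory.hom_ext _ _ (fun x => funext fun s => by simp)
      map_comp := fun φ ψ => ConcreteCategory.hom_ext _ _ (fun x => funext fun s => by simp) }
  map f :=
    { app := fun k => ↾fun x s => X.act (f.hom.app (single s)) (x s)
      naturality := fun k l φ => ConcreteCategory.hom_ext _ _ (fun x => funext fun s =>
        congrArg (fun t => Pointed.Hom.toFun t (x s))
          ((X.space.map (f.hom.app (single s))).naturality φ)) }
  map_id θ := by
    ext k x s
    exact act_id _
  map_comp f g := by
    ext k x s
    exact act_comp _ _ _

variable (X) in
/-- The natural transformation `X(S) ⟶ X(T) ∘ α_*`: at `t ∈ T̄`, it is the product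
`∏_{s ∈ α⁻¹(t)} X(θ_s) ⟶ X(θ_{α⁻¹(t)})`. -/
noncomputable def valueMap [Finite S] [Finite T] (α : S ⟶ T) :
    X.valueDiagram S ⟶ SumDiagram.pushforward α ⋙ X.valueDiagram T where
  app θ :=
    { app := fun k => ↾fun x t => prodOver (θ := θ) (k := k) x (preimage α (single t))
      naturality := fun k l φ => ConcreteCategory.hom_ext _ _ (fun x => funext fun t => by
        refine (map_prodOver (X := X) (θ := θ) (k := k) (X' := X) (θ' := θ) (k' := l)
          (fun U y => ((X.space.obj _).map φ).toFun y) (Pointed.Hom.map_point _) ?_ x _).symm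
        intro U V h x y
        refine (congrArg (fun t => Pointed.Hom.toFun t (X.mul x y))
          ((X.space.map (θ.glue U V h)).naturality φ)).symm.trans ?_
        exact congrArg (X.act _) (X.map_mul φ x y)) }
  naturality θ θ' f := by
    ext k x
    funext t
    refine (map_prodOver (X := X) (θ := θ) (k := k) (X' := X) (θ' := θ') (k' := k)
      (fun U y => X.act (f.hom.app U) y) (act_point _ _) ?_ x _).symm
    intro U V h x y
    rw [join, join, ← act_comp, ← SumDiagram.glue_naturality, act_comp]
    exact congrArg (X.act _) (X.mul_natural _ _ x y)

variable (X) in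
/-- The based space `X_{hI}(S) = hocolim_{D(S)} X(S)`, with base point given by the base points of
the `X(0)` over the zero sum diagram. -/
def gammaObj (S : Pointed.{0}) : BasedSSet.{u} where
  obj k := Pointed.of (X := HocolimSimplex (X.valueDiagram S) k)
    ⟨(Functor.const _).obj (SumDiagram.zero S), fun _ => ((X.space.obj _).obj k).point⟩
  map {k l} φ := ⟨hocolimOp (X.valueDiagram S) φ, by
    refine Sigma.ext (by rfl) (heq_of_eq ?_)
    funext s
    refine (congrArg (X.act _) (Pointed.Hom.map_point _)).trans ?_
    exact act_point _ _⟩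
  map_id k := Pointed.Hom.ext (funext fun p => hocolimOp_id _ p)
  map_comp φ ψ := Pointed.Hom.ext (funext fun p => hocolimOp_comp _ φ ψ p)

variable (X) in
/-- The map `α_* : X_{hI}(S) ⟶ X_{hI}(T)`. -/
noncomputable def gammaMap [Finite S] [Finite T] (α : S ⟶ T) : X.gammaObj S ⟶ X.gammaObj T where
  app k := ⟨(hocolimMap (SumDiagram.pushforward α) (X.valueMap α)).app k, by
    refine Sigma.ext (by rfl) (heq_of_eq ?_)
    funext t
    exact prodOver_point _⟩
  naturality k l φ := Pointed.Hom.ext (funext fun p =>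
    ConcreteCategory.congr_hom ((hocolimMap (SumDiagram.pushforward α) (X.valueMap α)).naturality φ)
      p)

variable (X) in
/-- The Γ-space `S ↦ X_{hI}(S)` associated to a commutative `I`-monoid. -/
noncomputable def gammaSpace : FinPointed ⥤ BasedSSet.{u} where
  obj S := X.gammaObj S.obj
  map {S T} α :=
    haveI : Finite S.obj := S.property
    haveI : Finite T.obj := T.property
    X.gammaMap α.hom
  map_id S := by
    have : Finite S.obj := S.property
    refine NatTrans.ext (funext fun k => Pointed.Hom.ext (funext fun p => ?_))
    refine Sigma.ext (by rfl) (heq_of_eq ?_)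
    funext s
    exact prodOver_single _ s
  map_comp {R S T} α β := by
    have : Finite R.obj := R.property
    have : Finite S.obj := S.property
    have : Finite T.obj := T.property
    refine NatTrans.ext (funext fun k => Pointed.Hom.ext (funext fun p => ?_))
    refine Sigma.ext (by rfl) (heq_of_eq ?_)
    funext t
    exact (prodOver_comp α.hom p.2 (preimage β.hom (single t))).symm

/-- The natural transformation `X(S) ⟶ Y(S)` induced by a morphism `X ⟶ Y`. -/
def valueNat {X Y : CommIMonoid.{u}} (f : X ⟶ Y) (S : Pointed.{0}) :
    X.valueDiagram S ⟶ Y.valueDiagram S where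
  app θ :=
    { app := fun k => ↾fun x s => ((f.natTrans.app _).app k).toFun (x s)
      naturality := fun k l φ => ConcreteCategory.hom_ext _ _ (fun x => funext fun s =>
        congrArg (fun t => Pointed.Hom.toFun t (x s)) ((f.natTrans.app _).naturality φ)) }
  naturality θ θ' g := by
    ext k x
    funext s
    exact congrArg (fun t => Pointed.Hom.toFun (NatTrans.app t k) (x s))
      (f.natTrans.naturality (g.hom.app (single s)))

/-- The map of Γ-spaces induced by a morphism of commutative `I`-monoids. -/
noncomputable def gammaNat {X Y : CommIMonoid.{u}} (f : X ⟶ Y) : X.gammaSpace ⟶ Y.gammaSpace where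
  app S :=
    { app := fun k => ⟨(hocolimMap (G := Y.valueDiagram S.obj) (𝟭 _) (valueNat f S.obj)).app k, by
        refine Sigma.ext (by rfl) (heq_of_eq ?_)
        funext s
        exact Pointed.Hom.map_point _⟩
      naturality := fun k l φ => Pointed.Hom.ext (funext fun p =>
        ConcreteCategory.congr_hom
          ((hocolimMap (G := Y.valueDiagram S.obj) (𝟭 _) (valueNat f S.obj)).naturality φ) p) }
  naturality S T α := by
    have : Finite S.obj := S.property
    have : Finite T.obj := T.property
    refine NatTrans.ext (funext fun k => Pointed.Hom.ext (funext fun p => ?_))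
    refine Sigma.ext (by rfl) (heq_of_eq ?_)
    funext t
    refine map_prodOver (X := X) (k := k) (X' := Y) (k' := k)
      (fun U y => ((f.natTrans.app _).app k).toFun y) (Pointed.Hom.map_point _) ?_ p.2 _
    intro U V h x y
    refine (congrArg (fun t => Pointed.Hom.toFun (NatTrans.app t k) (X.mul x y))
      (f.natTrans.naturality (SumDiagram.glue _ U V h))).trans ?_
    exact congrArg (Y.act _) (f.map_mul x y)

/-- The functor taking a commutative `I`-monoid to its Γ-space. -/
noncomputable def gammaFunctor : CommIMonoid.{u} ⥤ FinPointed ⥤ BasedSSet.{u} where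
  obj X := X.gammaSpace
  map f := gammaNat f
  map_id X := by
    ext S k p
    rfl
  map_comp f g := by
    ext S k p
    rfl

end CommIMonoid


/-! ### Γ-spaces -/

/-- A functor `A` from `Γᵒ` to based spaces is a Γ-space if `A(*) = *`. -/
def IsGammaSpace (A : FinPointed ⥤ BasedSSet.{u}) : Prop :=
  ∀ S : FinPointed, Subsingleton S.obj → ∀ k, Subsingleton ((A.obj S).obj k)

/-- The wedge `S ∨ T`, with `S̄ ⊔ T̄` as set of non-base points. -/
def wedge (S T : FinPointed) : FinPointed :=
  ⟨Pointed.of (X := Option ({s : S.obj // s ≠ S.obj.point} ⊕ {t : T.obj // t ≠ T.obj.point})) none,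
    by
      have := S.property
      have := T.property
      infer_instance⟩

/-- The projection `S ∨ T ⟶ S` collapsing `T`. -/
def wedgeFst (S T : FinPointed) : wedge S T ⟶ S :=
  ObjectProperty.homMk ⟨fun w => match w with
    | none => S.obj.point
    | some (Sum.inl s) => s.1
    | some (Sum.inr _) => S.obj.point, rfl⟩

/-- The projection `S ∨ T ⟶ T` collapsing `S`. -/
def wedgeSnd (S T : FinPointed) : wedge S T ⟶ T :=
  ObjectProperty.homMk ⟨fun w => match w with
    | none => T.obj.point
    | some (Sum.inl _) => T.obj.point
    | some (Sum.inr t) => t.1, rfl⟩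

/-- The fold map `S ∨ S ⟶ S`. -/
def fold (S : FinPointed) : wedge S S ⟶ S :=
  ObjectProperty.homMk ⟨fun w => match w with
    | none => S.obj.point
    | some (Sum.inl s) => s.1
    | some (Sum.inr s) => s.1, rfl⟩

/-- `A` is special if all the natural maps `A(S ∨ T) ⟶ A(S) × A(T)` are equivalences. -/
def IsSpecial (A : FinPointed ⥤ BasedSSet.{u}) : Prop :=
  ∀ S T : FinPointed, IsWeakEquivalence
    (CartesianMonoidalCategory.lift (underlying.map (A.map (wedgeFst S T)))
      (underlying.map (A.map (wedgeSnd S T))))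

/-- The pointed set `S⁰`. -/
def sphereZero : FinPointed := ⟨Pointed.of false, inferInstanceAs (Finite Bool)⟩

/-- The set of components of a based space. -/
abbrev components (K : BasedSSet.{u}) : Type u := SSet.π₀ (underlying.obj K)

/-- The map induced on components. -/
abbrev componentsMap {K L : BasedSSet.{u}} (f : K ⟶ L) : components K → components L :=
  SSet.mapπ₀ (underlying.map f)

/-- `A` is very special if it is special and `A(S⁰)` is group-like: the multiplication
`π₀ A(S⁰) × π₀ A(S⁰) ≅ π₀ A(S⁰ ∨ S⁰) ⟶ π₀ A(S⁰)` (the inverse of the bijection given by the two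
projections, followed by the fold map) makes `π₀ A(S⁰)` a group. -/
def IsVerySpecial (A : FinPointed ⥤ BasedSSet.{u}) : Prop :=
  IsSpecial A ∧ ∃ _ : Group (components (A.obj sphereZero)),
    ∀ w : components (A.obj (wedge sphereZero sphereZero)),
      componentsMap (A.map (wedgeFst sphereZero sphereZero)) w *
        componentsMap (A.map (wedgeSnd sphereZero sphereZero)) w =
      componentsMap (A.map (fold sphereZero)) w

/-- A simplicial monoid `G` is group-like if the induced multiplication makes `π₀ G` a group. -/
def IsGroupLike (G : SimplicialMonoid.{u}) : Prop :=
  ∃ _ : Group (SSet.π₀ (((SimplicialObject.whiskering _ _).obj (forget MonCat.{u})).obj G)),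
    ∀ a b : G.obj (op (SimplexCategory.mk 0)),
      (SSet.π₀.mk (a * b) : SSet.π₀ (((SimplicialObject.whiskering _ _).obj (forget MonCat)).obj G)) =
        SSet.π₀.mk a * SSet.π₀.mk b

/-! ### The circle -/

/-- The relation on `Δ[1]_n` that identifies all simplices of the boundary `∂Δ[1]`, that is, all
constant maps. -/
def circleSetoid (n : ℕ) : Setoid (Fin (n + 1) →o Fin 2) where
  r f g := f = g ∨ ((∃ c, ∀ i, f i = c) ∧ (∃ c, ∀ i, g i = c))
  iseqv :=
    { refl := fun _ => Or.inl rfl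
      symm := by
        rintro f g (h | ⟨h, h'⟩)
        · exact Or.inl h.symm
        · exact Or.inr ⟨h', h⟩
      trans := by
        rintro f g h (rfl | ⟨h₁, h₂⟩) (rfl | ⟨h₃, h₄⟩)
        · exact Or.inl rfl
        · exact Or.inr ⟨h₃, h₄⟩
        · exact Or.inr ⟨h₁, h₂⟩
        · exact Or.inr ⟨h₁, h₄⟩ }

/-- The finite pointed set `S¹_n = Δ[1]_n / ∂Δ[1]_n`. -/
def circleSimplices (n : ℕ) : FinPointed :=
  ⟨Pointed.of (X := Quotient (circleSetoid n)) (Quotient.mk _ (OrderHom.const _ 0)), by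
    have : Finite (Fin (n + 1) →o Fin 2) := DFunLike.finite _
    exact Finite.of_surjective _ (Quotient.mk_surjective (s := circleSetoid n))⟩

/-- The simplicial circle `S¹ = Δ[1] / ∂Δ[1]`, a simplicial finite pointed set. -/
def circle : SimplicialObject FinPointed where
  obj k := circleSimplices k.unop.len
  map φ := ObjectProperty.homMk
    ⟨Quotient.map' (fun f => f.comp φ.unop.toOrderHom) (by
      rintro f g (rfl | ⟨⟨c, hc⟩, ⟨d, hd⟩⟩)
      · exact Or.inl rfl
      · exact Or.inr ⟨⟨c, fun i => hc _⟩, ⟨d, fun i => hd _⟩⟩), rfl⟩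
  map_id k := by
    refine ObjectProperty.hom_ext _ (Pointed.Hom.ext (funext fun f => ?_))
    induction f using Quotient.inductionOn
    rfl
  map_comp φ ψ := by
    refine ObjectProperty.hom_ext _ (Pointed.Hom.ext (funext fun f => ?_))
    induction f using Quotient.inductionOn
    rfl

/-- The value `A(K)` at a degreewise finite pointed simplicial set `K`: the realization of
`[k] ↦ A(K_k)`. -/
def evaluateAt (K : SimplicialObject FinPointed) :
    (FinPointed ⥤ BasedSSet.{u}) ⥤ BasedSSet.{u} :=
  (Functor.whiskeringLeft _ _ _).obj K ⋙ diag

end IGamma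

/-! The heart of the proof is a strict comparison of `X_{hI}(S)` with the power `(X_{hI})^S̄`.
Evaluation at the one-point subsets gives `toFamilies` from the former to the latter. For a linear
order on `S̄`, lexicographic sums of finite sets give `ofFamilies` in the other direction. The
category `I` is skeletal and an order preserving bijection between two of its objects is an
identity, so two simplices of a homotopy colimit over `I` or `D(S)` are equal as soon as they are
linked by order preserving bijections compatible with the values (`h_ext`, `gamma_ext`). Hence
`ofFamilies` followed by `toFamilies` is the identity on the nose. The natural map from the
lexicographic sum of the `θ_s` to `θ` (`fromSequence`) gives a homotopy from the other composite to
the identity, stationary on the image of `ofFamilies`. So `ofFamilies` includes a strong deformation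
retract and is anodyne (`anodyne_ofFamilies`).

Specialness follows by two-out-of-three, because families indexed by a wedge are pairs of families.
On components, `X_{hI}(S⁰ ∨ S⁰)` consists of pairs `(a, b)`, and the fold map sends such a pair to
the product `a * b`; this identifies the two group conditions.

For the circle, the key fact is `gammaMap_ofFamilies`: if `α` preserves the order of the points not
sent to the base point, then `α_*` corresponds under `ofFamilies` to taking products in `X_{hI}`
over the fibres of `α`, in order. The non-base points of `S¹_k` are the `k` places where a monotone
map `[k] ⟶ [1]` can jump; they are linearly ordered, and the simplicial operators respect this order
in the sense required. The fibres are arcs, and ordered products over arcs are exactly the operators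
of the bar construction. The maps `ofFamilies` therefore assemble into a strict map of simplicial
spaces from `[k] ↦ (X_{hI})^k` to `[k] ↦ X_{hI}(S¹_k)` (`barRowsToGamma`), which is a levelwise
anodyne monomorphism.

Passing to diagonals uses the class `weakAnodyne` of maps with the left lifting property against Kan
fibrations between Kan complexes. It is closed under cobase change, transfinite composition,
pushout-products with monomorphisms and cancellation, and its monomorphisms are weak equivalences
(`IsWeakEquivalence.of_weakAnodyne`). A skeletal filtration in the outer simplicial direction then
shows that a levelwise monic and weakly anodyne map of bisimplicial sets is weakly anodyne on
diagonals (`weakAnodyne_diag`). -/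

namespace IGamma
-- Weakly anodyne maps
open Limits HomotopicalAlgebra SSet SSet.modelCategoryQuillen Simplicial

/-- Kan fibrations between Kan complexes. -/
def kanFibrations : MorphismProperty SSet.{u} := fun _ B p => Fibration p ∧ KanComplex B

/-- The morphisms with the left lifting property with respect to Kan fibrations between Kan
complexes. -/
def weakAnodyne : MorphismProperty SSet.{u} := kanFibrations.llp

lemma anodyne_le_weakAnodyne : anodyneExtensions.{u} ≤ weakAnodyne := by
  intro A B i hi E F p hp
  exact hi p ((HomotopicalAlgebra.fibration_iff p).1 hp.1)

instance : weakAnodyne.{u}.IsMultiplicative := by unfold weakAnodyne; infer_instance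
instance : weakAnodyne.{u}.RespectsIso := by unfold weakAnodyne; infer_instance
instance : weakAnodyne.{u}.IsStableUnderCobaseChange := by unfold weakAnodyne; infer_instance
instance : MorphismProperty.IsStableUnderTransfiniteComposition.{u} weakAnodyne.{u} := by
  unfold weakAnodyne; infer_instance

/-- What goes beyond the usual pullback-hom property is that the target of `sq.π` is again a Kan
complex: it maps to the Kan complex of maps `Y₁ ⟶ B` by a base change of the fibration induced by
`p` on maps out of `X₁`. -/
lemma kanFibrations_pullbackObjObjπ {X₁ Y₁ E B : SSet.{u}} {i : X₁ ⟶ Y₁} {p : E ⟶ B} [Mono i]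
    (hp : kanFibrations p) (sq : MonoidalClosed.internalHom.PullbackObjObj i p) :
    kanFibrations sq.π := by
  obtain ⟨h₁, h₂⟩ := hp
  refine ⟨fibration_pullbackObjObjπ sq, ?_⟩
  have h₃ : Fibration sq.snd := by
    have h : Fibration ((ihom X₁).map p) := inferInstance
    rw [HomotopicalAlgebra.fibration_iff, fibrations_eq] at h ⊢
    exact MorphismProperty.of_isPullback sq.isPullback h
  have h₄ : KanComplex ((MonoidalClosed.internalHom.obj (op Y₁)).obj B) :=
    inferInstanceAs (KanComplex ((ihom Y₁).obj B))
  exact isFibrant_of_fibration sq.snd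

/-- By adjunction, lifting the pushout-product against `p` amounts to lifting `j` against the
pullback-hom of `i` and `p`, which stays in `kanFibrations`. -/
lemma weakAnodyne_pushoutObjObjι {X₁ Y₁ X₂ Y₂ : SSet.{u}} {i : X₁ ⟶ Y₁} {j : X₂ ⟶ Y₂} [Mono i]
    (hj : weakAnodyne j) (sq : (curriedTensor SSet.{u}).PushoutObjObj i j) :
    weakAnodyne sq.ι := by
  intro E B p hp
  let sq' := Functor.PullbackObjObj.ofHasPullback MonoidalClosed.internalHom i p
  rw [MonoidalClosed.internalHomAdjunction₂.hasLiftingProperty_iff _ sq']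
  exact hj _ (kanFibrations_pullbackObjObjπ hp sq')

lemma weakAnodyne_unionProd_ι {X Y : SSet.{u}} (A : X.Subcomplex) (B : Y.Subcomplex)
    (hB : weakAnodyne B.ι) : weakAnodyne (A.unionProd B).ι :=
  weakAnodyne_pushoutObjObjι hB (Subcomplex.unionProd.pushoutObjObj A B)

/-- The face `δ i` is the inclusion of the 1-dimensional horn at the opposite index `i.rev`: that
horn has `i` as its only face. -/
lemma anodyne_δ (i : Fin 2) : anodyneExtensions.{u} (stdSimplex.{u}.δ i : Δ[0] ⟶ Δ[1]) := by
  intro E B p hp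
  rw [← HomotopicalAlgebra.fibration_iff] at hp
  refine ⟨fun {f g} sq => ?_⟩
  have hne : ∀ j : Fin 2, j ≠ i.rev → j = i := by clear * -; decide +revert
  have hne' : i ≠ i.rev := by clear * -; decide +revert
  obtain ⟨φ, h₁, h₂⟩ := horn.IsCompatible.exists_lift (i := i.rev) (f := fun _ _ => f)
    (by trivial) p g (fun j hj => by obtain rfl := hne j hj; exact sq.w)
  exact ⟨⟨⟨φ, h₁ i hne', h₂⟩⟩⟩

/-- The vertex `0` of `Δ[1]`. -/
def vertexZero : (Δ[0] : SSet.{u}) ⟶ Δ[1] := stdSimplex.{u}.δ 1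

lemma anodyne_vertexZero : anodyneExtensions.{u} vertexZero := anodyne_δ 1

lemma whiskerLeft_vertexZero (X : SSet.{u}) :
    X ◁ vertexZero = CartesianMonoidalCategory.fst _ _ ≫ ι₀ := by
  refine CartesianMonoidalCategory.hom_ext _ _ (by simp) ?_
  ext k ⟨x, y⟩
  refine stdSimplex.objEquiv.injective
    (SimplexCategory.Hom.ext _ _ (OrderHom.ext _ _ (funext fun j => ?_)))
  change Fin.succAbove (1 : Fin 2) (stdSimplex.objEquiv y j) = 0
  have h : ∀ a : Fin 1, Fin.succAbove (1 : Fin 2) a = 0 := by decide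
  exact h _

/-- The map `X × ∂Δ[1] ⟶ Y` given by two maps `X ⟶ Y`. -/
noncomputable def ofEndpoints {X Y : SSet.{u}} (f g : X ⟶ Y) :
    X ⊗ (∂Δ[1] : SSet.{u}) ⟶ Y where
  app k := ↾fun p => if stdSimplex.asOrderHom p.2.1 0 = 0 then f.app k p.1 else g.app k p.1
  naturality k l φ := by
    ext ⟨x, t, ht⟩
    have key : stdSimplex.asOrderHom (Δ[1].map φ t) 0 = stdSimplex.asOrderHom t 0 := by
      have ht' : ¬ Function.Surjective (stdSimplex.asOrderHom t) := ht
      change stdSimplex.asOrderHom t (φ.unop.toOrderHom 0) = _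
      have h01 : ∀ a b : Fin 2, a ≠ b → ∀ c, c = a ∨ c = b := by clear * -; decide +revert
      by_contra hne
      exact ht' (fun c => (h01 _ _ hne c).elim (fun h => ⟨_, h.symm⟩) (fun h => ⟨_, h.symm⟩))
    change (if stdSimplex.asOrderHom (Δ[1].map φ t) 0 = 0 then f.app l (X.map φ x)
      else g.app l (X.map φ x)) = Y.map φ (if stdSimplex.asOrderHom t 0 = 0 then f.app k x
      else g.app k x)
    rw [key]
    split_ifs
    · exact NatTrans.naturality_apply f φ x
    · exact NatTrans.naturality_apply g φ x

lemma endpoint_mem_boundary (c : Fin 2) (k : SimplexCategoryᵒᵖ) (X : SSet.{u}) (x : X.obj k) :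
    (SSet.const (X := X) (stdSimplex.obj₀Equiv.{u}.symm c)).app k x ∈ (∂Δ[1] : Subcomplex _).obj k := by
  intro h
  -- A simplex outside the boundary would be a surjective map to `[1]`, but the constant map at `c`
  -- misses `c + 1`.
  obtain ⟨a, ha⟩ := h (c + 1)
  have ha' : c = c + 1 := ha
  clear * - ha'
  exact absurd ha' (by decide +revert)

lemma ι₀_eq_of_endpoints {X Y : SSet.{u}} {f g : X ⟶ Y} {L : X ⊗ Δ[1] ⟶ Y}
    (h : X ◁ (∂Δ[1] : Subcomplex _).ι ≫ L = ofEndpoints f g) : ι₀ ≫ L = f := by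
  ext k x
  have := ConcreteCategory.congr_hom (congrArg (fun t => NatTrans.app t k) h)
    ⟨x, ⟨_, endpoint_mem_boundary 0 k X x⟩⟩
  refine this.trans ?_
  change (if (0 : Fin 2) = 0 then f.app k x else g.app k x) = f.app k x
  simp

lemma ι₁_eq_of_endpoints {X Y : SSet.{u}} {f g : X ⟶ Y} {L : X ⊗ Δ[1] ⟶ Y}
    (h : X ◁ (∂Δ[1] : Subcomplex _).ι ≫ L = ofEndpoints f g) : ι₁ ≫ L = g := by
  ext k x
  have := ConcreteCategory.congr_hom (congrArg (fun t => NatTrans.app t k) h)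
    ⟨x, ⟨_, endpoint_mem_boundary 1 k X x⟩⟩
  refine this.trans ?_
  change (if (1 : Fin 2) = 0 then f.app k x else g.app k x) = g.app k x
  simp

lemma comp_ofEndpoints {X Y Z : SSet.{u}} (f g : X ⟶ Y) (p : Y ⟶ Z) :
    ofEndpoints f g ≫ p = ofEndpoints (f ≫ p) (g ≫ p) := by
  ext k ⟨x, t⟩
  change p.app k (if _ then _ else _) = if _ then _ else _
  split_ifs <;> rfl

lemma whiskerRight_ofEndpoints {X Y Z : SSet.{u}} (i : Z ⟶ X) (f g : X ⟶ Y) :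
    i ▷ _ ≫ ofEndpoints f g = ofEndpoints (i ≫ f) (i ≫ g) := by
  ext k ⟨x, t⟩
  rfl

lemma ofEndpoints_self {X Y : SSet.{u}} (f : X ⟶ Y) :
    ofEndpoints f f = CartesianMonoidalCategory.fst _ _ ≫ f := by
  ext k ⟨x, t⟩
  exact ite_self _

lemma weakAnodyne_pushoutObjObjι' {X₁ Y₁ X₂ Y₂ : SSet.{u}} {i : X₁ ⟶ Y₁} {j : X₂ ⟶ Y₂} [Mono j]
    (hi : weakAnodyne i) (sq : (curriedTensor SSet.{u}).PushoutObjObj i j) :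
    weakAnodyne sq.ι := by
  refine (weakAnodyne.arrow_mk_iso_iff ?_).1 (weakAnodyne_pushoutObjObjι hi sq.flipTensor)
  exact Arrow.isoMk (Iso.refl _) (β_ _ _)

/-- Two lifts in a square that agree on the source of a weakly anodyne map are homotopic over
the base. -/
lemma exists_homotopy_of_weakAnodyne {A B E F : SSet.{u}} {i : A ⟶ B} (hi : weakAnodyne i)
    {p : E ⟶ F} (hp : kanFibrations p) (f g : B ⟶ E) (h₁ : i ≫ f = i ≫ g) (h₂ : f ≫ p = g ≫ p) :
    ∃ L : B ⊗ Δ[1] ⟶ E, ι₀ ≫ L = f ∧ ι₁ ≫ L = g ∧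
      L ≫ p = CartesianMonoidalCategory.fst _ _ ≫ f ≫ p := by
  -- Lift against the pushout-product of `i` with `∂Δ[1] ⊂ Δ[1]`, prescribing `f` and `g` at the two
  -- ends and the constant homotopy on `A`.
  let sq := Functor.PushoutObjObj.ofHasPushout (curriedTensor SSet.{u}) i (∂Δ[1] : Subcomplex _).ι
  have hlift := weakAnodyne_pushoutObjObjι' hi sq p hp
  let t : sq.pt ⟶ E := sq.isPushout.desc (ofEndpoints f g)
    (CartesianMonoidalCategory.fst _ _ ≫ i ≫ f) (by
      refine (whiskerRight_ofEndpoints i f g).trans ?_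
      rw [← h₁, ofEndpoints_self]
      rfl)
  have hcomm : CommSq t sq.ι p (CartesianMonoidalCategory.fst _ _ ≫ f ≫ p) := by
    refine ⟨sq.isPushout.hom_ext ?_ ?_⟩
    · rw [IsPushout.inl_desc_assoc, Functor.PushoutObjObj.inl_ι_assoc, comp_ofEndpoints, ← h₂,
        ofEndpoints_self]
      rfl
    · rw [IsPushout.inr_desc_assoc, Functor.PushoutObjObj.inr_ι_assoc]
      rfl
  have h₃ : B ◁ (∂Δ[1] : Subcomplex _).ι ≫ hcomm.lift = ofEndpoints f g := by
    have := congrArg (fun φ => sq.inl ≫ φ) hcomm.fac_left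
    rw [Functor.PushoutObjObj.inl_ι_assoc, IsPushout.inl_desc] at this
    exact this
  exact ⟨hcomm.lift, ι₀_eq_of_endpoints h₃, ι₁_eq_of_endpoints h₃, hcomm.fac_right⟩

/-- A lift on `C` exists for the restriction of the problem along `i`. On `B` it agrees with `g`
only after restriction to `A`, but then it is homotopic to `g` over `F`. Extending this homotopy to
`C` from the vertex `0`, with constant projection to `F`, and taking its other end gives a lift that
agrees with `g` strictly. -/
lemma weakAnodyne_of_comp {A B C : SSet.{u}} {i : A ⟶ B} {j : B ⟶ C} [Mono j]
    (hi : weakAnodyne i) (hij : weakAnodyne (i ≫ j)) : weakAnodyne j := by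
  intro E F p hp
  refine ⟨fun {g b} sq => ?_⟩
  have hl := hij p hp
  have sq₁ : CommSq (i ≫ g) (i ≫ j) p b := ⟨by rw [Category.assoc, Category.assoc, sq.w]⟩
  obtain ⟨L, hL₀, hL₁, hLp⟩ := exists_homotopy_of_weakAnodyne hi hp (j ≫ sq₁.lift) g
    (by rw [← Category.assoc, sq₁.fac_left]) (by rw [Category.assoc, sq₁.fac_right, sq.w])
  let po := Functor.PushoutObjObj.ofHasPushout (curriedTensor SSet.{u}) j
    vertexZero
  have hpo := anodyne_le_weakAnodyne _ (anodyneExtensions_pushoutObjObjι po anodyne_vertexZero) p hp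
  let t : po.pt ⟶ E := po.isPushout.desc
    (CartesianMonoidalCategory.fst C (Δ[0] : SSet.{u}) ≫ sq₁.lift) L (by
      change j ▷ _ ≫ _ = B ◁ vertexZero ≫ L
      rw [whiskerLeft_vertexZero, Category.assoc, hL₀]
      rfl)
  have hcomm : CommSq t po.ι p (CartesianMonoidalCategory.fst C (Δ[1] : SSet.{u}) ≫ b) := by
    refine ⟨po.isPushout.hom_ext ?_ ?_⟩
    · rw [IsPushout.inl_desc_assoc, Functor.PushoutObjObj.inl_ι_assoc, Category.assoc,
        sq₁.fac_right]
      rfl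
    · rw [IsPushout.inr_desc_assoc, Functor.PushoutObjObj.inr_ι_assoc, hLp, Category.assoc,
        sq₁.fac_right]
      rfl
  have h₁ : j ▷ (Δ[1] : SSet.{u}) ≫ hcomm.lift = L := by
    have := congrArg (fun φ => po.inr ≫ φ) hcomm.fac_left
    rw [Functor.PushoutObjObj.inr_ι_assoc, IsPushout.inr_desc] at this
    exact this
  refine ⟨⟨⟨ι₁ ≫ hcomm.lift, ?_, ?_⟩⟩⟩
  · rw [← hL₁, ← h₁]
    rfl
  · rw [Category.assoc, hcomm.fac_right, ← Category.assoc, ι₁_fst, Category.id_comp]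

/-- The inclusion of a strong deformation retract is anodyne. -/
lemma anodyne_of_deformationRetract {A C : SSet.{u}} {i : A ⟶ C} {r : C ⟶ A}
    (hr : i ≫ r = 𝟙 A) (H : C ⊗ Δ[1] ⟶ C) (h₀ : ι₀ ≫ H = r ≫ i) (h₁ : ι₁ ≫ H = 𝟙 C)
    (hi : i ▷ _ ≫ H = CartesianMonoidalCategory.fst _ _ ≫ i) : anodyneExtensions i := by
  have : Mono i := mono_of_mono_fac hr
  intro E F p hp
  refine ⟨fun {a b} sq => ?_⟩
  -- Lift `H ≫ b` through `p`, starting at `r ≫ a` and staying constant on `A`. Since `H` ends at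
  -- the identity, the end of the lifted homotopy solves the original problem.
  let po := Functor.PushoutObjObj.ofHasPushout (curriedTensor SSet.{u}) i
    vertexZero
  have hpo := anodyneExtensions_pushoutObjObjι po anodyne_vertexZero p hp
  let t : po.pt ⟶ E := po.isPushout.desc
    (CartesianMonoidalCategory.fst C (Δ[0] : SSet.{u}) ≫ r ≫ a)
    (CartesianMonoidalCategory.fst A (Δ[1] : SSet.{u}) ≫ a) (by
      have e : CartesianMonoidalCategory.fst A (Δ[0] : SSet.{u}) ≫ i ≫ r ≫ a =
        CartesianMonoidalCategory.fst A (Δ[0] : SSet.{u}) ≫ a := by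
        rw [← Category.assoc i, hr, Category.id_comp]
      exact e)
  have ht₁ : po.inl ≫ t = CartesianMonoidalCategory.fst C (Δ[0] : SSet.{u}) ≫ r ≫ a :=
    po.isPushout.inl_desc _ _ _
  have ht₂ : po.inr ≫ t = CartesianMonoidalCategory.fst A (Δ[1] : SSet.{u}) ≫ a :=
    po.isPushout.inr_desc _ _ _
  have hcomm : CommSq t po.ι p (H ≫ b) := by
    refine ⟨po.isPushout.hom_ext ?_ ?_⟩
    · rw [← Category.assoc, ht₁, Functor.PushoutObjObj.inl_ι_assoc]
      change _ = C ◁ vertexZero ≫ H ≫ b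
      rw [whiskerLeft_vertexZero, Category.assoc, Category.assoc, Category.assoc, sq.w,
        ← Category.assoc ι₀, h₀, Category.assoc]
    · rw [← Category.assoc, ht₂, Functor.PushoutObjObj.inr_ι_assoc, Category.assoc, sq.w]
      change _ = i ▷ (Δ[1] : SSet.{u}) ≫ H ≫ b
      rw [← Category.assoc (i ▷ _), hi, Category.assoc]
  have h₂ : i ▷ (Δ[1] : SSet.{u}) ≫ hcomm.lift = CartesianMonoidalCategory.fst _ _ ≫ a := by
    have := congrArg (fun φ => po.inr ≫ φ) hcomm.fac_left
    rw [Functor.PushoutObjObj.inr_ι_assoc, ht₂] at this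
    exact this
  refine ⟨⟨⟨ι₁ ≫ hcomm.lift, ?_, ?_⟩⟩⟩
  · rw [← Category.assoc, ← ι₁_comp, Category.assoc, h₂, ← Category.assoc, ι₁_fst,
      Category.id_comp]
  · rw [Category.assoc, hcomm.fac_right, ← Category.assoc, h₁, Category.id_comp]

/-! ### Components and weak equivalences -/

/-- Homotopic maps agree on components. -/
lemma mapπ₀_eq_of_homotopy {X Y : SSet.{u}} (H : X ⊗ Δ[1] ⟶ Y) :
    mapπ₀ (ι₀ ≫ H) = mapπ₀ (ι₁ ≫ H) := by
  funext x
  induction x with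
  | mk x =>
    simp only [mapπ₀_mk]
    -- The connecting edge is the image under `H` of the degenerate edge on `x` paired with the
    -- nondegenerate edge of `Δ[1]`; its faces `d₁` and `d₀` are the images of `x` at the two ends
    -- of the homotopy.
    have e : ∀ j : Fin 2, Y.δ j (H.app _ ⟨X.σ 0 x, stdSimplex.objEquiv.symm (𝟙 _)⟩) =
        H.app _ ⟨X.δ j (X.σ 0 x), Δ[1].δ j (stdSimplex.objEquiv.symm (𝟙 _))⟩ :=
      fun j => (NatTrans.naturality_apply H (SimplexCategory.δ j).op _).symm
    refine π₀.sound (Edge.mk (H.app _ ⟨X.σ 0 x, stdSimplex.objEquiv.symm (𝟙 _)⟩) ?_ ?_)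
    · rw [e]
      refine congrArg (H.app _) (Prod.ext (X.δ_comp_σ_succ_apply 0 x) ?_)
      refine stdSimplex.objEquiv.injective
        (SimplexCategory.Hom.ext _ _ (OrderHom.ext _ _ (funext fun j => ?_)))
      obtain rfl : j = 0 := Subsingleton.elim (α := Fin 1) _ _
      rfl
    · rw [e]
      refine congrArg (H.app _) (Prod.ext (X.δ_comp_σ_self_apply 0 x) ?_)
      refine stdSimplex.objEquiv.injective
        (SimplexCategory.Hom.ext _ _ (OrderHom.ext _ _ (funext fun j => ?_)))
      obtain rfl : j = 0 := Subsingleton.elim (α := Fin 1) _ _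
      rfl

/-- Lifting against `∅ ⟶ F` gives a section of `p`. Lifting against `E × ∂Δ[1] ⟶ E × Δ[1]` gives a
homotopy from `p` followed by the section to the identity. -/
lemma mapπ₀_bijective_of_rlp {E F : SSet.{u}} {p : E ⟶ F}
    (hp : (MorphismProperty.monomorphisms SSet.{u}).rlp p) : Function.Bijective (mapπ₀ p) := by
  have sq : CommSq (initial.to E) (initial.to F) p (𝟙 F) := ⟨initialIsInitial.hom_ext _ _⟩
  have := hp (initial.to F) inferInstance
  have hs : sq.lift ≫ p = 𝟙 F := sq.fac_right
  have sq' : CommSq (ofEndpoints (p ≫ sq.lift) (𝟙 E)) (E ◁ (∂Δ[1] : Subcomplex _).ι) p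
      (CartesianMonoidalCategory.fst _ _ ≫ p) := ⟨by
    rw [comp_ofEndpoints, Category.assoc, hs, Category.comp_id, Category.id_comp,
      ofEndpoints_self]
    rfl⟩
  have := hp (E ◁ (∂Δ[1] : Subcomplex _).ι) (by
    change Mono _
    rw [NatTrans.mono_iff_mono_app]
    intro k
    rw [mono_iff_injective]
    rintro ⟨x, y⟩ ⟨x', y'⟩ h
    exact Prod.ext (congrArg (fun t : (E ⊗ Δ[1]).obj k => t.1) h)
      (Subtype.ext (congrArg (fun t : (E ⊗ Δ[1]).obj k => t.2) h)))
  have h := mapπ₀_eq_of_homotopy sq'.lift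
  rw [ι₀_eq_of_endpoints sq'.fac_left, ι₁_eq_of_endpoints sq'.fac_left] at h
  refine ⟨Function.LeftInverse.injective (g := mapπ₀ sq.lift) fun x => ?_,
    Function.RightInverse.surjective (g := mapπ₀ sq.lift) fun x => ?_⟩
  · rw [← mapπ₀_comp_apply, h, mapπ₀_id_apply]
  · rw [← mapπ₀_comp_apply, hs, mapπ₀_id_apply]

namespace IsWeakEquivalence

/-- Restriction `Fun(B, Z) ⟶ Fun(A, Z)` lifts against every monomorphism `j`: by adjunction this is
lifting of the pushout-product of `i` and `j`, which is weakly anodyne, against `Z ⟶ *`. Such a map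
is bijective on components. -/
lemma of_weakAnodyne {A B : SSet.{u}} {i : A ⟶ B} [Mono i] (hi : weakAnodyne i) :
    IsWeakEquivalence i := by
  intro Z hZ
  apply mapπ₀_bijective_of_rlp
  intro K L j hj
  have : Mono j := hj
  let po := Functor.PushoutObjObj.ofHasPushout (curriedTensor SSet.{u}) i j
  let pb := Functor.PullbackObjObj.ofIsTerminal MonoidalClosed.internalHom i (terminal.from Z)
    terminalIsTerminal
  change HasLiftingProperty j pb.π
  rw [← MonoidalClosed.internalHomAdjunction₂.hasLiftingProperty_iff po]
  refine weakAnodyne_pushoutObjObjι' hi po _ ⟨?_, ?_⟩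
  · exact (isFibrant_iff Z).1 hZ
  · refine (isFibrant_iff _).2 ?_
    have : IsIso (terminal.from (⊤_ SSet.{u})) :=
      isIso_of_isTerminal terminalIsTerminal terminalIsTerminal _
    infer_instance

lemma id (X : SSet.{u}) : IsWeakEquivalence (𝟙 X) := of_weakAnodyne (weakAnodyne.id_mem X)

lemma mapπ₀_pre_comp {X Y W : SSet.{u}} (f : X ⟶ Y) (g : Y ⟶ W) (Z : SSet.{u}) :
    mapπ₀ ((MonoidalClosed.pre (f ≫ g)).app Z) =
      mapπ₀ ((MonoidalClosed.pre f).app Z) ∘ mapπ₀ ((MonoidalClosed.pre g).app Z) := by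
  funext x
  rw [MonoidalClosed.pre_map]
  exact mapπ₀_comp_apply _ _ x

variable {X Y W : SSet.{u}} {f : X ⟶ Y} {g : Y ⟶ W}

lemma comp (hf : IsWeakEquivalence f) (hg : IsWeakEquivalence g) :
    IsWeakEquivalence (f ≫ g) := fun Z hZ => by
  rw [mapπ₀_pre_comp]; exact (hf Z hZ).comp (hg Z hZ)

lemma of_comp_left (hf : IsWeakEquivalence f) (hfg : IsWeakEquivalence (f ≫ g)) :
    IsWeakEquivalence g := fun Z hZ => by
  have h := hfg Z hZ
  rw [mapπ₀_pre_comp] at h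
  exact (Function.Bijective.of_comp_iff' (hf Z hZ) _).1 h

lemma of_comp_right (hg : IsWeakEquivalence g) (hfg : IsWeakEquivalence (f ≫ g)) :
    IsWeakEquivalence f := fun Z hZ => by
  have h := hfg Z hZ
  rw [mapπ₀_pre_comp] at h
  exact (Function.Bijective.of_comp_iff _ (hg Z hZ)).1 h

lemma of_isIso (f : X ⟶ Y) [IsIso f] : IsWeakEquivalence f :=
  of_weakAnodyne (MorphismProperty.of_isIso weakAnodyne f)

end IsWeakEquivalence

end IGamma

/-! ### Diagonals of levelwise weakly anodyne maps of bisimplicial sets -/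

namespace IGamma
open Limits HomotopicalAlgebra SSet SSet.modelCategoryQuillen Simplicial

/-- Degreewise, `D'` is `D` together with the image of `f`, and outside the preimage `S` of `D` the
map `f` is injective. So `D'` arises from `D` by attaching `P` along `S`. This is the form in which
cells are attached in the skeletal filtration. -/
lemma isPushout_of_injOn_compl {P Q : SSet.{u}} (f : P ⟶ Q) {D D' : Q.Subcomplex} (hD : D ≤ D')
    (S : P.Subcomplex) (hS : D.preimage f = S) (hf : Subcomplex.range f ≤ D')
    (hD' : D' ≤ D ⊔ Subcomplex.range f)
    (hinj : ∀ (k : SimplexCategoryᵒᵖ) (x y : P.obj k), x ∉ S.obj k → y ∉ S.obj k →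
      f.app k x = f.app k y → x = y) :
    IsPushout (Subcomplex.lift (B := D) (S.ι ≫ f) (by
      rintro k _ ⟨x, rfl⟩
      exact hS.ge _ x.2))
      S.ι (Subcomplex.homOfLE hD) (Subcomplex.lift f hf) where
  w := rfl
  isColimit' := ⟨evaluationJointlyReflectsColimits _ (fun k ↦ by
    refine (isColimitMapCoconePushoutCoconeEquiv _ _).2 (IsPushout.isColimit ?_)
    have hm : Mono (((evaluation SimplexCategoryᵒᵖ (Type u)).obj k).map (Subcomplex.homOfLE hD)) := by
      rw [mono_iff_injective]
      intro x y h
      exact Subtype.ext (congrArg (fun z : D'.obj k => z.1) h)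
    refine Types.isPushout_of_isPullback_of_mono' ?_ ?_ ?_
    · rw [Types.isPullback_iff]
      refine ⟨rfl, fun x y h => Subtype.ext h.2, fun x y h => ?_⟩
      have h' : x.1 = f.app k y := congrArg Subtype.val h
      subst hS
      exact ⟨⟨y, by change f.app k y ∈ D.obj k; rw [← h']; exact x.2⟩, Subtype.ext h'.symm, rfl⟩
    · refine Set.eq_univ_of_forall fun x => ?_
      obtain h | ⟨y, hy⟩ := hD' _ x.2
      · exact Or.inl ⟨⟨x.1, h⟩, rfl⟩
      · exact Or.inr ⟨y, Subtype.ext hy⟩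
    · intro x y hx hy h
      exact hinj k x y (fun h' => hx ⟨⟨x, h'⟩, rfl⟩) (fun h' => hy ⟨⟨y, h'⟩, rfl⟩)
        (congrArg Subtype.val h))⟩

variable (a : SimplexCategoryᵒᵖ ⥤ SimplexCategoryᵒᵖ)

/-- The restriction of a bisimplicial set along `l ↦ (a l, l)`. For `a = 𝟭` this is the diagonal, for
`a` constant one of the rows. -/
def along : SimplicialObject SSet.{u} ⥤ SSet.{u} where
  obj B :=
    { obj := fun l => (B.obj (a.obj l)).obj l
      map := fun {k l} φ => (B.map (a.map φ)).app k ≫ (B.obj (a.obj l)).map φ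
      map_comp := fun φ ψ => by simp }
  map f :=
    { app := fun l => (f.app (a.obj l)).app l
      naturality := fun k l φ => by
        have h := congrArg (fun t => NatTrans.app t k) (f.naturality (a.map φ))
        simp only [NatTrans.comp_app] at h
        simp only [Category.assoc, NatTrans.naturality]
        rw [← Category.assoc, ← Category.assoc, h] }

section filtration
variable {B X : SimplicialObject SSet.{u}} (f : B ⟶ X)

/-- The union of the image of `f` and the `m`-skeleton (the simplices that come from degrees `< m`) with
respect to the outer simplicial direction. -/
def filt (m : ℕ) (k : SimplexCategoryᵒᵖ) : (X.obj k).Subcomplex where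
  obj l := {x | (∃ b, (f.app k).app l b = x) ∨
    ∃ (j : ℕ) (_ : j < m) (φ : op ⦋j⦌ ⟶ k) (y : (X.obj (op ⦋j⦌)).obj l), (X.map φ).app l y = x}
  map {l l'} ψ := by
    rintro x (⟨b, rfl⟩ | ⟨j, hj, φ, y, rfl⟩)
    · exact Or.inl ⟨_, NatTrans.naturality_apply _ _ _⟩
    · exact Or.inr ⟨j, hj, φ, _, NatTrans.naturality_apply _ _ _⟩

lemma map_mem_filt {m : ℕ} {k k' l : SimplexCategoryᵒᵖ} (ψ : k ⟶ k') {x : (X.obj k).obj l}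
    (hx : x ∈ (filt f m k).obj l) : (X.map ψ).app l x ∈ (filt f m k').obj l := by
  obtain ⟨b, rfl⟩ | ⟨j, hj, φ, y, rfl⟩ := hx
  · exact Or.inl ⟨(B.map ψ).app l b,
      ConcreteCategory.congr_hom (congrArg (fun t => NatTrans.app t l) (f.naturality ψ)) b⟩
  · exact Or.inr ⟨j, hj, φ ≫ ψ, y, by rw [X.map_comp]; rfl⟩

lemma filt_mono {m m' : ℕ} (h : m ≤ m') (k : SimplexCategoryᵒᵖ) : filt f m k ≤ filt f m' k := by
  rintro l x (hx | ⟨j, hj, hx⟩)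
  · exact Or.inl hx
  · exact Or.inr ⟨j, hj.trans_le h, hx⟩

lemma filt_zero (k : SimplexCategoryᵒᵖ) : filt f 0 k = Subcomplex.range (f.app k) := by
  ext l x
  exact ⟨fun h => h.elim id (fun ⟨j, hj, _⟩ => absurd hj (Nat.not_lt_zero j)), Or.inl⟩

/-- The filtration on the restriction along `l ↦ (a l, l)`. -/
def filtAlong (m : ℕ) : ((along a).obj X).Subcomplex where
  obj l := (filt f m (a.obj l)).obj l
  map {_ l'} ψ _ hx := (filt f m (a.obj l')).map ψ (map_mem_filt f (a.map ψ) hx)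

lemma filtAlong_mono {m m' : ℕ} (h : m ≤ m') : filtAlong a f m ≤ filtAlong a f m' :=
  fun _ => filt_mono f h _ _

variable (X) in
/-- The attaching map of the `m`-th step of the filtration. -/
def attach (m : ℕ) : (a ⋙ Δ[m] : SSet.{u}) ⊗ X.obj (op ⦋m⦌) ⟶ (along a).obj X where
  app l := ↾fun p => (X.map (stdSimplex.objEquiv p.1).op).app l p.2
  naturality l l' ψ := by
    ext ⟨φ, x⟩
    change (X.map (stdSimplex.objEquiv (Δ[m].map (a.map ψ) φ)).op).app l' ((X.obj _).map ψ x) =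
      (X.obj _).map ψ ((X.map (a.map ψ)).app l ((X.map (stdSimplex.objEquiv φ).op).app l x))
    have h : (stdSimplex.objEquiv (Δ[m].map (a.map ψ) φ)).op =
      (stdSimplex.objEquiv φ).op ≫ a.map ψ := rfl
    rw [h, X.map_comp, NatTrans.naturality_apply]
    rfl

/-- The simplices of `a ⋙ Δ[m]` in the boundary of `Δ[m]`. -/
def boundaryAlong (m : ℕ) : Subcomplex (a ⋙ Δ[m] : SSet.{u}) where
  obj l := (∂Δ[m] : Subcomplex _).obj (a.obj l)
  map ψ _ hx := (∂Δ[m] : Subcomplex _).map (a.map ψ) hx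

/-- The image of a non-surjective `φ` is some `[j]` with `j < m`, through which the operator
factors. -/
lemma map_mem_filt_of_not_epi {m : ℕ} {n : SimplexCategory} (φ : n ⟶ ⦋m⦌) (hφ : ¬ Epi φ)
    {l : SimplexCategoryᵒᵖ} (x : (X.obj (op ⦋m⦌)).obj l) :
    (X.map φ.op).app l x ∈ (filt f m (op n)).obj l := by
  have hlt : (image φ).len < m := by
    refine lt_of_le_of_ne (SimplexCategory.len_le_of_mono (image.ι φ)) fun h => hφ ?_
    have : IsIso (image.ι φ) := (SimplexCategory.isIso_iff_of_mono _).2 h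
    rw [← image.fac φ]
    infer_instance
  refine Or.inr ⟨(image φ).len, hlt, (factorThruImage φ).op, (X.map (image.ι φ).op).app l x, ?_⟩
  have : (X.map φ.op) = X.map (image.ι φ).op ≫ X.map (factorThruImage φ).op := by
    rw [← X.map_comp, ← op_comp, image.fac]
  rw [this]
  rfl

/-- Surjections in the simplex category split, so `x` is recovered from its degeneracy by applying a
section, and the filtration is stable under the operators. -/
lemma map_mem_filt_iff {m : ℕ} {n : SimplexCategory} (φ : n ⟶ ⦋m⦌) [Epi φ]
    {l : SimplexCategoryᵒᵖ} (x : (X.obj (op ⦋m⦌)).obj l) :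
    (X.map φ.op).app l x ∈ (filt f m (op n)).obj l ↔ x ∈ (filt f m (op ⦋m⦌)).obj l := by
  refine ⟨fun h => ?_, map_mem_filt f _⟩
  obtain ⟨⟨s⟩⟩ := isSplitEpi_of_epi φ
  have := map_mem_filt f s.section_.op h
  have e : X.map φ.op ≫ X.map s.section_.op = 𝟙 _ := by
    rw [← X.map_comp, ← op_comp, s.id, op_id, X.map_id]
  have e' := ConcreteCategory.congr_hom (congrArg (fun t => NatTrans.app t l) e) x
  rw [← show _ = x from e']
  exact this

/-- This is the Eilenberg-Zilber lemma in the outer direction at fixed inner degree `l`: an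
`m`-simplex outside `filt f m` does not come from lower degree, hence is nondegenerate, and a
nondegenerate simplex and its degeneracy operator are determined by the resulting degenerate
simplex. -/
lemma map_inj_of_notMem_filt {m : ℕ} {n : SimplexCategory} (φ φ' : n ⟶ ⦋m⦌) [Epi φ]
    {l : SimplexCategoryᵒᵖ} {x x' : (X.obj (op ⦋m⦌)).obj l} (hx : x ∉ (filt f m (op ⦋m⦌)).obj l)
    (hx' : x' ∉ (filt f m (op ⦋m⦌)).obj l)
    (h : (X.map φ.op).app l x = (X.map φ'.op).app l x') : φ = φ' ∧ x = x' := by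
  induction n using SimplexCategory.rec with | _ n
  let Y : SSet.{u} := X ⋙ (evaluation _ _).obj l
  have key : ∀ y : Y _⦋m⦌, y ∉ (filt f m (op ⦋m⦌)).obj l → y ∈ Y.nonDegenerate m := by
    rintro y hy ⟨j, hj, ψ, z, rfl⟩
    exact hy (Or.inr ⟨j, hj, ψ.op, z, rfl⟩)
  exact ⟨Y.unique_nonDegenerate_map _ φ ⟨x, key x hx⟩ rfl φ' ⟨x', key x' hx'⟩ h,
    congrArg Subtype.val
      (Y.unique_nonDegenerate_simplex _ φ ⟨x, key x hx⟩ rfl φ' ⟨x', key x' hx'⟩ h)⟩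

lemma notMem_boundary_iff {m : ℕ} {k : SimplexCategoryᵒᵖ} (φ : (Δ[m] : SSet.{u}).obj k) :
    φ ∉ (∂Δ[m] : Subcomplex _).obj k ↔ Epi (stdSimplex.objEquiv φ) := by
  rw [SimplexCategory.epi_iff_surjective]
  exact not_not

/-- Stage `m + 1` is obtained by attaching `Δ[m] × X_m` (with `Δ[m]` reindexed by `a`) along the
union of `∂Δ[m] × X_m` and `Δ[m] × filt_m X_m`. That inclusion is the pushout-product of a
monomorphism with the map assumed weakly anodyne. The Eilenberg-Zilber lemma provides injectivity
off the attaching locus. -/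
lemma weakAnodyne_filtAlong_step (m : ℕ) (h : weakAnodyne (filt f m (op ⦋m⦌)).ι) :
    weakAnodyne (Subcomplex.homOfLE (filtAlong_mono a f (Nat.le_succ m))) := by
  refine weakAnodyne.of_isPushout (isPushout_of_injOn_compl (attach a X m) _
    ((boundaryAlong a m).unionProd (filt f m (op ⦋m⦌))) ?_ ?_ ?_ ?_)
    (weakAnodyne_unionProd_ι _ _ h)
  · ext l ⟨φ, x⟩
    refine Iff.trans ?_ (Subcomplex.mem_unionProd_iff _ _ _).symm
    change (X.map (stdSimplex.objEquiv φ).op).app l x ∈ (filt f m (a.obj l)).obj l ↔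
      x ∈ (filt f m (op ⦋m⦌)).obj l ∨ φ ∈ (∂Δ[m] : Subcomplex _).obj (a.obj l)
    by_cases hφ : φ ∈ (∂Δ[m] : Subcomplex _).obj (a.obj l)
    · have := map_mem_filt_of_not_epi f (stdSimplex.objEquiv φ)
        (fun h => (notMem_boundary_iff φ).2 h hφ) x
      exact ⟨fun _ => Or.inr hφ, fun _ => this⟩
    · have := (notMem_boundary_iff φ).1 hφ
      exact (map_mem_filt_iff f (stdSimplex.objEquiv φ) x).trans
        ⟨Or.inl, fun h => h.resolve_right hφ⟩
  · rintro l _ ⟨⟨φ, x⟩, rfl⟩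
    exact Or.inr ⟨m, Nat.lt_succ_self m, (stdSimplex.objEquiv φ).op, x, rfl⟩
  · rintro l x (hx | ⟨j, hj, φ, y, rfl⟩)
    · exact Or.inl (Or.inl hx)
    · obtain hj | rfl := (Nat.lt_succ_iff.1 hj).lt_or_eq
      · exact Or.inl (Or.inr ⟨j, hj, φ, y, rfl⟩)
      · exact Or.inr ⟨⟨stdSimplex.objEquiv.symm φ.unop, y⟩, rfl⟩
  · rintro l ⟨φ, x⟩ ⟨φ', x'⟩ hx hx' h
    have hx₁ := (not_congr (Subcomplex.mem_unionProd_iff _ _ _)).1 hx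
    have hx₂ := (not_congr (Subcomplex.mem_unionProd_iff _ _ _)).1 hx'
    rw [not_or] at hx₁ hx₂
    have := (notMem_boundary_iff φ).1 hx₁.2
    obtain ⟨h₁, h₂⟩ := map_inj_of_notMem_filt f (stdSimplex.objEquiv φ) (stdSimplex.objEquiv φ')
      hx₁.1 hx₂.1 h
    exact Prod.ext (stdSimplex.objEquiv.injective h₁) h₂

/-- The rows of a bisimplicial set as restrictions along constant functors. -/
def rowIso (k : SimplexCategoryᵒᵖ) : (along ((Functor.const _).obj k)).obj X ≅ X.obj k :=
  NatIso.ofComponents (fun l => Iso.refl _) (fun {l l'} φ => by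
    change ((X.map (𝟙 k)).app l ≫ (X.obj k).map φ) ≫ 𝟙 _ = 𝟙 _ ≫ _
    simp)

/-- The same attachment seen in a single row, by taking `a` constant. -/
lemma weakAnodyne_filt_step (m : ℕ) (h : weakAnodyne (filt f m (op ⦋m⦌)).ι)
    (k : SimplexCategoryᵒᵖ) :
    weakAnodyne (Subcomplex.homOfLE (filt_mono f (Nat.le_succ m) k)) := by
  let e : ∀ m, ((filtAlong ((Functor.const _).obj k) f m : Subcomplex _) : SSet.{u}) ≅
      ((filt f m k : Subcomplex _) : SSet.{u}) := fun m =>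
    NatIso.ofComponents (fun l => Iso.refl _) (fun {l l'} φ => by
      ext x
      exact Subtype.ext
        (ConcreteCategory.congr_hom ((rowIso (X := X) k).hom.naturality φ) x.1 :))
  refine (weakAnodyne.arrow_mk_iso_iff (Arrow.isoMk (e m) (e (m + 1)) ?_)).1
    (weakAnodyne_filtAlong_step ((Functor.const _).obj k) f m h)
  rfl

variable (hf : ∀ k, Mono (f.app k)) (hf' : ∀ k, weakAnodyne (f.app k))

include hf hf'

/-- Induction on `m`, for all rows at once: the row of degree `m` supplies the hypothesis of the
attaching step in every row `k`. Then `filt_m ⟶ filt_{m+1}` and `filt_m ⟶ X_k` are both weakly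
anodyne, and cancellation handles `filt_{m+1} ⟶ X_k`. -/
lemma weakAnodyne_filt (m : ℕ) : ∀ k, weakAnodyne (filt f m k).ι := by
  induction m with
  | zero =>
    intro k
    rw [filt_zero]
    have : IsIso (Subcomplex.toRange (f.app k)) := by
      have := hf k
      infer_instance
    exact (weakAnodyne.arrow_mk_iso_iff (Arrow.isoMk (f := Arrow.mk (f.app k))
      (g := Arrow.mk (Subcomplex.range (f.app k)).ι) (@asIso _ _ _ _ _ this) (Iso.refl _) rfl)).1 (hf' k)
  | succ m ih =>
    intro k
    exact weakAnodyne_of_comp (weakAnodyne_filt_step f m (ih _) k) (ih k)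

omit hf' in
lemma mono_along : Mono ((along a).map f) := by
  rw [NatTrans.mono_iff_mono_app]
  intro l
  have := hf (a.obj l)
  exact inferInstanceAs (Mono ((f.app (a.obj l)).app l))

omit hf hf' in
lemma filtAlong_zero : filtAlong a f 0 = Subcomplex.range ((along a).map f) := by
  ext l x
  exact ⟨fun h => h.elim id (fun ⟨j, hj, _⟩ => absurd hj (Nat.not_lt_zero j)), Or.inl⟩

/-- On the diagonal, the filtration exhibits the map as a countable composite of weakly anodyne
attaching steps, starting from its image. -/
lemma weakAnodyne_diag : weakAnodyne ((along (𝟭 _)).map f) := by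
  have := mono_along (𝟭 _) f hf
  have hF : Monotone (filtAlong (𝟭 _) f) := fun _ _ h => filtAlong_mono _ f h
  have htop : ⨆ m, filtAlong (𝟭 _) f m = ⊤ := by
    refine top_le_iff.1 fun l x _ => ?_
    -- A diagonal simplex of degree `n` has outer degree `n`, hence lies in stage `n + 1`, as `filt
    -- f m` uses degrees strictly below `m`.
    refine (le_iSup (filtAlong (𝟭 _) f) (l.unop.len + 1)) l
      (Or.inr ⟨l.unop.len, Nat.lt_succ_self _, 𝟙 l, x, ?_⟩)
    rw [X.map_id]
    rfl
  let T : weakAnodyne.TransfiniteCompositionOfShape ℕ ((along (𝟭 _)).map f) :=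
    { F := hF.functor ⋙ Subcomplex.toSSetFunctor
      isoBot := Subcomplex.eqToIso (filtAlong_zero _ f) ≪≫ (asIso (Subcomplex.toRange _)).symm
      isWellOrderContinuous := inferInstance
      incl := { app := fun m => (filtAlong (𝟭 _) f m).ι }
      isColimit := IsColimit.ofIsoColimit (isColimitOfPreserves Subcomplex.toSSetFunctor
        (CompleteLattice.colimitCocone hF.functor).isColimit)
        (Cocone.ext (Subcomplex.eqToIso htop ≪≫ Subcomplex.topIso _))
      map_mem := fun m _ => weakAnodyne_filtAlong_step (𝟭 _) f m (weakAnodyne_filt f hf hf' m _) }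
  have : weakAnodyne.{u}.IsStableUnderTransfiniteCompositionOfShape ℕ :=
    kanFibrations.isStableUnderTransfiniteCompositionOfShape_llp ℕ
  exact MorphismProperty.transfiniteCompositionsOfShape_le weakAnodyne.{u} ℕ _ ⟨T⟩
end filtration

end IGamma

/-! ### Homotopies and equality of simplices in homotopy colimits -/

namespace IGamma
open Limits HomotopicalAlgebra SSet SSet.modelCategoryQuillen Simplicial FinInj Subsets CommIMonoid

section hocolim
variable {C D : Type} [Category.{0} C] [Category.{0} D]

/-- The naturality of `β` replaces all bookkeeping with casts: a natural transformation of chains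
whose components happen to be identities identifies the chains. -/
lemma hocolim_ext_of_hom {F : C ⥤ SSet.{u}} {k : SimplexCategoryᵒᵖ} {p q : HocolimSimplex F k}
    (β : p.1 ⟶ q.1) (hβ : ∀ i, ∃ h, β.app i = eqToHom h)
    (hx : (F.map (β.app 0)).app k p.2 = q.2) : p = q := by
  choose h hβ using hβ
  refine hocolim_ext h (fun i j f => ?_) ?_
  · rw [← hβ, ← hβ, β.naturality]
  · rw [← hβ]
    exact hx

/-- The functor `Fin (n + 1) ⥤ Fin 2` given by an `n`-simplex of `Δ[1]`. -/
def intervalChain {k : SimplexCategoryᵒᵖ} (t : (Δ[1] : SSet.{u}).obj k) :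
    ComposableArrows (Fin 2) k.unop.len :=
  (stdSimplex.objEquiv t).toOrderHom.monotone.functor

/-- The chain `i ↦ T(t_i)(c_i)`. -/
def twist (T : Fin 2 ⥤ C ⥤ D) {k : SimplexCategoryᵒᵖ} (c : ComposableArrows C k.unop.len)
    (t : (Δ[1] : SSet.{u}).obj k) : ComposableArrows D k.unop.len :=
  Functor.prod' (intervalChain t) c ⋙ Functor.uncurry.obj T

lemma map_app_comp_map (T : Fin 2 ⥤ C ⥤ D) {a b d : Fin 2} (e : a ⟶ b) (e' : b ⟶ d) (e'' : a ⟶ d)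
    {x y : C} (h : x ⟶ y) :
    ((T.map e).app x ≫ (T.obj b).map h) ≫ (T.map e').app y =
      (T.map e'').app x ≫ (T.obj d).map h := by
  rw [Subsingleton.elim e'' (e ≫ e'), T.map_comp, NatTrans.comp_app, Category.assoc, Category.assoc,
    NatTrans.naturality]

lemma map_comp_app (T : Fin 2 ⥤ C ⥤ D) {a b d : Fin 2} (e : a ⟶ b) (e' : b ⟶ d) (e'' : a ⟶ d)
    {x y : C} (h : x ⟶ y) :
    (T.obj a).map h ≫ (T.map e'').app y =
      (T.map e).app x ≫ (T.map e').app x ≫ (T.obj d).map h := by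
  rw [Subsingleton.elim e'' (e ≫ e'), T.map_comp, NatTrans.naturality, NatTrans.comp_app,
    Category.assoc]

/-- The homotopy of maps of homotopy colimits given by two functors of indexing categories with a
natural transformation between them (as a functor `T` on `Fin 2`), and `η : F ⟶ T(0) ⋙ G`. -/
def hocolimHomotopy {F : C ⥤ SSet.{u}} {G : D ⥤ SSet.{u}} (T : Fin 2 ⥤ C ⥤ D)
    (η : F ⟶ T.obj 0 ⋙ G) : hocolim F ⊗ Δ[1] ⟶ hocolim G where
  app k := ↾fun p => ⟨twist T p.1.1 p.2,
    (G.map ((T.map (homOfLE (Fin.zero_le ((intervalChain p.2).obj 0)))).app (p.1.1.obj 0))).app k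
      ((η.app (p.1.1.obj 0)).app k p.1.2)⟩
  naturality {k l} φ := by
    ext ⟨⟨c, x⟩, t⟩
    refine Sigma.ext (by rfl) (heq_of_eq ?_)
    let j := φ.unop.toOrderHom 0
    let a : c.obj 0 ⟶ c.obj j := c.map (homOfLE (Fin.zero_le j))
    let b : (0 : Fin 2) ⟶ (intervalChain t).obj 0 := homOfLE (Fin.zero_le _)
    let b' : (0 : Fin 2) ⟶ (intervalChain t).obj j := homOfLE (Fin.zero_le _)
    let e : (intervalChain t).obj 0 ⟶ (intervalChain t).obj j := (intervalChain t).map (homOfLE (Fin.zero_le j))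
    change (G.map ((T.map b').app (c.obj j))).app l ((η.app (c.obj j)).app l ((F.map a).app l
      ((F.obj (c.obj 0)).map φ x))) = (G.map ((T.map e).app (c.obj 0) ≫ (T.obj _).map a)).app l
        ((G.obj _).map φ ((G.map ((T.map b).app (c.obj 0))).app k ((η.app (c.obj 0)).app k x)))
    have h₁ := ConcreteCategory.congr_hom (congrArg (fun t => NatTrans.app t l)
      (η.naturality a)) ((F.obj (c.obj 0)).map φ x)
    have h₂ := ConcreteCategory.congr_hom ((η.app (c.obj 0)).naturality φ) x
    have h₃ := ConcreteCategory.congr_hom ((G.map ((T.map b).app (c.obj 0))).naturality φ)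
      ((η.app (c.obj 0)).app k x)
    -- Compare the two routes from `T(0)(c₀)` to `T(t_j)(c_j)`: along the chain and then from `0` to
    -- `t_j`, or first from `0` to `t_0` and then along the twisted chain.
    have h₄ := map_comp_app T b e b' a
    refine (congrArg _ h₁).trans ?_
    refine Eq.trans ?_ (congrArg _ h₃)
    have h₅ := congrArg (fun f => (G.map f).app l ((η.app (c.obj 0)).app l
      ((F.obj (c.obj 0)).map φ x))) h₄
    rw [G.map_comp, G.map_comp] at h₅
    refine h₅.trans (congrArg (fun y => (G.map ((T.map e).app (c.obj 0) ≫ (T.obj _).map a)).app l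
      ((G.map ((T.map b).app (c.obj 0))).app l y)) h₂)

variable {F : C ⥤ SSet.{u}} {G : D ⥤ SSet.{u}}

/-- `T(t) ⟶ T(1)` on chains. -/
def twistToOne (T : Fin 2 ⥤ C ⥤ D) {k : SimplexCategoryᵒᵖ} (c : ComposableArrows C k.unop.len)
    (t : (Δ[1] : SSet.{u}).obj k) : twist T c t ⟶ c ⋙ T.obj 1 where
  app i := (T.map (homOfLE (Fin.le_last ((intervalChain t).obj i)))).app (c.obj i)
  naturality i j f := by
    exact map_app_comp_map T _ _ _ _

/-- `T(0) ⟶ T(t)` on chains. -/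
def zeroToTwist (T : Fin 2 ⥤ C ⥤ D) {k : SimplexCategoryᵒᵖ} (c : ComposableArrows C k.unop.len)
    (t : (Δ[1] : SSet.{u}).obj k) : c ⋙ T.obj 0 ⟶ twist T c t where
  app i := (T.map (homOfLE (Fin.zero_le ((intervalChain t).obj i)))).app (c.obj i)
  naturality i j f := by
    exact map_comp_app T _ _ _ _

lemma map_endo (T : Fin 2 ⥤ C ⥤ D) {i : Fin 2} (f : i ⟶ i) (c : C) :
    (T.map f).app c = 𝟙 _ := by
  rw [Subsingleton.elim f (𝟙 _)]
  simp

lemma ι₀_hocolimHomotopy (T : Fin 2 ⥤ C ⥤ D) (η : F ⟶ T.obj 0 ⋙ G) :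
    ι₀ ≫ hocolimHomotopy T η = hocolimMap (T.obj 0) η := by
  ext k ⟨c, x⟩
  symm
  let t := (ι₀.app k (show (hocolim F).obj k from ⟨c, x⟩)).2
  refine hocolim_ext_of_hom (F := G) (p := ⟨c ⋙ T.obj 0, _⟩) (q := ⟨twist T c t, _⟩)
    (zeroToTwist T c t) (fun i => ⟨rfl, (map_endo T (i := 0) _ _)⟩) ?_
  rfl

/-- The homotopy is stationary at chains where the transformation consists of identities. This gives
both its value at the end `1` and, later, its constancy on a retract. -/
lemma hocolimHomotopy_eq_of_eqToHom (T : Fin 2 ⥤ C ⥤ D) (η : F ⟶ T.obj 0 ⋙ G)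
    {k : SimplexCategoryᵒᵖ} (c : ComposableArrows C k.unop.len) (x : (F.obj (c.obj 0)).obj k)
    (t : (Δ[1] : SSet.{u}).obj k) (h : ∀ i, ∃ h, (twistToOne T c t).app i = eqToHom h) :
    (hocolimHomotopy T η).app k (⟨c, x⟩, t) = (⟨c ⋙ T.obj 1,
      (G.map ((T.map (homOfLE (Fin.zero_le 1))).app (c.obj 0))).app k ((η.app (c.obj 0)).app k x)⟩ :
        HocolimSimplex G k) := by
  refine hocolim_ext_of_hom (F := G) (twistToOne T c _) h ?_
  let b : (0 : Fin 2) ⟶ (intervalChain t).obj 0 := homOfLE (Fin.zero_le _)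
  let e : (intervalChain t).obj 0 ⟶ 1 := homOfLE (Fin.le_last _)
  change (G.map ((T.map e).app _)).app k ((G.map ((T.map b).app _)).app k _) = _
  have : (T.map (homOfLE (Fin.zero_le 1))).app (c.obj 0) = (T.map b).app _ ≫ (T.map e).app _ := by
    rw [← NatTrans.comp_app, ← T.map_comp]
    rfl
  rw [this, G.map_comp]
  rfl

lemma ι₁_hocolimHomotopy (T : Fin 2 ⥤ C ⥤ D) (η : F ⟶ T.obj 0 ⋙ G) :
    ι₁ ≫ hocolimHomotopy T η = hocolimMap (T.obj 1)
      (η ≫ Functor.whiskerRight (T.map (homOfLE (Fin.zero_le 1))) G) := by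
  ext k ⟨c, x⟩
  exact hocolimHomotopy_eq_of_eqToHom T η c x _ (fun i => ⟨rfl, map_endo T (i := 1) _ _⟩)

end hocolim

namespace FinInj

/-- Order preserving bijections. -/
def IsOrderIso {m n : FinInj} (f : m ⟶ n) : Prop :=
  Monotone f.toFun ∧ Function.Surjective f.toFun

/-- A bijection forces equal cardinalities, hence equal objects of `I`, and a finite linear order
has no automorphism but the identity. -/
lemma IsOrderIso.exists_eqToHom {m n : FinInj} {f : m ⟶ n} (hf : IsOrderIso f) :
    ∃ h, f = eqToHom h := by
  obtain ⟨m⟩ := m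
  obtain ⟨n⟩ := n
  obtain rfl : m = n := by
    simpa using Fintype.card_congr (Equiv.ofBijective f.toFun ⟨f.injective, hf.2⟩)
  refine ⟨rfl, ?_⟩
  have hs : StrictMono f.toFun := hf.1.strictMono_of_injective f.injective
  apply hom_ext
  intro i
  exact congrArg (fun g : Fin m ≃o Fin m => g i)
    (Subsingleton.elim (hs.orderIsoOfSurjective f.toFun hf.2) (OrderIso.refl _))

end FinInj

lemma SumDiagram.exists_eqToHom {S : Pointed.{0}} {θ θ' : SumDiagram S} (f : θ ⟶ θ')
    (hf : ∀ U, IsOrderIso (f.hom.app U)) : ∃ h, f = eqToHom h := by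
  choose h e using fun U => (hf U).exists_eqToHom
  obtain ⟨θ, hθ⟩ := θ
  obtain ⟨θ', hθ'⟩ := θ'
  obtain rfl : θ = θ' := CategoryTheory.Functor.ext h (fun U V g => by
    have := f.hom.naturality g
    rw [e, e] at this
    rw [← Category.assoc, ← this]
    simp)
  exact ⟨rfl, ObjectProperty.hom_ext _ (NatTrans.ext (funext e))⟩

/-- The working criterion for strict equalities in `X_{hI}(S)`: it suffices to give a natural family
of order preserving bijections that carries one tuple of values to the other. -/
lemma gamma_ext {X : CommIMonoid.{u}} {S : Pointed.{0}} {k : SimplexCategoryᵒᵖ}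
    {p q : HocolimSimplex (X.valueDiagram S) k} (β : p.1 ⟶ q.1)
    (hβ : ∀ i U, IsOrderIso ((β.app i).hom.app U))
    (hx : ∀ s, X.act ((β.app 0).hom.app (single s)) (p.2 s) = q.2 s) : p = q :=
  hocolim_ext_of_hom β (fun i => SumDiagram.exists_eqToHom _ (hβ i)) (funext hx)

lemma h_ext {X : CommIMonoid.{u}} {k : SimplexCategoryᵒᵖ}
    {p q : HocolimSimplex X.diagram k} (β : p.1 ⟶ q.1) (hβ : ∀ i, IsOrderIso (β.app i))
    (hx : X.act (β.app 0) p.2 = q.2) : p = q :=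
  hocolim_ext_of_hom β (fun i => (hβ i).exists_eqToHom) hx

end IGamma

/-! ### Lexicographic sum diagrams -/

namespace IGamma
open Limits HomotopicalAlgebra SSet SSet.modelCategoryQuillen Simplicial FinInj Subsets CommIMonoid

namespace FinInj

section
variable {L : Type} [LinearOrder L]

/-- A finite subset of a linear order as an object of `I`. -/
def ofFinset (A : Finset L) : FinInj := ⟨A.card⟩

/-- The order preserving enumeration of a finite subset of a linear order. -/
def label (A : Finset L) : Fin (ofFinset A).card ↪o L := A.orderEmbOfFin rfl

lemma label_mem (A : Finset L) (i : Fin (ofFinset A).card) : label A i ∈ A :=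
  A.orderEmbOfFin_mem rfl i

lemma exists_label {A : Finset L} {x : L} (hx : x ∈ A) : ∃ i, label A i = x := by
  exact (Finset.range_orderEmbOfFin A rfl).ge hx

lemma ofFinset_hom_ext {m : FinInj} {A : Finset L} {f g : m ⟶ ofFinset A}
    (h : ∀ i, label A (f.toFun i) = label A (g.toFun i)) : f = g :=
  hom_ext fun i => (label A).injective (h i)

/-- The morphism to a finite subset given by an injective map. -/
noncomputable def lift {m : FinInj} (A : Finset L) (f : Fin m.card → L)
    (hf : Function.Injective f) (hA : ∀ i, f i ∈ A) : m ⟶ ofFinset A where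
  toFun i := (exists_label (hA i)).choose
  inj' i j h := hf ((exists_label (hA i)).choose_spec.symm.trans
    ((congrArg (label A) h).trans (exists_label (hA j)).choose_spec))

lemma label_lift {m : FinInj} (A : Finset L) (f : Fin m.card → L)
    (hf : Function.Injective f) (hA : ∀ i, f i ∈ A) (i : Fin m.card) :
    label A ((lift A f hf hA).toFun i) = f i :=
  (exists_label (hA i)).choose_spec

/-- The morphism given by an inclusion of finite subsets. -/
noncomputable def inclusion {A B : Finset L} (h : A ⊆ B) : ofFinset A ⟶ ofFinset B :=
  lift B (label A) (label A).injective fun i => h (label_mem A i)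

lemma label_inclusion {A B : Finset L} (h : A ⊆ B) (i : Fin (ofFinset A).card) :
    label B ((inclusion h).toFun i) = label A i := label_lift _ _ _ _ _

lemma isOrderIso_of_label {m : FinInj} {A : Finset L} {f : m ⟶ ofFinset A}
    (hf : Monotone (fun i => label A (f.toFun i))) (hA : ∀ x ∈ A, ∃ i, label A (f.toFun i) = x) :
    IsOrderIso f := by
  refine ⟨fun i j h => (label A).le_iff_le.1 (hf h), fun j => ?_⟩
  obtain ⟨i, hi⟩ := hA _ (label_mem A j)
  exact ⟨i, (label A).injective hi⟩

end
end FinInj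

/-- The set `S̄` of points of `S` different from the base point. -/
abbrev Pts (S : Pointed.{0}) : Type := {s : S // s ≠ S.point}

lemma single_le {S : Pointed.{0}} {s : Pts S} {U : Subsets S} (h : s.1 ∈ U.1) : single s ≤ U :=
  Set.singleton_subset_iff.2 h

lemma SumDiagram.map_comp_apply {S : Pointed.{0}} (θ : SumDiagram S) {U V W : Subsets S}
    (f : U ⟶ V) (g : V ⟶ W) (h : U ⟶ W) (i : Fin (θ.obj.obj U).card) :
    (θ.obj.map g).toFun ((θ.obj.map f).toFun i) = (θ.obj.map h).toFun i := by
  rw [Subsingleton.elim h (f ≫ g), θ.obj.map_comp]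
  rfl

/-- For distinct points, `θ_{s}` and `θ_{s'}` have disjoint images in the value at `{s, s'}`, and
the map from there to `θ_U` is injective. -/
lemma SumDiagram.map_single_injective {S : Pointed.{0}} (θ : SumDiagram S) {U : Subsets S}
    {s s' : Pts S} (f : single s ⟶ U) (f' : single s' ⟶ U) {i : Fin (θ.obj.obj (single s)).card}
    {j : Fin (θ.obj.obj (single s')).card} (h : (θ.obj.map f).toFun i = (θ.obj.map f').toFun j) :
    s = s' := by
  by_contra hs
  have hd : Disjoint (single s).1 (single s').1 :=
    Set.disjoint_singleton.2 fun e => hs (Subtype.ext e)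
  have hle : union (single s) (single s') ≤ U := Set.union_subset (leOfHom f) (leOfHom f')
  have h' := θ.property _ _ hd
  have e : (θ.obj.map (homOfLE (le_union_left (single s) (single s')))).toFun i =
      (θ.obj.map (homOfLE (le_union_right (single s) (single s')))).toFun j := by
    apply (θ.obj.map (homOfLE hle)).injective
    exact (θ.map_comp_apply _ _ f i).trans (h.trans (θ.map_comp_apply _ _ f' j).symm)
  cases h'.1 (a₁ := Sum.inl i) (a₂ := Sum.inr j) e

section sequences
variable {S : Pointed.{0}} [Finite S] [LinearOrder (Pts S)]

/-- The disjoint union of the sets `n_s`, ordered lexicographically. -/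
abbrev Labels (n : Pts S → FinInj) : Type := Σₗ s : Pts S, Fin (n s).card

/-- The elements of the `n_s` for `s ∈ U`. -/
noncomputable def labelsOver (n : Pts S → FinInj) (U : Subsets S) : Finset (Labels n) :=
  haveI : Finite (Labels n) := inferInstanceAs (Finite (Σ s : Pts S, Fin (n s).card))
  (Set.toFinite (Set.ofPred fun p : Labels n => (ofLex p).1.1 ∈ U.1)).toFinset

lemma mem_labelsOver {n : Pts S → FinInj} {U : Subsets S} {p : Labels n} :
    p ∈ labelsOver n U ↔ (ofLex p).1.1 ∈ U.1 := by
  simp [labelsOver]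

lemma labelsOver_mono (n : Pts S → FinInj) {U V : Subsets S} (h : U ≤ V) :
    labelsOver n U ⊆ labelsOver n V :=
  fun _ hp => mem_labelsOver.2 (h (mem_labelsOver.1 hp))

/-- The sum diagram with `θ_U = ⊔_{s ∈ U} n_s`. -/
noncomputable def sequenceObj (n : Pts S → FinInj) : SumDiagram S where
  obj :=
    { obj := fun U => ofFinset (labelsOver n U)
      map := fun {U V} h => inclusion (labelsOver_mono n (leOfHom h))
      map_id := fun U => ofFinset_hom_ext fun i => label_inclusion _ _
      map_comp := fun f g => ofFinset_hom_ext fun i => (label_inclusion _ _).trans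
        ((label_inclusion (labelsOver_mono n (leOfHom g)) _).trans (label_inclusion _ _)).symm }
  property U V h := by
    have hU := label_inclusion (labelsOver_mono n (le_union_left U V))
    have hV := label_inclusion (labelsOver_mono n (le_union_right U V))
    change Function.Bijective (Sum.elim (inclusion (labelsOver_mono n (le_union_left U V))).toFun
      (inclusion (labelsOver_mono n (le_union_right U V))).toFun)
    refine ⟨?_, fun j => ?_⟩
    · rintro (i | i) (j | j) e
      · exact congrArg Sum.inl (Function.Embedding.injective _ e)
      · have e' := (hU i).symm.trans ((congrArg (label _) e).trans (hV j))
        exact (Set.disjoint_left.1 h (mem_labelsOver.1 (label_mem _ i))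
          (by rw [e']; exact mem_labelsOver.1 (label_mem _ j))).elim
      · have e' := (hV i).symm.trans ((congrArg (label _) e).trans (hU j))
        exact (Set.disjoint_left.1 h (mem_labelsOver.1 (label_mem _ j))
          (by rw [← e']; exact mem_labelsOver.1 (label_mem _ i))).elim
      · exact congrArg Sum.inr (Function.Embedding.injective _ e)
    · obtain hj | hj := mem_labelsOver.1 (label_mem (labelsOver n (union U V)) j)
      · obtain ⟨i, hi⟩ := exists_label (mem_labelsOver.2 hj)
        exact ⟨Sum.inl i, (label _).injective ((hU i).trans hi)⟩
      · obtain ⟨i, hi⟩ := exists_label (mem_labelsOver.2 hj)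
        exact ⟨Sum.inr i, (label _).injective ((hV i).trans hi)⟩

/-- The label of an element of the lexicographic sum. -/
noncomputable def slabel (n : Pts S → FinInj) (U : Subsets S) :
    Fin ((sequenceObj n).obj.obj U).card ↪o Labels n :=
  label (labelsOver n U)

lemma slabel_mem (n : Pts S → FinInj) (U : Subsets S) (i : Fin ((sequenceObj n).obj.obj U).card) :
    (ofLex (slabel n U i)).1.1 ∈ U.1 :=
  mem_labelsOver.1 (label_mem _ i)

lemma exists_slabel {n : Pts S → FinInj} {U : Subsets S} {p : Labels n}
    (hp : (ofLex p).1.1 ∈ U.1) : ∃ i, slabel n U i = p :=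
  exists_label (mem_labelsOver.2 hp)

lemma slabel_map (n : Pts S → FinInj) {U V : Subsets S} (h : U ⟶ V)
    (i : Fin ((sequenceObj n).obj.obj U).card) :
    slabel n V (((sequenceObj n).obj.map h).toFun i) = slabel n U i :=
  label_inclusion (labelsOver_mono n (leOfHom h)) i

lemma sequenceObj_hom_ext {m : FinInj} {n : Pts S → FinInj} {U : Subsets S}
    {f g : m ⟶ (sequenceObj n).obj.obj U}
    (h : ∀ i, slabel n U (f.toFun i) = slabel n U (g.toFun i)) : f = g :=
  ofFinset_hom_ext h

/-- The morphism to a lexicographic sum with given labels. -/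
noncomputable def sequenceLift {m : FinInj} (n : Pts S → FinInj) (U : Subsets S)
    (f : Fin m.card → Labels n) (hf : Function.Injective f) (hU : ∀ i, (ofLex (f i)).1.1 ∈ U.1) :
    m ⟶ (sequenceObj n).obj.obj U :=
  lift _ f hf fun i => mem_labelsOver.2 (hU i)

lemma slabel_sequenceLift {m : FinInj} (n : Pts S → FinInj) (U : Subsets S)
    (f : Fin m.card → Labels n) (hf : Function.Injective f) (hU : ∀ i, (ofLex (f i)).1.1 ∈ U.1)
    (i : Fin m.card) : slabel n U ((sequenceLift n U f hf hU).toFun i) = f i :=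
  label_lift _ _ _ _ _

lemma isOrderIso_of_slabel {m : FinInj} {n : Pts S → FinInj} {U : Subsets S}
    {f : m ⟶ (sequenceObj n).obj.obj U} (hf : Monotone (fun i => slabel n U (f.toFun i)))
    (hU : ∀ p : Labels n, (ofLex p).1.1 ∈ U.1 → ∃ i, slabel n U (f.toFun i) = p) :
    IsOrderIso f :=
  isOrderIso_of_label hf fun p hp => hU p (mem_labelsOver.1 hp)

omit [Finite S] [LinearOrder (Pts S)] in
/-- The morphism of labels given by a family of morphisms. -/
def mapLabels {n n' : Pts S → FinInj} (f : n ⟶ n') (p : Labels n) : Labels n' :=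
  toLex ⟨(ofLex p).1, (f _).toFun (ofLex p).2⟩

omit [Finite S] [LinearOrder (Pts S)] in
lemma mapLabels_injective {n n' : Pts S → FinInj} (f : n ⟶ n') :
    Function.Injective (mapLabels f) := by
  rintro ⟨s, i⟩ ⟨s', j⟩ h
  obtain rfl : s = s' := congrArg (fun p => (ofLex p).1) h
  have : (f s).toFun i = (f s).toFun j := eq_of_heq (Sigma.mk.inj h).2
  rw [(f s).injective this]

/-- The map of lexicographic sums given by a family of morphisms. -/
noncomputable def sequenceMap {n n' : Pts S → FinInj} (f : n ⟶ n') (U : Subsets S) :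
    (sequenceObj n).obj.obj U ⟶ (sequenceObj n').obj.obj U :=
  sequenceLift n' U (fun i => mapLabels f (slabel n U i))
    ((mapLabels_injective f).comp (slabel n U).injective) (fun i => slabel_mem n U i)

lemma slabel_sequenceMap {n n' : Pts S → FinInj} (f : n ⟶ n') (U : Subsets S)
    (i : Fin ((sequenceObj n).obj.obj U).card) :
    slabel n' U ((sequenceMap f U).toFun i) = mapLabels f (slabel n U i) :=
  slabel_sequenceLift _ _ _ _ _ _

/-- The functor taking a family of finite sets to the sum diagram of its lexicographic sums. -/
noncomputable def sequence : (Pts S → FinInj) ⥤ SumDiagram S where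
  obj := sequenceObj
  map {n n'} f := ObjectProperty.homMk
    { app := sequenceMap f
      naturality := fun U V h => sequenceObj_hom_ext fun i =>
        (slabel_sequenceMap f V _).trans ((congrArg (mapLabels f) (slabel_map n h i)).trans
          ((slabel_map n' h _).trans (slabel_sequenceMap f U i)).symm) }
  map_id n := ObjectProperty.hom_ext _ (NatTrans.ext (funext fun U => sequenceObj_hom_ext fun i =>
    slabel_sequenceMap _ _ _))
  map_comp f g := ObjectProperty.hom_ext _ (NatTrans.ext (funext fun U =>
    sequenceObj_hom_ext fun i => (slabel_sequenceMap (f ≫ g) U i).trans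
      ((slabel_sequenceMap g U _).trans (congrArg (mapLabels g) (slabel_sequenceMap f U i))).symm))

/-- The bijection of `n_s` with the value at `{s}` of the sum diagram. -/
noncomputable def toSequence (n : Pts S → FinInj) (s : Pts S) :
    n s ⟶ (sequenceObj n).obj.obj (single s) :=
  sequenceLift n (single s) (fun i => toLex ⟨s, i⟩)
    (fun _ _ h => eq_of_heq (Sigma.mk.inj h).2) (fun _ => rfl)

lemma slabel_toSequence (n : Pts S → FinInj) (s : Pts S) (i : Fin (n s).card) :
    slabel n (single s) ((toSequence n s).toFun i) = toLex ⟨s, i⟩ :=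
  slabel_sequenceLift _ _ _ _ _ _

/-- A lexicographic sum with the single block `n s` is enumerated in the order of `n s`. -/
lemma isOrderIso_toSequence (n : Pts S → FinInj) (s : Pts S) : IsOrderIso (toSequence n s) := by
  refine isOrderIso_of_slabel (fun _ _ h => ?_) (fun p hp => ?_)
  · simp only [slabel_toSequence]
    exact Sigma.Lex.right _ _ h
  · obtain ⟨s', i⟩ := p
    obtain rfl : s' = s := Subtype.ext hp
    exact ⟨i, slabel_toSequence _ _ _⟩

lemma toSequence_naturality {n n' : Pts S → FinInj} (f : n ⟶ n') (s : Pts S) :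
    toSequence n s ≫ sequenceMap f (single s) = f s ≫ toSequence n' s :=
  sequenceObj_hom_ext fun i => (slabel_sequenceMap f _ _).trans
    ((congrArg (mapLabels f) (slabel_toSequence n s i)).trans (slabel_toSequence n' s _).symm)

/-- The values of a sum diagram at the one-point sets. -/
def restrict (s : Pts S) : SumDiagram S ⥤ FinInj := ObjectProperty.ι _ ⋙ (evaluation _ _).obj (single s)

omit [Finite S] [LinearOrder (Pts S)] in
/-- The labels of the lexicographic sum of the `θ_s`. -/
abbrev SumLabels (θ : SumDiagram S) : Type := Labels (fun s => (restrict s).obj θ)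

omit [Finite S] [LinearOrder (Pts S)] in
/-- The element of `θ_U` with a given label. -/
def ofLabel (θ : SumDiagram S) {U : Subsets S} (p : SumLabels θ) (h : (ofLex p).1.1 ∈ U.1) :
    Fin (θ.obj.obj U).card :=
  (θ.obj.map (homOfLE (single_le h))).toFun (ofLex p).2

omit [Finite S] [LinearOrder (Pts S)] in
lemma ofLabel_injective (θ : SumDiagram S) {U : Subsets S} {p q : SumLabels θ}
    (hp : (ofLex p).1.1 ∈ U.1) (hq : (ofLex q).1.1 ∈ U.1) (h : ofLabel θ p hp = ofLabel θ q hq) :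
    p = q := by
  obtain ⟨s, x⟩ := p
  obtain ⟨s', y⟩ := q
  obtain rfl := θ.map_single_injective _ _ h
  obtain rfl := (θ.obj.map (homOfLE (single_le hp))).injective h
  rfl

omit [Finite S] [LinearOrder (Pts S)] in
lemma ofLabel_congr (θ : SumDiagram S) {U : Subsets S} {p q : SumLabels θ}
    (hp : (ofLex p).1.1 ∈ U.1) (h : p = q) : ofLabel θ p hp = ofLabel θ q (h ▸ hp) := by
  subst h
  rfl

omit [Finite S] [LinearOrder (Pts S)] in
lemma map_ofLabel (θ : SumDiagram S) {U V : Subsets S} (h : U ⟶ V) (p : SumLabels θ)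
    (hp : (ofLex p).1.1 ∈ U.1) :
    (θ.obj.map h).toFun (ofLabel θ p hp) = ofLabel θ p (leOfHom h hp) :=
  θ.map_comp_apply _ _ _ _

omit [Finite S] [LinearOrder (Pts S)] in
lemma app_ofLabel {θ θ' : SumDiagram S} (f : θ ⟶ θ') {U : Subsets S} (p : SumLabels θ)
    (hp : (ofLex p).1.1 ∈ U.1) :
    (f.hom.app U).toFun (ofLabel θ p hp) =
      ofLabel θ' (mapLabels (fun s => (restrict s).map f) p) hp :=
  congrArg (fun e : θ.obj.obj (single (ofLex p).1) ⟶ θ'.obj.obj U => e.toFun (ofLex p).2)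
    (f.hom.naturality (homOfLE (single_le hp)))

/-- The map to `θ_U` from the lexicographic sum of the `θ_s`. -/
noncomputable def fromSequenceApp (θ : SumDiagram S) (U : Subsets S) :
    (sequenceObj (fun s => (restrict s).obj θ)).obj.obj U ⟶ θ.obj.obj U where
  toFun i := ofLabel θ (slabel _ U i) (slabel_mem _ U i)
  inj' _ _ h := (slabel _ U).injective (ofLabel_injective θ _ _ h)

/-- The morphism to `θ` from the lexicographic sum of the `θ_s`. -/
noncomputable def fromSequence : Functor.pi' (restrict (S := S)) ⋙ sequence ⟶ 𝟭 _ where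
  app θ := ObjectProperty.homMk
    { app := fromSequenceApp θ
      naturality := fun U V h => FinInj.hom_ext fun i =>
        (ofLabel_congr θ (slabel_mem _ V _) (slabel_map _ h i)).trans
          (map_ofLabel θ h _ (slabel_mem _ U i)).symm }
  naturality _ θ' f := ObjectProperty.hom_ext _ (NatTrans.ext (funext fun U =>
    FinInj.hom_ext fun i =>
      (ofLabel_congr θ' (slabel_mem _ U _) (slabel_sequenceMap _ U i)).trans
        (app_ofLabel f _ (slabel_mem _ U i)).symm))

lemma ofLabel_self (θ : SumDiagram S) (s : Pts S) (i : Fin (θ.obj.obj (single s)).card)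
    (h : s.1 ∈ (single s).1) : ofLabel θ (toLex ⟨s, i⟩ : SumLabels θ) h = i := by
  have e : homOfLE (single_le h) = 𝟙 (single s) := Subsingleton.elim _ _
  change (θ.obj.map (homOfLE (single_le h))).toFun i = i
  rw [e, θ.obj.map_id]
  rfl

/-- At one-point sets `fromSequence` is inverted by `toSequence`; this makes the homotopy built from
it end at the identity, values included. -/
lemma toSequence_fromSequence (θ : SumDiagram S) (s : Pts S) :
    toSequence (fun s => (restrict s).obj θ) s ≫ fromSequenceApp θ (single s) = 𝟙 _ := by
  apply FinInj.hom_ext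
  intro i
  have h := slabel_toSequence (fun s => (restrict s).obj θ) s i
  exact (ofLabel_congr θ (slabel_mem _ (single s) _) h).trans (ofLabel_self θ s i rfl)

/-- Summing lexicographically the blocks of a lexicographic sum reproduces its order, so
`fromSequence` is an identity on diagrams of this form. Here `key` says that an element keeps its
label in the original sum, and `hfst` that the two labels lie in the same block. -/
lemma isOrderIso_fromSequence (n : Pts S → FinInj) (U : Subsets S) :
    IsOrderIso (fromSequenceApp (sequenceObj n) U) := by
  have key : ∀ i, slabel n U ((fromSequenceApp (sequenceObj n) U).toFun i) =
      slabel n (single _) (ofLex (slabel (fun s => (restrict s).obj (sequenceObj n)) U i)).2 :=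
    fun i => slabel_map n (homOfLE (single_le (slabel_mem _ U i))) _
  have hfst : ∀ p : SumLabels (sequenceObj n),
      (ofLex (slabel n (single (ofLex p).1) (ofLex p).2)).1 = (ofLex p).1 :=
    fun p => Subtype.ext (slabel_mem n (single (ofLex p).1) _)
  refine isOrderIso_of_slabel (fun i j h => ?_) (fun p hp => ?_)
  · simp only [key]
    have h' := (slabel (fun s => (restrict s).obj (sequenceObj n)) U).monotone h
    revert h'
    generalize slabel (fun s => (restrict s).obj (sequenceObj n)) U i = p
    generalize slabel (fun s => (restrict s).obj (sequenceObj n)) U j = q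
    intro h'
    obtain ⟨s, x⟩ := p
    obtain ⟨s', y⟩ := q
    cases h' with
    | left _ _ h =>
      exact (Sigma.Lex.lt_def.2 (Or.inl (((hfst ⟨s, x⟩).trans_lt h).trans_eq
        (hfst ⟨s', y⟩).symm))).le
    | right _ _ h => exact (slabel n (single s)).monotone h
  · obtain ⟨j, hj⟩ := exists_slabel (n := n) (U := single (ofLex p).1) (p := p) rfl
    obtain ⟨i, hi⟩ := exists_slabel (n := fun s => (restrict s).obj (sequenceObj n)) (U := U)
      (p := toLex ⟨(ofLex p).1, j⟩) hp
    refine ⟨i, (key i).trans ?_⟩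
    rw [hi]
    exact hj

end sequences
end IGamma

/-! ### The deformation retraction of `X_{hI}(S)` onto a power of `X_{hI}` -/

namespace IGamma
open Limits HomotopicalAlgebra SSet SSet.modelCategoryQuillen Simplicial FinInj Subsets CommIMonoid

section
variable (X : CommIMonoid.{u}) (S : Pointed.{0})

/-- The simplicial set of families of simplices of `X_{hI}` indexed by `S̄`. -/
def families : SSet.{u} where
  obj l := Pts S → HocolimSimplex X.diagram l
  map φ := ↾fun g s => hocolimOp X.diagram φ (g s)
  map_id l := ConcreteCategory.hom_ext _ _ fun g => funext fun s => hocolimOp_id _ _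
  map_comp φ ψ := ConcreteCategory.hom_ext _ _ fun g => funext fun s => hocolimOp_comp _ φ ψ _

/-- The map `X_{hI}(S) ⟶ (X_{hI})^S̄` with components the values at the one-point sets. -/
def toFamilies : hocolim (X.valueDiagram S) ⟶ families X S where
  app l := ↾fun p s => ⟨p.1 ⋙ restrict s, p.2 s⟩
  naturality _ _ _ := rfl

variable {S} [Finite S] [LinearOrder (Pts S)]

lemma toSequence_act {n n' : Pts S → FinInj} (f : n ⟶ n') (s : Pts S) {k : SimplexCategoryᵒᵖ}
    (x : (X.space.obj (n s)).obj k) :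
    X.act (sequenceMap f (single s)) (X.act (toSequence n s) x) =
      X.act (toSequence n' s) (X.act (f s) x) := by
  rw [← act_comp, ← act_comp, toSequence_naturality]

variable (S) in
/-- The map `(X_{hI})^S̄ ⟶ X_{hI}(S)` given by lexicographic sums. -/
noncomputable def ofFamilies : families X S ⟶ hocolim (X.valueDiagram S) where
  app l := ↾fun g => ⟨Functor.pi' (fun s => (g s).1) ⋙ sequence,
    fun s => X.act (toSequence _ s) (g s).2⟩
  naturality l l' φ := by
    ext g
    refine Sigma.ext (by rfl) (heq_of_eq (funext fun s => ?_))
    change X.act (toSequence _ s) (X.act _ (((X.space.obj _).map φ).toFun (g s).2)) =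
      X.act (sequenceMap _ (single s)) (((X.space.obj _).map φ).toFun
        (X.act (toSequence (fun s => (g s).1.obj 0) s) (g s).2))
    have h : ((X.space.obj _).map φ).toFun (X.act (toSequence (fun s => (g s).1.obj 0) s) (g s).2) =
        X.act (toSequence (fun s => (g s).1.obj 0) s) (((X.space.obj _).map φ).toFun (g s).2) :=
      congrArg (fun t => Pointed.Hom.toFun t (g s).2)
        ((X.space.map (toSequence (fun s => (g s).1.obj 0) s)).naturality φ).symm
    refine Eq.symm ((congrArg _ h).trans ?_)
    exact toSequence_act X (n := fun s => (g s).1.obj 0) _ s _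

/-- Strict equality holds because `toSequence` is an order preserving bijection from each `n_s` to
the value of the sum at `{s}`, natural along the chain. -/
lemma ofFamilies_toFamilies : ofFamilies X S ≫ toFamilies X S = 𝟙 _ := by
  ext l g
  funext s
  symm
  refine h_ext (p := g s)
    { app := fun i => toSequence (fun s => (g s).1.obj i) s
      naturality := fun i j f => ?_ } (fun i => isOrderIso_toSequence _ _) rfl
  exact (toSequence_naturality (n := fun s => (g s).1.obj i) (fun s => (g s).1.map f) s).symm

/-- The values at one-point sets, included in the lexicographic sums. -/
noncomputable def valueToSequence : X.valueDiagram S ⟶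
    (Functor.pi' (restrict (S := S)) ⋙ sequence) ⋙ X.valueDiagram S where
  app θ :=
    { app := fun k => ↾fun x s => X.act (toSequence (fun s => (restrict s).obj θ) s) (x s)
      naturality := fun k l φ => ConcreteCategory.hom_ext _ _ fun x => funext fun s =>
        congrArg (fun t => Pointed.Hom.toFun t (x s))
          ((X.space.map (toSequence (fun s => (restrict s).obj θ) s)).naturality φ) }
  naturality θ θ' f := by
    ext k x
    funext s
    exact (toSequence_act X (n := fun s => (restrict s).obj θ) (fun s => (restrict s).map f) s _).symm

variable (S) in
/-- The homotopy from `X_{hI}(S) ⟶ (X_{hI})^S̄ ⟶ X_{hI}(S)` to the identity. -/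
noncomputable def familiesHomotopy :
    hocolim (X.valueDiagram S) ⊗ Δ[1] ⟶ hocolim (X.valueDiagram S) :=
  hocolimHomotopy (ComposableArrows.mk₁ (fromSequence (S := S))) (valueToSequence X)

lemma ι₀_familiesHomotopy : ι₀ ≫ familiesHomotopy X S = toFamilies X S ≫ ofFamilies X S :=
  ι₀_hocolimHomotopy _ _

/-- The values are first moved into the lexicographic sum by `toSequence` and then back by
`fromSequence`, which cancels. -/
lemma ι₁_familiesHomotopy : ι₁ ≫ familiesHomotopy X S = 𝟙 _ := by
  refine (ι₁_hocolimHomotopy _ _).trans ?_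
  ext k ⟨c, x⟩
  refine Sigma.ext (by rfl) (heq_of_eq (funext fun s => ?_))
  refine (act_comp (toSequence _ s) (fromSequenceApp (c.obj 0) (single s)) _).symm.trans ?_
  rw [toSequence_fromSequence]
  exact act_id _

/-- On the image of `ofFamilies` all diagrams are lexicographic sums, where `fromSequence` is an
identity, so the homotopy does not move and agrees throughout with its end at `1`. -/
lemma ofFamilies_familiesHomotopy : ofFamilies X S ▷ _ ≫ familiesHomotopy X S =
    CartesianMonoidalCategory.fst _ _ ≫ ofFamilies X S := by
  ext k ⟨g, t⟩
  refine (hocolimHomotopy_eq_of_eqToHom (ComposableArrows.mk₁ (fromSequence (S := S)))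
    (valueToSequence X) _ _ t (fun i => ?_)).trans ?_
  · have key : ∀ (a : Fin 2) (h : a ≤ 1) (n : Pts S → FinInj), ∃ h',
        ((ComposableArrows.mk₁ (fromSequence (S := S))).map (homOfLE h)).app (sequenceObj n) =
          eqToHom h' := by
      intro a h n
      fin_cases a
      · exact SumDiagram.exists_eqToHom _ fun U => isOrderIso_fromSequence n U
      · exact ⟨rfl, map_endo _ (i := 1) _ _⟩
    exact key _ _ _
  · exact ConcreteCategory.congr_hom (congrArg (fun f => NatTrans.app f k)
      (ι₁_hocolimHomotopy (ComposableArrows.mk₁ (fromSequence (S := S)))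
        (valueToSequence X)).symm) ((ofFamilies X S).app k g) |>.trans
      (ConcreteCategory.congr_hom (congrArg (fun f => NatTrans.app f k)
        (ι₁_familiesHomotopy X (S := S))) ((ofFamilies X S).app k g))

lemma anodyne_ofFamilies : anodyneExtensions (ofFamilies X S) :=
  anodyne_of_deformationRetract (ofFamilies_toFamilies X) (familiesHomotopy X S)
    (ι₀_familiesHomotopy X) (ι₁_familiesHomotopy X) (ofFamilies_familiesHomotopy X)

end
end IGamma

/-! ### Ordered products and the effect of pointed maps -/

namespace IGamma
open Limits HomotopicalAlgebra SSet SSet.modelCategoryQuillen Simplicial FinInj Subsets CommIMonoid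

section
variable {X : CommIMonoid.{u}} {S T : Pointed.{0}} [Finite S]

omit [Finite S] in
lemma ne_point_of_mem {U : Subsets S} {s : S} (h : s ∈ U.1) : s ≠ S.point := by
  rintro rfl
  exact U.2 h

/-- The value of a simplex of `X_{hI}(S)` at a subset of `S̄`. -/
noncomputable def evalAt {k : SimplexCategoryᵒᵖ} (p : HocolimSimplex (X.valueDiagram S) k)
    (U : Subsets S) : HocolimSimplex X.diagram k :=
  ⟨p.1 ⋙ ObjectProperty.ι _ ⋙ (evaluation _ _).obj U, prodOver p.2 U⟩

lemma evalAt_single {k : SimplexCategoryᵒᵖ} (p : HocolimSimplex (X.valueDiagram S) k) (s : Pts S) :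
    evalAt p (single s) = (toFamilies X S).app k p s :=
  Sigma.ext (by rfl) (heq_of_eq (prodOver_single _ s))

lemma prodOver_empty {θ : SumDiagram S} {k : SimplexCategoryᵒᵖ}
    (x : ∀ s : Pts S, X.Val θ k (single s)) :
    prodOver x (Subsets.empty S) = ((X.space.obj _).obj k).point := by
  apply prodOver_eq
  have : members (Subsets.empty S) = ∅ := by
    ext s
    rw [mem_members]
    exact ⟨fun h => h.elim, fun h => absurd h (Finset.notMem_empty _)⟩
  rw [this, Finset.prod_empty]
  rfl

/-- The defining product in the commutative monoid `Partial` splits over the disjoint union of the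
two index sets. -/
lemma prodOver_union {θ : SumDiagram S} {k : SimplexCategoryᵒᵖ}
    (x : ∀ s : Pts S, X.Val θ k (single s)) (U V : Subsets S) (h : Disjoint U.1 V.1) :
    prodOver x (union U V) = join U V h (prodOver x U) (prodOver x V) := by
  classical
  apply prodOver_eq
  have : members (union U V) = members U ∪ members V := by
    ext s
    rw [Finset.mem_union, mem_members, mem_members, mem_members]
    exact Iff.rfl
  rw [this, Finset.prod_union, prodOver_spec, prodOver_spec, val_mul _ _ h]
  rw [Finset.disjoint_left]
  intro s hs hs'
  rw [mem_members] at hs hs'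
  exact Set.disjoint_left.1 h hs hs'

variable [LinearOrder (Pts S)]

/-- The product of the `g_s` for `s ∈ U`, in the order of `S̄`. -/
noncomputable def orderedProduct {k : SimplexCategoryᵒᵖ} (g : Pts S → HocolimSimplex X.diagram k)
    (U : Subsets S) : HocolimSimplex X.diagram k :=
  evalAt ((ofFamilies X S).app k g) U

variable {k : SimplexCategoryᵒᵖ} (g : Pts S → HocolimSimplex X.diagram k)

lemma toFamilies_ofFamilies (g : (families X S).obj k) :
    (toFamilies X S).app k ((ofFamilies X S).app k g) = g :=
  ConcreteCategory.congr_hom (congrArg (fun f => NatTrans.app f k) (ofFamilies_toFamilies X)) g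

lemma orderedProduct_single (s : Pts S) : orderedProduct g (single s) = g s :=
  (evalAt_single _ s).trans (congrFun (toFamilies_ofFamilies g) s)

lemma orderedProduct_empty : orderedProduct g (Subsets.empty S) = 1 := by
  symm
  refine h_ext (X := X) (p := 1) (q := orderedProduct g (Subsets.empty S))
    { app := fun i => (⟨fun j => j.elim0, fun j => j.elim0⟩ : FinInj.zero ⟶ _)
      naturality := fun i j f => zero_hom_ext _ _ }
    (fun i => ⟨fun j => j.elim0, fun j => ?_⟩) ?_
  · exact (slabel_mem (fun s => (g s).1.obj i) (Subsets.empty S) j).elim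
  · exact (act_point _ _).trans
      (prodOver_empty (θ := sequenceObj fun s => (g s).1.obj 0) _).symm

/-- When all of `U` precedes all of `V`, concatenation of the sums over `U` and over `V` is already
the lexicographic order on the sum over the union. -/
lemma isOrderIso_glue (n : Pts S → FinInj) (U V : Subsets S) (h : Disjoint U.1 V.1)
    (hlt : ∀ s s' : Pts S, s.1 ∈ U.1 → s'.1 ∈ V.1 → s < s') :
    IsOrderIso ((sequenceObj n).glue U V h) := by
  have hl : ∀ i, ((sequenceObj n).glue U V h).toFun (Fin.castAdd _ i) =
      ((sequenceObj n).obj.map (homOfLE (le_union_left U V))).toFun i := fun i =>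
    congrArg (fun e : (sequenceObj n).obj.obj U ⟶ (sequenceObj n).obj.obj (union U V) => e.toFun i)
      ((sequenceObj n).inl_glue U V h)
  have hr : ∀ i, ((sequenceObj n).glue U V h).toFun (Fin.natAdd _ i) =
      ((sequenceObj n).obj.map (homOfLE (le_union_right U V))).toFun i := fun i =>
    congrArg (fun e : (sequenceObj n).obj.obj V ⟶ (sequenceObj n).obj.obj (union U V) => e.toFun i)
      ((sequenceObj n).inr_glue U V h)
  refine ⟨fun i j hij => ?_, fun z => ?_⟩
  · rw [← (slabel n _).le_iff_le]
    induction i using Fin.addCases with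
    | left i =>
      induction j using Fin.addCases with
      | left j =>
        rw [hl, hl, slabel_map, slabel_map]
        exact (slabel n U).monotone hij
      | right j =>
        rw [hl, hr, slabel_map, slabel_map]
        exact (Sigma.Lex.lt_def.2 (Or.inl (hlt _ _ (slabel_mem n U i) (slabel_mem n V j)))).le
    | right i =>
      induction j using Fin.addCases with
      | left j =>
        have h₁ : ((sequenceObj n).obj.obj U).card + i.1 ≤ j.1 := hij
        have := j.2
        omega
      | right j =>
        rw [hr, hr, slabel_map, slabel_map]
        exact (slabel n V).monotone ((Fin.natAdd_le_natAdd_iff _).1 hij)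
  · obtain ⟨i | i, rfl⟩ := ((sequenceObj n).property U V h).2 z
    · exact ⟨Fin.castAdd _ i, hl i⟩
    · exact ⟨Fin.natAdd _ i, hr i⟩

/-- The gluing map identifies the concatenated chains strictly by `isOrderIso_glue`, and the values
multiply by `prodOver_union`. With the cases of the empty set and of one point, this shows that
`orderedProduct` is an honest product in the noncommutative monoid `X_{hI}`. -/
lemma orderedProduct_union (U V : Subsets S)
    (hlt : ∀ s s' : Pts S, s.1 ∈ U.1 → s'.1 ∈ V.1 → s < s') :
    orderedProduct g (union U V) = orderedProduct g U * orderedProduct g V := by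
  have h : Disjoint U.1 V.1 := Set.disjoint_left.2 fun s hs hs' =>
    lt_irrefl _ (hlt ⟨s, ne_point_of_mem hs⟩ ⟨s, ne_point_of_mem hs⟩ hs hs')
  symm
  refine h_ext (X := X) (p := orderedProduct g U * orderedProduct g V)
    (q := orderedProduct g (union U V))
    { app := fun i => (sequenceObj fun s => (g s).1.obj i).glue U V h
      naturality := fun i j f => SumDiagram.glue_naturality
        (sequence.map (fun s => (g s).1.map f :
          (fun s => (g s).1.obj i) ⟶ (fun s => (g s).1.obj j))) U V h }
    (fun i => isOrderIso_glue _ U V h hlt) ?_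
  exact (prodOver_union _ U V h).symm

variable [Finite T] [LinearOrder (Pts T)]

/-- If `α` is monotone on the points not sent to the base point, the fibres over smaller points of
`T̄` precede those over larger ones. Summing over each fibre and then over `T̄` gives the same
lexicographic order as summing all at once. -/
lemma isOrderIso_fromSequence_pushforward (α : S ⟶ T)
    (hα : ∀ (s s' : Pts S) (t t' : Pts T), α.toFun s.1 = t.1 → α.toFun s'.1 = t'.1 → s ≤ s' → t ≤ t')
    (n : Pts S → FinInj) (U : Subsets T) :
    IsOrderIso (fromSequenceApp ((SumDiagram.pushforward α).obj (sequenceObj n)) U) := by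
  let θ := (SumDiagram.pushforward α).obj (sequenceObj n)
  have key : ∀ i, slabel n (preimage α U) ((fromSequenceApp θ U).toFun i) =
      slabel n (preimage α (single _)) (ofLex (slabel (fun t => (restrict t).obj θ) U i)).2 :=
    fun i => slabel_map n ((Subsets.pullback α).map (homOfLE (single_le (slabel_mem _ U i)))) _
  refine isOrderIso_of_slabel (n := n) (U := preimage α U) (fun i j h => ?_) (fun p hp => ?_)
  · refine (key i).trans_le (LE.le.trans_eq ?_ (key j).symm)
    have h' := (slabel (fun t => (restrict t).obj θ) U).monotone h
    revert h'
    generalize slabel (fun t => (restrict t).obj θ) U i = p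
    generalize slabel (fun t => (restrict t).obj θ) U j = q
    intro h'
    obtain ⟨t, x⟩ := p
    obtain ⟨t', y⟩ := q
    cases h' with
    | left _ _ h =>
      -- For `t < t'` the block indices in `S̄` must satisfy `s < s'`, since `s' ≤ s` would give `t'
      -- ≤ t` by `hα`.
      refine (Sigma.Lex.lt_def.2 (Or.inl (not_le.1 fun hle => not_le.2 h ?_))).le
      exact hα _ _ t' t (slabel_mem n (preimage α (single t')) y)
        (slabel_mem n (preimage α (single t)) x) hle
    | right _ _ h => exact (slabel n (preimage α (single t))).monotone h
  · let t : Pts T := ⟨α.toFun (ofLex p).1.1, ne_point_of_mem (U := U) hp⟩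
    obtain ⟨j, hj⟩ := exists_slabel (n := n) (U := preimage α (single t)) (p := p) rfl
    obtain ⟨i, hi⟩ := exists_slabel (n := fun t => (restrict t).obj θ) (U := U)
      (p := toLex ⟨t, j⟩) hp
    refine ⟨i, (key i).trans ?_⟩
    rw [hi]
    exact hj

/-- Restricting the pushed-forward simplex to one-point sets gives, by definition, the ordered
products over the fibres. It remains to see that this simplex is the lexicographic sum of its
restrictions, which is the preceding order isomorphism. -/
lemma gammaMap_ofFamilies (α : S ⟶ T)
    (hα : ∀ (s s' : Pts S) (t t' : Pts T), α.toFun s.1 = t.1 → α.toFun s'.1 = t'.1 → s ≤ s' → t ≤ t') :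
    ((X.gammaMap α).app k).toFun ((ofFamilies X S).app k g) =
      (ofFamilies X T).app k (fun t => orderedProduct g (preimage α (single t))) := by
  let p : HocolimSimplex (X.valueDiagram T) k :=
    ((X.gammaMap α).app k).toFun ((ofFamilies X S).app k g)
  symm
  refine gamma_ext (p := (ofFamilies X T).app k ((toFamilies X T).app k p)) (q := p)
    (Functor.whiskerLeft p.1 fromSequence)
    (fun i U => isOrderIso_fromSequence_pushforward α hα (fun s => (g s).1.obj i) U)
    (fun t => ?_)
  refine (act_comp (toSequence _ t) (fromSequenceApp (p.1.obj 0) (single t)) _).symm.trans ?_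
  rw [toSequence_fromSequence]
  exact act_id _

end
end IGamma

/-! ### The Γ-space is special, and the criterion for very special -/

namespace IGamma
open Limits HomotopicalAlgebra SSet SSet.modelCategoryQuillen Simplicial FinInj Subsets CommIMonoid

variable (X : CommIMonoid.{u})

/-- The empty set is disjoint from itself, so an element of `θ_∅` would be hit from both summands of
a coproduct. -/
lemma SumDiagram.isEmpty_of_isEmpty {S : Pointed.{0}} (θ : SumDiagram S) (U : Subsets S)
    (hU : U.1 = ∅) : IsEmpty (Fin (θ.obj.obj U).card) := by
  obtain rfl : U = Subsets.empty S := Subtype.ext hU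
  refine ⟨fun i => ?_⟩
  have h := (θ.property (Subsets.empty S) (Subsets.empty S) (Set.empty_disjoint _)).1
    (a₁ := Sum.inl i) (a₂ := Sum.inr i) rfl
  cases h

lemma isGammaSpace_gammaSpace : IsGammaSpace X.gammaSpace := by
  intro S hS k
  have hU : ∀ U : Subsets S.obj, U.1 = ∅ := fun U => Set.eq_empty_of_forall_notMem fun s hs =>
    ne_point_of_mem hs (Subsingleton.elim _ _)
  refine ⟨fun (p q : HocolimSimplex (X.valueDiagram S.obj) k) => ?_⟩
  have hp : ∀ i U, IsEmpty (Fin ((p.1.obj i).obj.obj U).card) :=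
    fun i U => (p.1.obj i).isEmpty_of_isEmpty U (hU U)
  have hq : ∀ i U, IsEmpty (Fin ((q.1.obj i).obj.obj U).card) :=
    fun i U => (q.1.obj i).isEmpty_of_isEmpty U (hU U)
  refine gamma_ext (p := p) (q := q)
    { app := fun i => ObjectProperty.homMk
        { app := fun U => ⟨fun x => ((hp i U).false x).elim, fun x => ((hp i U).false x).elim⟩
          naturality := fun U V f => FinInj.hom_ext fun x => ((hp i U).false x).elim }
      naturality := fun i j f => ObjectProperty.hom_ext _ (NatTrans.ext (funext fun U =>
        FinInj.hom_ext fun x => ((hp i U).false x).elim)) }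
    (fun i U => ⟨fun x => ((hp i U).false x).elim, fun x => ((hq i U).false x).elim⟩)
    (fun s => (s.2 (Subsingleton.elim _ _)).elim)

/-- An arbitrary order suffices for statements about `toFamilies`, which does not depend on it. -/
lemma exists_linearOrder (S : Pointed.{0}) [Finite S] : Nonempty (LinearOrder (Pts S)) :=
  ⟨LinearOrder.lift' (Finite.equivFin (Pts S)) (Finite.equivFin (Pts S)).injective⟩

lemma isWeakEquivalence_ofFamilies (S : Pointed.{0}) [Finite S] [LinearOrder (Pts S)] :
    IsWeakEquivalence (ofFamilies X S) := by
  have : Mono (ofFamilies X S) := mono_of_mono_fac (ofFamilies_toFamilies X)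
  exact .of_weakAnodyne (anodyne_le_weakAnodyne _ (anodyne_ofFamilies X))

lemma isWeakEquivalence_toFamilies (S : Pointed.{0}) [Finite S] :
    IsWeakEquivalence (toFamilies X S) := by
  obtain ⟨_⟩ := exists_linearOrder S
  refine .of_comp_left (isWeakEquivalence_ofFamilies X S) ?_
  rw [ofFamilies_toFamilies]
  exact .id _

/-- The product of the sections `ofFamilies` is a composite of anodyne maps times identities, hence
anodyne; two-out-of-three then applies. -/
lemma isWeakEquivalence_tensor_toFamilies (S T : Pointed.{0}) [Finite S] [Finite T] :
    IsWeakEquivalence (toFamilies X S ⊗ₘ toFamilies X T) := by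
  obtain ⟨_⟩ := exists_linearOrder S
  obtain ⟨_⟩ := exists_linearOrder T
  have e : (ofFamilies X S ⊗ₘ ofFamilies X T) ≫ (toFamilies X S ⊗ₘ toFamilies X T) = 𝟙 _ := by
    rw [MonoidalCategory.tensorHom_comp_tensorHom, ofFamilies_toFamilies, ofFamilies_toFamilies,
      MonoidalCategory.id_tensorHom_id]
  have : Mono (ofFamilies X S ⊗ₘ ofFamilies X T) := mono_of_mono_fac e
  have h : anodyneExtensions (ofFamilies X S ⊗ₘ ofFamilies X T) := by
    rw [MonoidalCategory.tensorHom_def]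
    exact MorphismProperty.comp_mem _ _ _ ((anodyne_ofFamilies X).whiskerRight _)
      ((anodyne_ofFamilies X).whiskerLeft _)
  refine .of_comp_left (.of_weakAnodyne (anodyne_le_weakAnodyne _ h)) ?_
  rw [e]
  exact .id _

/-- The points of a wedge. -/
def wedgePts (S T : FinPointed) : Pts (wedge S T).obj ≃ Pts S.obj ⊕ Pts T.obj where
  toFun w := match w with
    | ⟨none, h⟩ => (h rfl).elim
    | ⟨some a, _⟩ => a
  invFun a := ⟨some a, fun h => by cases h⟩
  left_inv w := match w with
    | ⟨none, h⟩ => (h rfl).elim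
    | ⟨some a, _⟩ => rfl
  right_inv _ := rfl

/-- Families indexed by a wedge are pairs of families. -/
def familiesWedge (S T : FinPointed) :
    families X (wedge S T).obj ≅ families X S.obj ⊗ families X T.obj where
  hom := CartesianMonoidalCategory.lift
    { app := fun _ => ↾fun g s => g ((wedgePts S T).symm (Sum.inl s)) }
    { app := fun _ => ↾fun g t => g ((wedgePts S T).symm (Sum.inr t)) }
  inv :=
    { app := fun _ => ↾fun p w => Sum.elim p.1 p.2 (wedgePts S T w)
      naturality := fun k l φ => by
        ext p
        funext w
        obtain ⟨w, rfl⟩ := (wedgePts S T).symm.surjective w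
        obtain s | t := w <;> rfl }
  hom_inv_id := by
    ext k p
    funext w
    obtain ⟨w, rfl⟩ := (wedgePts S T).symm.surjective w
    obtain s | t := w <;> rfl
  inv_hom_id := by
    ext k p <;> rfl

lemma preimage_wedgeFst (S T : FinPointed) (s : Pts S.obj) :
    preimage (wedgeFst S T).hom (single s) = single ((wedgePts S T).symm (Sum.inl s)) := by
  apply Subtype.ext
  ext (_ | s' | t)
  · exact ⟨fun h => (s.2 (Eq.symm h)).elim, fun h => by cases h⟩
  · refine ⟨fun h => ?_, fun h => ?_⟩
    · obtain rfl : s' = s := Subtype.ext h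
      rfl
    · cases h
      rfl
  · exact ⟨fun h => (s.2 (Eq.symm h)).elim, fun h => by cases h⟩

lemma preimage_wedgeSnd (S T : FinPointed) (t : Pts T.obj) :
    preimage (wedgeSnd S T).hom (single t) = single ((wedgePts S T).symm (Sum.inr t)) := by
  apply Subtype.ext
  ext (_ | s | t')
  · exact ⟨fun h => (t.2 (Eq.symm h)).elim, fun h => by cases h⟩
  · exact ⟨fun h => (t.2 (Eq.symm h)).elim, fun h => by cases h⟩
  · refine ⟨fun h => ?_, fun h => ?_⟩
    · obtain rfl : t' = t := Subtype.ext h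
      rfl
    · cases h
      rfl

lemma preimage_fold (S : FinPointed) (s : Pts S.obj) :
    preimage (fold S).hom (single s) = union (single ((wedgePts S S).symm (Sum.inl s)))
      (single ((wedgePts S S).symm (Sum.inr s))) := by
  apply Subtype.ext
  ext (_ | s' | s')
  · exact ⟨fun h => (s.2 (Eq.symm h)).elim, fun h => by rcases h with h | h <;> cases h⟩
  · refine ⟨fun h => ?_, fun h => ?_⟩
    · obtain rfl : s' = s := Subtype.ext h
      exact Or.inl rfl
    · rcases h with h | h <;> cases h
      rfl
  · refine ⟨fun h => ?_, fun h => ?_⟩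
    · obtain rfl : s' = s := Subtype.ext h
      exact Or.inr rfl
    · rcases h with h | h <;> cases h
      rfl

/-- The fibre of a wedge projection over a non-base point is a single point. So, after restriction
to one-point sets, the natural map becomes the isomorphism splitting a family over the wedge into
two families. -/
lemma isSpecial_gammaSpace : IsSpecial X.gammaSpace := by
  intro S T
  have : Finite S.obj := S.property
  have : Finite T.obj := T.property
  have : Finite (wedge S T).obj := (wedge S T).property
  refine .of_comp_right (g := toFamilies X S.obj ⊗ₘ toFamilies X T.obj)
    (isWeakEquivalence_tensor_toFamilies X _ _) ?_
  have e : CartesianMonoidalCategory.lift (underlying.map (X.gammaSpace.map (wedgeFst S T)))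
      (underlying.map (X.gammaSpace.map (wedgeSnd S T))) ≫
      (toFamilies X S.obj ⊗ₘ toFamilies X T.obj) =
      toFamilies X (wedge S T).obj ≫ (familiesWedge X S T).hom := by
    ext k p
    · funext s
      exact (congrArg (evalAt p) (preimage_wedgeFst S T s)).trans (evalAt_single _ _)
    · funext t
      exact (congrArg (evalAt p) (preimage_wedgeSnd S T t)).trans (evalAt_single _ _)
  rw [e]
  exact .comp (isWeakEquivalence_toFamilies X _) (.of_isIso _)

section components
variable {S : Pointed.{0}} [Finite S] [LinearOrder (Pts S)]

/-- Read off from the explicit homotopy, which avoids deducing a bijection on components from the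
definition of weak equivalence by maps into Kan complexes. -/
lemma mapπ₀_ofFamilies_toFamilies (a : π₀ (hocolim (X.valueDiagram S))) :
    mapπ₀ (ofFamilies X S) (mapπ₀ (toFamilies X S) a) = a := by
  have h := mapπ₀_eq_of_homotopy (familiesHomotopy X S)
  rw [ι₀_familiesHomotopy, ι₁_familiesHomotopy] at h
  have h' := congrFun h a
  rwa [mapπ₀_comp_apply, mapπ₀_id_apply] at h'

lemma mapπ₀_toFamilies_ofFamilies (a : π₀ (families X S)) :
    mapπ₀ (toFamilies X S) (mapπ₀ (ofFamilies X S) a) = a := by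
  rw [← mapπ₀_comp_apply, ofFamilies_toFamilies, mapπ₀_id_apply]

end components

instance (S : FinPointed) : Finite S.obj := S.property

/-- The non-base point of `S⁰`. -/
def sphereZeroPoint : Pts sphereZero.obj := ⟨true, fun h => Bool.noConfusion h⟩

instance : Subsingleton (Pts sphereZero.obj) := by
  refine ⟨?_⟩
  rintro ⟨_ | _, hs⟩ ⟨_ | _, ht⟩
  · exact (hs rfl).elim
  · exact (hs rfl).elim
  · exact (ht rfl).elim
  · rfl

instance : LinearOrder (Pts sphereZero.obj) := inferInstanceAs (LinearOrder {b : Bool // b ≠ false})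

/-- Points of the first summand precede those of the second, so that the fold map multiplies pairs
in their given order. -/
instance (S T : FinPointed) [LinearOrder (Pts S.obj)] [LinearOrder (Pts T.obj)] :
    LinearOrder (Pts (wedge S T).obj) :=
  LinearOrder.lift' (fun w => toLex (wedgePts S T w)) (wedgePts S T).injective

/-- `X_{hI}` as the simplicial set of families indexed by the single non-base point of `S⁰`. -/
def familiesSphereZero : hocolim X.diagram ≅ families X sphereZero.obj where
  hom := { app := fun _ => ↾fun x _ => x }
  inv := { app := fun _ => ↾fun g => g sphereZeroPoint }
  inv_hom_id := by
    ext k g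
    funext s
    exact congrArg g (Subsingleton.elim _ _)

/-- The bijection from the components of `X_{hI}` to those of `X_{hI}(S⁰)`. -/
noncomputable def componentsEquiv :
    π₀ (hocolim X.diagram) ≃ components (X.gammaSpace.obj sphereZero) where
  toFun a := mapπ₀ (ofFamilies X sphereZero.obj) (mapπ₀ (familiesSphereZero X).hom a)
  invFun b := mapπ₀ (familiesSphereZero X).inv (mapπ₀ (toFamilies X sphereZero.obj) b)
  left_inv a := by
    refine (congrArg (mapπ₀ (familiesSphereZero X).inv)
      (mapπ₀_toFamilies_ofFamilies X (S := sphereZero.obj) _)).trans ?_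
    rw [← mapπ₀_comp_apply, Iso.hom_inv_id, mapπ₀_id_apply]
  right_inv b := by
    refine (congrArg (mapπ₀ (ofFamilies X sphereZero.obj)) ?_).trans
      (mapπ₀_ofFamilies_toFamilies X (S := sphereZero.obj) b)
    refine (mapπ₀_comp_apply (familiesSphereZero X).inv (familiesSphereZero X).hom _).symm.trans ?_
    rw [Iso.inv_hom_id, mapπ₀_id_apply]

lemma componentsEquiv_mk (a : HocolimSimplex X.diagram (op ⦋0⦌)) :
    componentsEquiv X (π₀.mk (X := hocolim X.diagram) a) =
      π₀.mk (X := hocolim (X.valueDiagram sphereZero.obj))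
        ((ofFamilies X sphereZero.obj).app _ fun _ => a) := rfl

/-- The family on `S⁰ ∨ S⁰` given by a pair. -/
def pairFamily {k : SimplexCategoryᵒᵖ} (a b : HocolimSimplex X.diagram k) :
    Pts (wedge sphereZero sphereZero).obj → HocolimSimplex X.diagram k :=
  fun w => Sum.elim (fun _ => a) (fun _ => b) (wedgePts sphereZero sphereZero w)

/-- The component of `X_{hI}(S⁰ ∨ S⁰)` given by a pair of vertices of `X_{hI}`. -/
noncomputable def pairComponent (a b : HocolimSimplex X.diagram (op ⦋0⦌)) :
    components (X.gammaSpace.obj (wedge sphereZero sphereZero)) :=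
  π₀.mk (X := hocolim (X.valueDiagram (wedge sphereZero sphereZero).obj))
    ((ofFamilies X _).app _ (pairFamily X a b))

/-- Choose a vertex of the power of `X_{hI}` representing the image of `w` under `toFamilies`, and
apply `ofFamilies` to return to `w`. -/
lemma exists_pairComponent (w : components (X.gammaSpace.obj (wedge sphereZero sphereZero))) :
    ∃ a b, w = pairComponent X a b := by
  have h := mapπ₀_ofFamilies_toFamilies X (S := (wedge sphereZero sphereZero).obj) w
  obtain ⟨g, hg⟩ := π₀.mk_surjective (mapπ₀ (toFamilies X (wedge sphereZero sphereZero).obj) w)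
  refine ⟨g ((wedgePts sphereZero sphereZero).symm (Sum.inl sphereZeroPoint)),
    g ((wedgePts sphereZero sphereZero).symm (Sum.inr sphereZeroPoint)), ?_⟩
  rw [← h, ← hg]
  refine congrArg (fun g => π₀.mk (X := hocolim (X.valueDiagram (wedge sphereZero sphereZero).obj))
    ((ofFamilies X _).app _ g)) (funext fun w => ?_)
  obtain ⟨w, rfl⟩ := (wedgePts sphereZero sphereZero).symm.surjective w
  obtain s | s := w <;> obtain rfl : s = sphereZeroPoint := Subsingleton.elim _ _ <;> rfl

/-- The order condition of `gammaMap_ofFamilies` is automatic, as `S⁰` has only one non-base point.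
-/
lemma componentsMap_pairComponent (α : wedge sphereZero sphereZero ⟶ sphereZero)
    (a b c : HocolimSimplex X.diagram (op ⦋0⦌))
    (h : orderedProduct (pairFamily X a b) (preimage α.hom (single sphereZeroPoint)) = c) :
    componentsMap (X.gammaSpace.map α) (pairComponent X a b) =
      componentsEquiv X (π₀.mk (X := hocolim X.diagram) c) := by
  rw [componentsEquiv_mk]
  refine congrArg (π₀.mk (X := hocolim (X.valueDiagram sphereZero.obj))) ?_
  refine (gammaMap_ofFamilies (pairFamily X a b) α.hom
    (fun _ _ _ _ _ _ _ => (Subsingleton.elim _ _).le)).trans ?_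
  refine congrArg ((ofFamilies X sphereZero.obj).app (op ⦋0⦌)) (funext fun s => ?_)
  obtain rfl : s = sphereZeroPoint := Subsingleton.elim _ _
  exact h

lemma componentsMap_wedgeFst (a b : HocolimSimplex X.diagram (op ⦋0⦌)) :
    componentsMap (X.gammaSpace.map (wedgeFst _ _)) (pairComponent X a b) =
      componentsEquiv X (π₀.mk (X := hocolim X.diagram) a) := by
  refine componentsMap_pairComponent X _ a b a ?_
  rw [preimage_wedgeFst, orderedProduct_single]
  rfl

lemma componentsMap_wedgeSnd (a b : HocolimSimplex X.diagram (op ⦋0⦌)) :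
    componentsMap (X.gammaSpace.map (wedgeSnd _ _)) (pairComponent X a b) =
      componentsEquiv X (π₀.mk (X := hocolim X.diagram) b) := by
  refine componentsMap_pairComponent X _ a b b ?_
  rw [preimage_wedgeSnd, orderedProduct_single]
  rfl

lemma componentsMap_fold (a b : HocolimSimplex X.diagram (op ⦋0⦌)) :
    componentsMap (X.gammaSpace.map (fold _)) (pairComponent X a b) =
      componentsEquiv X (π₀.mk (X := hocolim X.diagram) (a * b)) := by
  refine componentsMap_pairComponent X _ a b (a * b) ?_
  rw [preimage_fold, orderedProduct_union, orderedProduct_single, orderedProduct_single]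
  · rfl
  · intro w w' hw hw'
    obtain rfl : w = _ := Subtype.ext hw
    obtain rfl : w' = _ := Subtype.ext hw'
    exact Sum.Lex.inl_lt_inr _ _

/-- Group structures are transported along `componentsEquiv`. Pairs of vertices represent all
components over `S⁰ ∨ S⁰`, and on them the two projections and the fold map give `a`, `b` and `a *
b`, so the two compatibility conditions say the same thing. -/
lemma isVerySpecial_gammaSpace_iff :
    IsVerySpecial X.gammaSpace ↔ IsGroupLike X.hSimplicialMonoid := by
  refine ⟨fun ⟨_, hG, h⟩ => ?_, fun ⟨hG, h⟩ => ⟨isSpecial_gammaSpace X, ?_⟩⟩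
  · let G : Group (π₀ (hocolim X.diagram)) := (componentsEquiv X).group
    refine ⟨G, fun a b => (componentsEquiv X).injective ?_⟩
    exact (componentsMap_fold X a b).symm.trans ((h (pairComponent X a b)).symm.trans
      ((congrArg₂ (· * ·) (componentsMap_wedgeFst X a b) (componentsMap_wedgeSnd X a b)).trans
        ((componentsEquiv X).apply_symm_apply _).symm))
  · let _ : Group (π₀ (hocolim X.diagram)) := hG
    let _ : Group (components (X.gammaSpace.obj sphereZero)) := (componentsEquiv X).symm.group
    refine ⟨inferInstance, fun w => ?_⟩
    obtain ⟨a, b, rfl⟩ := exists_pairComponent X w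
    refine (congrArg₂ (· * ·) (componentsMap_wedgeFst X a b) (componentsMap_wedgeSnd X a b)).trans
      (Eq.trans ?_ (componentsMap_fold X a b).symm)
    refine (congrArg (componentsEquiv X) ?_).trans (congrArg (componentsEquiv X) (h a b).symm)
    exact congrArg₂ (· * ·) ((componentsEquiv X).symm_apply_apply _)
      ((componentsEquiv X).symm_apply_apply _)

end IGamma

/-! ### The simplicial circle and the bar construction -/

namespace IGamma
open Limits HomotopicalAlgebra SSet SSet.modelCategoryQuillen Simplicial FinInj Subsets CommIMonoid

lemma Subsets.ext_pts {S : Pointed.{0}} {U V : Subsets S} (h : ∀ s : Pts S, s.1 ∈ U.1 ↔ s.1 ∈ V.1) :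
    U = V :=
  Subtype.ext (Set.ext fun s =>
    ⟨fun hs => (h ⟨s, ne_point_of_mem hs⟩).1 hs, fun hs => (h ⟨s, ne_point_of_mem hs⟩).2 hs⟩)

/-- The map `[k] ⟶ [1]` with value `0` exactly on `0, …, i`. -/
def cut {k : ℕ} (i : Fin k) : Fin (k + 1) →o Fin 2 where
  toFun j := if j ≤ i.castSucc then 0 else 1
  monotone' j j' h := by
    dsimp only
    split_ifs with h₁ h₂ h₂
    · exact le_rfl
    · exact Fin.zero_le _
    · exact absurd (h.trans h₂) h₁
    · exact le_rfl

lemma cut_eq_zero_iff {k : ℕ} (i : Fin k) (j : Fin (k + 1)) : cut i j = 0 ↔ j ≤ i.castSucc := by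
  change (if j ≤ i.castSucc then (0 : Fin 2) else 1) = 0 ↔ _
  split_ifs with h <;> simp [h]

lemma cut_not_const {k : ℕ} (i : Fin k) : ¬ ∃ c, ∀ j, cut i j = c := by
  rintro ⟨c, hc⟩
  have h₀ := (cut_eq_zero_iff i i.castSucc).2 le_rfl
  have h₁ := (cut_eq_zero_iff i i.succ).1 (((hc _).trans (hc _).symm).trans h₀)
  exact absurd h₁ (not_le.2 i.castSucc_lt_succ)

/-- A nonconstant monotone map to `[1]` starts at `0`, ends at `1` and jumps at a unique place. -/
lemma exists_cut {k : ℕ} (f : Fin (k + 1) →o Fin 2) (hf : ¬ ∃ c, ∀ j, f j = c) :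
    ∃ i : Fin k, f = cut i := by
  have h₀ : f 0 = 0 := by
    by_contra h
    refine hf ⟨1, fun j => ?_⟩
    have := f.monotone (Fin.zero_le j)
    omega
  have h₁ : f (Fin.last k) ≠ 0 := fun h => hf ⟨0, fun j => by
    have := f.monotone (Fin.le_last j)
    omega⟩
  obtain ⟨i, hi, hi'⟩ : ∃ i : Fin k, f i.castSucc = 0 ∧ f i.succ ≠ 0 := by
    by_contra! h
    refine h₁ ?_
    have : ∀ j, f j = 0 := fun j => Fin.induction h₀ h j
    exact this _
  refine ⟨i, OrderHom.ext _ _ (funext fun j => ?_)⟩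
  have key : f j = 0 ↔ cut i j = 0 := by
    rw [cut_eq_zero_iff]
    constructor
    · intro h
      by_contra h'
      have := f.monotone (Fin.castSucc_lt_iff_succ_le.1 (not_le.1 h'))
      omega
    · intro h
      have := f.monotone h
      omega
  by_cases h : f j = 0
  · rw [h, key.1 h]
  · have := mt key.2 h
    omega

/-- The non-base points of the set of `k`-simplices of the circle. -/
noncomputable def circlePts (k : SimplexCategoryᵒᵖ) : Fin k.unop.len ≃ Pts (circle.obj k).obj :=
  Equiv.ofBijective (fun i => ⟨Quotient.mk (circleSetoid k.unop.len) (cut i), fun h =>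
    (Quotient.exact h).elim (fun h => cut_not_const i ⟨0, fun j => by rw [h]; rfl⟩)
      (fun h => cut_not_const i h.1)⟩) (by
    constructor
    · intro i j h
      obtain h | h := Quotient.exact (congrArg Subtype.val h)
      · have h' : ∀ l, l ≤ i.castSucc ↔ l ≤ j.castSucc := fun l => by
          rw [← cut_eq_zero_iff, h, cut_eq_zero_iff]
        exact Fin.castSucc_injective _ (le_antisymm ((h' _).1 le_rfl) ((h' _).2 le_rfl))
      · exact (cut_not_const i h.1).elim
    · rintro ⟨f, hf⟩
      induction f using Quotient.inductionOn with | _ f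
      obtain ⟨i, rfl⟩ := exists_cut f fun h => hf (Quotient.sound (Or.inr ⟨h, 0, fun _ => rfl⟩))
      exact ⟨i, rfl⟩)

/-- Points are ordered by the place of the jump, which matches the order of the entries `(g₁, …,
g_k)` in the bar construction. -/
noncomputable instance (k : SimplexCategoryᵒᵖ) : LinearOrder (Pts (circle.obj k).obj) :=
  LinearOrder.lift' (circlePts k).symm (circlePts k).symm.injective

lemma circlePts_le_iff {k : SimplexCategoryᵒᵖ} {i j : Fin k.unop.len} :
    circlePts k i ≤ circlePts k j ↔ i ≤ j := by
  change (circlePts k).symm (circlePts k i) ≤ (circlePts k).symm (circlePts k j) ↔ _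
  rw [Equiv.symm_apply_apply, Equiv.symm_apply_apply]

/-- The composite of the cut at `i` with `φ` is the cut at `t` exactly when it is still `0` at `t`
and already `1` at `t + 1`. The proof compares the sets where the two maps vanish. -/
lemma circle_map_circlePts {k l : SimplexCategoryᵒᵖ} (φ : k ⟶ l) (i : Fin k.unop.len)
    (t : Fin l.unop.len) : (circle.map φ).hom.toFun (circlePts k i).1 = (circlePts l t).1 ↔
      (φ.unop.toOrderHom t.castSucc).1 ≤ i.1 ∧ i.1 < (φ.unop.toOrderHom t.succ).1 := by
  have h : (circle.map φ).hom.toFun (circlePts k i).1 = (circlePts l t).1 ↔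
      (cut i).comp φ.unop.toOrderHom = cut t := by
    constructor
    · intro h
      obtain h | h := Quotient.exact h
      · exact h
      · exact (cut_not_const t h.2).elim
    · intro h
      exact congrArg (Quotient.mk (circleSetoid l.unop.len)) h
  have h' : ∀ j, (cut i).comp φ.unop.toOrderHom j = 0 ↔ (φ.unop.toOrderHom j).1 ≤ i.1 :=
    fun j => cut_eq_zero_iff i _
  rw [h]
  constructor
  · intro e
    rw [← h', e, ← not_le, ← h', e, cut_eq_zero_iff, cut_eq_zero_iff]
    exact ⟨le_rfl, not_le.2 t.castSucc_lt_succ⟩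
  · rintro ⟨h₁, h₂⟩
    refine OrderHom.ext _ _ (funext fun j => ?_)
    have key : (cut i).comp φ.unop.toOrderHom j = 0 ↔ cut t j = 0 := by
      rw [h', cut_eq_zero_iff]
      constructor
      · intro h
        by_contra h₃
        have : φ.unop.toOrderHom t.succ ≤ φ.unop.toOrderHom j :=
          φ.unop.toOrderHom.monotone (Fin.castSucc_lt_iff_succ_le.1 (not_le.1 h₃))
        have : (φ.unop.toOrderHom t.succ).1 ≤ (φ.unop.toOrderHom j).1 := this
        omega
      · intro h
        have : (φ.unop.toOrderHom j).1 ≤ (φ.unop.toOrderHom t.castSucc).1 :=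
          φ.unop.toOrderHom.monotone h
        omega
    by_cases h : cut t j = 0
    · exact (key.2 h).trans h.symm
    · have := mt key.1 h
      change (cut i).comp φ.unop.toOrderHom j = cut t j
      omega

/-- The points of the circle between two vertices of a simplex. -/
def arc (k : SimplexCategoryᵒᵖ) (a b : Fin (k.unop.len + 1)) : Subsets (circle.obj k).obj :=
  ⟨{p | ∃ i : Fin k.unop.len, (circlePts k i).1 = p ∧ a.1 ≤ i.1 ∧ i.1 < b.1},
    fun ⟨i, hi, _⟩ => (circlePts k i).2 hi⟩

lemma circlePts_mem_arc {k : SimplexCategoryᵒᵖ} {a b : Fin (k.unop.len + 1)}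
    {i : Fin k.unop.len} : (circlePts k i).1 ∈ (arc k a b).1 ↔ a.1 ≤ i.1 ∧ i.1 < b.1 :=
  ⟨fun ⟨j, hj, h⟩ => by rwa [← (circlePts k).injective (Subtype.ext hj)], fun h => ⟨i, rfl, h⟩⟩

lemma subsets_circle_ext {k : SimplexCategoryᵒᵖ} {U V : Subsets (circle.obj k).obj}
    (h : ∀ i, (circlePts k i).1 ∈ U.1 ↔ (circlePts k i).1 ∈ V.1) : U = V :=
  Subsets.ext_pts fun s => by
    obtain ⟨i, rfl⟩ := (circlePts k).surjective s
    exact h i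

lemma preimage_circle_map {k l : SimplexCategoryᵒᵖ} (φ : k ⟶ l) (t : Fin l.unop.len) :
    preimage (circle.map φ).hom (single (circlePts l t)) =
      arc k (φ.unop.toOrderHom t.castSucc) (φ.unop.toOrderHom t.succ) :=
  subsets_circle_ext fun i => (circle_map_circlePts φ i t).trans circlePts_mem_arc.symm

lemma arc_self (k : SimplexCategoryᵒᵖ) (a : Fin (k.unop.len + 1)) :
    arc k a a = Subsets.empty _ :=
  subsets_circle_ext fun i => circlePts_mem_arc.trans
    ⟨fun h => absurd h.2 (not_lt.2 h.1), fun h => h.elim⟩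

lemma arc_succ {k : SimplexCategoryᵒᵖ} (i : Fin k.unop.len) :
    arc k i.castSucc i.succ = single (circlePts k i) :=
  subsets_circle_ext fun j => by
    rw [circlePts_mem_arc]
    constructor
    · rintro ⟨h₁, h₂⟩
      have : j = i := Fin.ext (le_antisymm (Nat.lt_succ_iff.1 h₂) h₁)
      subst this
      exact rfl
    · intro h
      obtain rfl := (circlePts k).injective (Subtype.ext h)
      exact ⟨le_rfl, Nat.lt_succ_self _⟩

lemma union_arc {k : SimplexCategoryᵒᵖ} {a b c : Fin (k.unop.len + 1)} (h : a ≤ b) (h' : b ≤ c) :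
    union (arc k a b) (arc k b c) = arc k a c :=
  subsets_circle_ext fun i => by
    have h₁ : a.1 ≤ b.1 := h
    have h₂ : b.1 ≤ c.1 := h'
    refine (or_congr circlePts_mem_arc circlePts_mem_arc).trans (Iff.trans ?_ circlePts_mem_arc.symm)
    omega

section
variable {X : CommIMonoid.{u}} {k l : SimplexCategoryᵒᵖ}

/-- Consecutive arcs are disjoint and the points of the first precede those of the second. -/
lemma orderedProduct_arc (g : Pts (circle.obj k).obj → HocolimSimplex X.diagram l)
    {a b c : Fin (k.unop.len + 1)} (h : a ≤ b) (h' : b ≤ c) :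
    orderedProduct g (arc k a c) = orderedProduct g (arc k a b) * orderedProduct g (arc k b c) := by
  rw [← union_arc h h', orderedProduct_union]
  intro s s' hs hs'
  obtain ⟨i, rfl⟩ := (circlePts k).surjective s
  obtain ⟨i', rfl⟩ := (circlePts k).surjective s'
  rw [circlePts_mem_arc] at hs hs'
  refine not_le.1 fun h => ?_
  have : i'.1 ≤ i.1 := circlePts_le_iff.1 h
  omega

/-- The simplices of the bar construction of the monoid of `l`-simplices of `X_{hI}`. -/
abbrev BarSimplex (X : CommIMonoid.{u}) (k l : SimplexCategoryᵒᵖ) : Type u :=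
  ComposableArrows (SingleObj (HocolimSimplex X.diagram l)ᵐᵒᵖ) k.unop.len

/-- The element of the monoid corresponding to an edge of a simplex of the bar construction. -/
def edge (F : BarSimplex X k l) {a b : Fin (k.unop.len + 1)} (h : a ≤ b) :
    HocolimSimplex X.diagram l :=
  MulOpposite.unop (F.map (homOfLE h))

lemma edge_self (F : BarSimplex X k l) (a : Fin (k.unop.len + 1)) : edge F (le_refl a) = 1 :=
  congrArg MulOpposite.unop (F.map_id a)

/-- The opposite monoid in `bar` compensates for the reversed composition of `SingleObj`, so
consecutive edges multiply from left to right. -/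
lemma edge_mul_edge (F : BarSimplex X k l) {a b c : Fin (k.unop.len + 1)} (h : a ≤ b)
    (h' : b ≤ c) : edge F h * edge F h' = edge F (h.trans h') :=
  (congrArg MulOpposite.unop (F.map_comp (homOfLE h) (homOfLE h'))).symm

/-- The sequence of elements of the monoid corresponding to a simplex of the bar construction. -/
noncomputable def spine (F : BarSimplex X k l) (s : Pts (circle.obj k).obj) :
    HocolimSimplex X.diagram l :=
  edge F ((circlePts k).symm s).castSucc_lt_succ.le

lemma spine_circlePts (F : BarSimplex X k l) (i : Fin k.unop.len) :
    spine F (circlePts k i) = edge F i.castSucc_lt_succ.le := by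
  rw [spine]
  simp only [Equiv.symm_apply_apply]

/-- Induction on the endpoint `b`, adding one edge of the spine at a time: this is the Segal
property of the nerve, with its products expressed by `orderedProduct`. -/
lemma orderedProduct_spine (F : BarSimplex X k l) {a b : Fin (k.unop.len + 1)} (h : a ≤ b) :
    orderedProduct (spine F) (arc k a b) = edge F h := by
  induction b using Fin.induction with
  | zero =>
    obtain rfl : a = 0 := le_antisymm h (Fin.zero_le _)
    rw [arc_self, orderedProduct_empty]
    exact (edge_self F _).symm
  | succ b ih =>
    obtain rfl | h' := h.eq_or_lt
    · rw [arc_self, orderedProduct_empty]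
      exact (edge_self F _).symm
    · have h₁ : a ≤ b.castSucc := Fin.le_castSucc_iff.2 h'
      rw [orderedProduct_arc _ h₁ b.castSucc_lt_succ.le, ih h₁, arc_succ, orderedProduct_single,
        ← edge_mul_edge F h₁ b.castSucc_lt_succ.le, spine_circlePts]

/-- The simplex of the bar construction given by a sequence of elements of the monoid. -/
noncomputable def ofSpine (g : Pts (circle.obj k).obj → HocolimSimplex X.diagram l) :
    BarSimplex X k l where
  obj _ := SingleObj.star _
  map {a b} _ := MulOpposite.op (orderedProduct g (arc k a b))
  map_id a := by
    rw [arc_self, orderedProduct_empty]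
    rfl
  map_comp f f' := congrArg MulOpposite.op (orderedProduct_arc g (leOfHom f) (leOfHom f'))

lemma spine_ofSpine (g : Pts (circle.obj k).obj → HocolimSimplex X.diagram l) :
    spine (ofSpine g) = g := by
  funext s
  obtain ⟨i, rfl⟩ := (circlePts k).surjective s
  refine Eq.trans ?_ (orderedProduct_single g (circlePts k i))
  rw [← arc_succ]
  change orderedProduct g (arc k ((circlePts k).symm (circlePts k i)).castSucc
    ((circlePts k).symm (circlePts k i)).succ) = _
  rw [Equiv.symm_apply_apply]

lemma ofSpine_spine (F : BarSimplex X k l) : ofSpine (spine F) = F := by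
  refine CategoryTheory.Functor.ext (fun _ => rfl) (fun a b f => ?_)
  refine Eq.trans ?_ ((Category.id_comp _).trans (Category.comp_id _)).symm
  exact congrArg MulOpposite.op (orderedProduct_spine F (leOfHom f))

variable (X)

/-- The bisimplicial set `(k, l) ↦ B_k` of the monoid of `l`-simplices of `X_{hI}`. -/
def barRows : SimplicialObject SSet.{u} :=
  Functor.flip (C := SimplexCategoryᵒᵖ) (D := SimplexCategoryᵒᵖ) (E := Pointed.{u})
    (X.hSimplicialMonoid ⋙ bar) ⋙ underlying

/-- The isomorphism of the rows of the bar construction with powers of `X_{hI}`. -/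
noncomputable def spineIso (k : SimplexCategoryᵒᵖ) :
    (barRows X).obj k ≅ families X (circle.obj k).obj :=
  NatIso.ofComponents (fun l => Equiv.toIso
    { toFun := fun F : BarSimplex X k l => spine F
      invFun := fun g => (ofSpine g : BarSimplex X k l)
      left_inv := ofSpine_spine
      right_inv := spine_ofSpine }) (fun _ => rfl)

/-- The fibres over distinct points are disjoint intervals of jump places, in the same order as
those points. -/
lemma circle_map_monotone {k k' : SimplexCategoryᵒᵖ} (φ : k ⟶ k')
    (s s' : Pts (circle.obj k).obj) (t t' : Pts (circle.obj k').obj)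
    (h : (circle.map φ).hom.toFun s.1 = t.1) (h' : (circle.map φ).hom.toFun s'.1 = t'.1)
    (hs : s ≤ s') : t ≤ t' := by
  obtain ⟨i, rfl⟩ := (circlePts k).surjective s
  obtain ⟨i', rfl⟩ := (circlePts k).surjective s'
  obtain ⟨j, rfl⟩ := (circlePts k').surjective t
  obtain ⟨j', rfl⟩ := (circlePts k').surjective t'
  rw [circle_map_circlePts] at h h'
  rw [circlePts_le_iff] at hs ⊢
  by_contra hj
  have h₁ : (φ.unop.toOrderHom j'.succ).1 ≤ (φ.unop.toOrderHom j.castSucc).1 :=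
    φ.unop.toOrderHom.monotone (Fin.succ_le_castSucc_iff.2 (not_le.1 hj))
  have h₂ : i.1 ≤ i'.1 := hs
  omega

/-- The map from the rows of the bar construction of `X_{hI}` to the values `X_{hI}(S¹_k)`. -/
noncomputable def barRowsToGamma :
    barRows X ⟶ circle ⋙ X.gammaSpace ⋙ underlying where
  app k := (spineIso X k).hom ≫ ofFamilies X (circle.obj k).obj
  naturality k k' φ := by
    ext l F
    -- The operator `φ` sends the spine to its ordered products over the arcs from `φ(t)` to `φ(t +
    -- 1)`. These are the edges of `F` between those vertices, which form the spine of the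
    -- restricted simplex.
    refine Eq.symm ((gammaMap_ofFamilies (spine F) (circle.map φ).hom
      (circle_map_monotone φ)).trans ?_)
    refine congrArg ((ofFamilies X (circle.obj k').obj).app l) (funext fun t => ?_)
    obtain ⟨j, rfl⟩ := (circlePts k').surjective t
    rw [preimage_circle_map, orderedProduct_spine F
      (φ.unop.toOrderHom.monotone j.castSucc_lt_succ.le)]
    exact (spine_circlePts (X := X) (l := l)
      (show BarSimplex X k' l from ((barRows X).map φ).app l F) j).symm

lemma mono_barRowsToGamma (k : SimplexCategoryᵒᵖ) : Mono ((barRowsToGamma X).app k) := by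
  have : Mono (ofFamilies X (circle.obj k).obj) := mono_of_mono_fac (ofFamilies_toFamilies X)
  exact @mono_comp _ _ _ _ _ (spineIso X k).hom inferInstance (ofFamilies X (circle.obj k).obj) this

lemma weakAnodyne_barRowsToGamma (k : SimplexCategoryᵒᵖ) :
    weakAnodyne ((barRowsToGamma X).app k) :=
  weakAnodyne.comp_mem _ _ (MorphismProperty.of_isIso _ _)
    (anodyne_le_weakAnodyne _ (anodyne_ofFamilies X))

/-- The realization of the bar construction as a diagonal of its rows. -/
def barIso : underlying.obj (barConstruction.obj X.hSimplicialMonoid) ≅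
    (along (𝟭 _)).obj (barRows X) :=
  NatIso.ofComponents (fun _ => Iso.refl _) (fun {k l} φ => by
    ext F
    rfl)

/-- The map `BX_{hI} ⟶ X_{hI}(S¹)` of underlying simplicial sets. -/
noncomputable def barToGamma : underlying.obj (barConstruction.obj X.hSimplicialMonoid) ⟶
    underlying.obj ((evaluateAt circle).obj X.gammaSpace) :=
  (barIso X).hom ≫ (along (𝟭 _)).map (barRowsToGamma X)

/-- The bar construction is the diagonal of its rows, and the rows map to the values at `S¹_k` by
weakly anodyne monomorphisms, so `weakAnodyne_diag` applies. -/
lemma isWeakEquivalence_barToGamma : IsWeakEquivalence (barToGamma X) := by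
  have := mono_along (𝟭 _) (barRowsToGamma X) (mono_barRowsToGamma X)
  exact .comp (.of_isIso _) (@IsWeakEquivalence.of_weakAnodyne _ _ _ this
    (weakAnodyne_diag _ (mono_barRowsToGamma X) (weakAnodyne_barRowsToGamma X)))

/-- A lexicographic sum of empty sets is empty, and all the maps involved preserve base points; this
is what makes the comparison map based. -/
lemma ofFamilies_one (S : Pointed.{0}) [Finite S] [LinearOrder (Pts S)] (k : SimplexCategoryᵒᵖ) :
    (ofFamilies X S).app k (fun _ => (1 : HocolimSimplex X.diagram k)) =
      ((X.gammaObj S).obj k).point := by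
  have he : ∀ U, IsEmpty (Fin ((sequenceObj (S := S) fun _ => FinInj.zero).obj.obj U).card) :=
    fun U => ⟨fun i => (ofLex (slabel _ U i)).2.elim0⟩
  let β : SumDiagram.zero S ⟶ sequenceObj (fun _ => FinInj.zero) := ObjectProperty.homMk
    { app := fun U => ⟨fun x => x.elim0, fun x => x.elim0⟩
      naturality := fun U V f => zero_hom_ext _ _ }
  have hx : ∀ s, X.act (β.hom.app (single s)) ((X.space.obj FinInj.zero).obj k).point =
      X.act (toSequence (fun _ => FinInj.zero) s) ((X.space.obj FinInj.zero).obj k).point := fun s =>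
    (act_point (β.hom.app (single s)) k).trans
      (act_point (toSequence (fun _ => FinInj.zero) s) k).symm
  symm
  exact gamma_ext (X := X) (p := ((X.gammaObj S).obj k).point)
    (q := (ofFamilies X S).app k (fun _ => (1 : HocolimSimplex X.diagram k)))
    { app := fun _ => β
      naturality := fun i j f => ObjectProperty.hom_ext _ (NatTrans.ext (funext fun U =>
        zero_hom_ext _ _)) }
    (fun i U => ⟨fun x => x.elim0, fun x => ((he U).false x).elim⟩) hx

/-- The chain of sum diagrams depends only on the chains of finite sets, which `f` leaves unchanged;
on values, `f` commutes with the action of `toSequence`. -/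
lemma gammaNat_ofFamilies {X Y : CommIMonoid.{u}} (f : X ⟶ Y) (S : FinPointed)
    [LinearOrder (Pts S.obj)] {k : SimplexCategoryᵒᵖ}
    (g : Pts S.obj → HocolimSimplex X.diagram k) :
    (((gammaNat f).app S).app k).toFun ((ofFamilies X S.obj).app k g) =
      (ofFamilies Y S.obj).app k (fun s => (hMap f).app k (g s)) := by
  refine Sigma.ext (by rfl) (heq_of_eq (funext fun s => ?_))
  exact (congrArg (fun t => Pointed.Hom.toFun (NatTrans.app t k) (g s).2)
    (f.natTrans.naturality (toSequence (fun s => (g s).1.obj 0) s)))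

/-- A map of underlying simplicial sets that preserves base points. -/
def basedMap {K L : BasedSSet.{u}} (f : underlying.obj K ⟶ underlying.obj L)
    (hf : ∀ k, f.app k (K.obj k).point = (L.obj k).point) : K ⟶ L where
  app k := ⟨f.app k, hf k⟩
  naturality _ _ φ := Pointed.Hom.ext (funext fun x => ConcreteCategory.congr_hom (f.naturality φ) x)

lemma barToGamma_point (k : SimplexCategoryᵒᵖ) :
    (barToGamma X).app k ((barConstruction.obj X.hSimplicialMonoid).obj k).point =
      (((evaluateAt circle).obj X.gammaSpace).obj k).point :=
  ofFamilies_one X (circle.obj k).obj k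

lemma barToGamma_naturality {X Y : CommIMonoid.{u}} (f : X ⟶ Y) (k : SimplexCategoryᵒᵖ)
    (F : BarSimplex X k k) :
    (barToGamma Y).app k
        (((barConstruction.map (hMonoidFunctor.map f)).app k).toFun F) =
      (((gammaNat f).app (circle.obj k)).app k).toFun ((barToGamma X).app k F) :=
  (gammaNat_ofFamilies f (circle.obj k) (spine F)).symm

/-- The natural map `BX_{hI} ⟶ X_{hI}(S¹)`. -/
noncomputable def barToGammaNat : hMonoidFunctor.{u} ⋙ barConstruction ⟶
    gammaFunctor ⋙ evaluateAt circle where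
  app X := basedMap (barToGamma X) (barToGamma_point X)
  naturality X Y f := NatTrans.ext (funext fun k => Pointed.Hom.ext (funext fun F =>
    barToGamma_naturality f k F))

end
end IGamma

theorem proposition4p2 :
    (∀ X : IGamma.CommIMonoid.{u},
      IGamma.IsGammaSpace X.gammaSpace ∧ IGamma.IsSpecial X.gammaSpace ∧
      (IGamma.IsVerySpecial X.gammaSpace ↔ IGamma.IsGroupLike X.hSimplicialMonoid)) ∧
    ∃ η : IGamma.CommIMonoid.hMonoidFunctor.{u} ⋙ IGamma.barConstruction ⟶
        IGamma.CommIMonoid.gammaFunctor ⋙ IGamma.evaluateAt IGamma.circle,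
      ∀ X : IGamma.CommIMonoid.{u},
        IGamma.IsWeakEquivalence (IGamma.underlying.map (η.app X)) :=
  ⟨fun X => ⟨IGamma.isGammaSpace_gammaSpace X, IGamma.isSpecial_gammaSpace X,
    IGamma.isVerySpecial_gammaSpace_iff X⟩,
    IGamma.barToGammaNat, IGamma.isWeakEquivalence_barToGamma⟩
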